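/- Let $(M,g)$ be a smooth Hausdorff Riemannian manifold of dimension $n\ge 1$ with constant sectional curvature $\kappa\in\mathbb R$ (for instance a spaceform). Let $\gamma:\mathbb R\to M$ be a geodesic parametrized by arc length, let $(e_1,\dots,e_n)$ be the frame along $\gamma$ obtained by parallel transport of an orthonormal basis of $T_{\gamma(0)}M$ with $e_1(0)=\dot\gamma(0)$ (so $e_1=\dot\gamma$), and let $$\Phi(x^1,\dots,x^n)=\exp_{\gamma(x^1)}\Big(\sum_{k=2}^n x^k e_k(x^1)\Big)$$ be the normal exponential map, which defines the Fermi coordinates $(x^1,\vec x)$ along $\gamma=\{\vec x=0\}$. Let $\Gamma^k_{ij}$ be the Christoffel symbols of the metric $\Phi^*g$. (0) For every $s\in\mathbb R$ one has $\Phi(s,\vec 0)=\gamma(s)$, the map $\Phi$ and all $\Gamma^k_{ij}$ are smooth near $(s,\vec 0)$, and the differential of $\Phi$ at $(s,\vec 0)$ is bijective. (1) For all $m,p\in\{2,\dots,n\}$, all $a,b,i,j\in\{1,\dots,n\}$ and all $s\in\mathbb R$, $$\partial_1\partial_m\Gamma^i_{j1}(s,\vec 0)=0,\qquad \partial_p\partial_m\Gamma^i_{11}(s,\vec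 0)=0,\qquad \partial_1\partial_a\partial_b\Gamma^i_{11}(s,\vec 0)=0 .$$ (2) Let $d\ge 0$, let $\langle\cdot,\cdot\rangle$ be the Minkowski metric of signature $(-,+,\dots,+)$ on $\mathbb R^{1+d}$, $\Box$ its wave operator, $\ell:\mathbb R^{1+d}\to\mathbb R$ linear, and $\sigma=\langle D\ell,D\ell\rangle$. For $u=(u^1,\vec u)$ put $\varphi=(\ell+u^1,\vec u)$. Then for every $K$ there are $C,\delta>0$ such that, for every $x$ with $|\ell(x)|\le K$, every $u:\mathbb R^{1+d}\to\mathbb R^n$ that is $C^2$ near $x$ with $|u(x)|\le\delta$, and every $i$, at $x$ the left side of the wave map equation equals $$\begin{aligned}\Box\varphi^i+\Gamma^i_{jk}(\varphi)\langle D\varphi^j,D\varphi^k\rangle={}&\Box u^i+\sum_{m\ge2}\partial_m\Gamma^i_{11}u^m\sigma+2\sum_{m\ge 2}\partial_m\Gamma^i_{11}u^m\langle Du^1,D\ell\rangle+2\sum_{m,p\ge2}\partial_m\Gamma^i_{p1}u^m\langle Du^p,D\ell\rangle\\&+\sum_{m\ge2}\sum_{j,k\ge 1}\partial_m\Gamma^i_{jk}u^m\langle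 Du^j,Du^k\rangle+\sum_{m,p\ge2}\sum_{j\ge1}\partial_m\partial_p\Gamma^i_{j1}u^mu^p\langle Du^j,D\ell\rangle\\&+\tfrac16\sum_{m,p,q\ge2}\partial_m\partial_p\partial_q\Gamma^i_{11}u^mu^pu^q\,\sigma+\mathcal R^i,\qquad |\mathcal R^i|\le C\big(|u|^4+|Du|^4\big),\end{aligned}$$ where the derivatives of $\Gamma$ on the right are taken at $(\ell(x),\vec 0)$. Thus the only quadratic terms are of the forms $\vec u\cdot\langle D\vec u,D\ell\rangle$ and $\vec u\cdot\langle Du^1,D\ell\rangle$, and the undifferentiated $u^1$ does not occur in the terms up to third order. -/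

import Mathlib

open scoped Manifold ContDiff

noncomputable section

namespace FermiWaveMap

/-- Coordinate space `ℝ^{n+1}`. Coordinate `0` is written `x¹` in mathematical notation, and the
coordinates `m.succ` with `m : Fin n` are `x², …, x^{n+1}`. -/
abbrev Coord (n : ℕ) : Type := EuclideanSpace ℝ (Fin (n + 1))

/-- The `i`-th coordinate vector. -/
def basisVec {n : ℕ} (i : Fin (n + 1)) : Coord n := EuclideanSpace.single i (1 : ℝ)

/-- The partial derivative `∂_i f` at `x`. -/
def pd {n : ℕ} (i : Fin (n + 1)) (f : Coord n → ℝ) (x : Coord n) : ℝ :=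
  fderiv ℝ f x (basisVec i)

section Coordinates

variable {n : ℕ}

/-- The Christoffel symbol `Γ^k_{ij}` of a metric with components `G`. -/
def christoffel (G : Coord n → Matrix (Fin (n + 1)) (Fin (n + 1)) ℝ)
    (k i j : Fin (n + 1)) (y : Coord n) : ℝ :=
  (1 / 2) * ∑ l, (G y)⁻¹ k l *
    (pd i (fun z => G z j l) y + pd j (fun z => G z i l) y - pd l (fun z => G z i j) y)

/-- The component `l` of `R(∂_i, ∂_j) ∂_k`, where
`R(X,Y)Z = ∇_X ∇_Y Z - ∇_Y ∇_X Z - ∇_[X,Y] Z`. -/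
def riemann (G : Coord n → Matrix (Fin (n + 1)) (Fin (n + 1)) ℝ)
    (l i j k : Fin (n + 1)) (y : Coord n) : ℝ :=
  pd i (christoffel G l j k) y - pd j (christoffel G l i k) y
    + ∑ m, (christoffel G l i m y * christoffel G m j k y
      - christoffel G l j m y * christoffel G m i k y)

/-- The bilinear form `⟨v, w⟩` given by `G` at `y`. -/
def pairing (G : Coord n → Matrix (Fin (n + 1)) (Fin (n + 1)) ℝ)
    (y v w : Coord n) : ℝ :=
  ∑ i, ∑ j, G y i j * v i * w j

/-- `⟨R(v,w)w, v⟩` at `y`. -/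
def curvatureForm (G : Coord n → Matrix (Fin (n + 1)) (Fin (n + 1)) ℝ)
    (y v w : Coord n) : ℝ :=
  ∑ i, ∑ j, ∑ k, ∑ l, ∑ q, G y l q * riemann G l i j k y * v i * w j * w k * v q

end Coordinates

section Manifold

variable {n : ℕ} {M : Type*} [TopologicalSpace M] [ChartedSpace (Coord n) M]
  [IsManifold (𝓡 (n + 1)) ∞ M]

/-- Smooth Riemannian metrics on `M`. -/
abbrev Metric (n : ℕ) (M : Type*) [TopologicalSpace M] [ChartedSpace (Coord n) M]
    [IsManifold (𝓡 (n + 1)) ∞ M] : Type _ :=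
  Bundle.ContMDiffRiemannianMetric (𝓡 (n + 1)) ∞ (Coord n)
    (fun x : M => TangentSpace (𝓡 (n + 1)) x)

/-- The components `⟨∂_i ψ, ∂_j ψ⟩_g` of the pull-back of `g` under `ψ`. -/
def pullbackMetric (g : Metric n M) (ψ : Coord n → M) (y : Coord n) :
    Matrix (Fin (n + 1)) (Fin (n + 1)) ℝ :=
  Matrix.of fun i j =>
    g.inner (ψ y) (mfderiv 𝓘(ℝ, Coord n) (𝓡 (n + 1)) ψ y (basisVec i))
      (mfderiv 𝓘(ℝ, Coord n) (𝓡 (n + 1)) ψ y (basisVec j))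

/-- The components of `g` in the chart of `M` around `x₀`. -/
def chartMetric (g : Metric n M) (x₀ : M) : Coord n → Matrix (Fin (n + 1)) (Fin (n + 1)) ℝ :=
  pullbackMetric g (extChartAt (𝓡 (n + 1)) x₀).symm

/-- All sectional curvatures of `g` equal `κ`. For dependent `v, w` both sides vanish. -/
def HasConstantCurvature (g : Metric n M) (κ : ℝ) : Prop :=
  ∀ x₀ : M, ∀ y ∈ (extChartAt (𝓡 (n + 1)) x₀).target, ∀ v w : Coord n,
    curvatureForm (chartMetric g x₀) y v w =
      κ * (pairing (chartMetric g x₀) y v v * pairing (chartMetric g x₀) y w w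
        - pairing (chartMetric g x₀) y v w ^ 2)

/-- The velocity of a curve. -/
def velocity (c : ℝ → M) (t : ℝ) : TangentSpace (𝓡 (n + 1)) (c t) :=
  mfderiv 𝓘(ℝ, ℝ) (𝓡 (n + 1)) c t (1 : ℝ)

/-- The components in the chart around `x₀` of the vector `v` at `x`. -/
def chartComp (x₀ : M) {x : M} (v : TangentSpace (𝓡 (n + 1)) x) : Coord n :=
  mfderiv (𝓡 (n + 1)) 𝓘(ℝ, Coord n) (extChartAt (𝓡 (n + 1)) x₀) x v

/-- The vector field `V` along the smooth curve `c` is parallel on the open set `s`: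
`dV^k/dt + Γ^k_{ij} (dc^i/dt) V^j = 0` in charts. -/
def IsParallelOn (g : Metric n M) (c : ℝ → M) (V : ∀ t, TangentSpace (𝓡 (n + 1)) (c t))
    (s : Set ℝ) : Prop :=
  ∀ t ∈ s, ∀ x₀ : M, c t ∈ (extChartAt (𝓡 (n + 1)) x₀).source → ∀ k : Fin (n + 1),
    HasDerivAt (fun τ => chartComp x₀ (V τ) k)
      (-∑ i, ∑ j, christoffel (chartMetric g x₀) k i j (extChartAt (𝓡 (n + 1)) x₀ (c t))
        * chartComp x₀ (velocity c t) i * chartComp x₀ (V t) j) t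

/-- `c` is a geodesic on the open set `s`: it is smooth and its velocity is parallel. -/
def IsGeodesicOn (g : Metric n M) (c : ℝ → M) (s : Set ℝ) : Prop :=
  ContMDiffOn 𝓘(ℝ, ℝ) (𝓡 (n + 1)) ∞ c s ∧ IsParallelOn g c (velocity c) s

open Classical in
/-- The exponential map: the value at time `1` of the geodesic that starts at `p` with
velocity `v`, where that geodesic lives up to time `1` (always, if `g` is complete). -/
def geodesicExp (g : Metric n M) (p : M) (v : TangentSpace (𝓡 (n + 1)) p) : M :=
  if h : ∃ c : ℝ → M, (∃ ε > 0, IsGeodesicOn g c (Set.Ioo (-ε) (1 + ε))) ∧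
      (⟨c 0, velocity c 0⟩ : TangentBundle (𝓡 (n + 1)) M) = ⟨p, v⟩
  then h.choose 1 else p

/-- `e` is the frame along `γ` obtained by parallel transport of an orthonormal basis at `γ 0`
whose first vector is the velocity of `γ`. -/
structure IsParallelFrame (g : Metric n M) (γ : ℝ → M)
    (e : Fin (n + 1) → ∀ t, TangentSpace (𝓡 (n + 1)) (γ t)) : Prop where
  first : ∀ t, e 0 t = velocity γ t
  parallel : ∀ i, IsParallelOn g γ (e i) Set.univ
  orthonormal : ∀ i j, g.inner (γ 0) (e i 0) (e j 0) = if i = j then 1 else 0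

/-- The normal exponential map in the frame `e`; its inverse gives the Fermi coordinates
(geodesic normal coordinates) along `γ`. -/
def fermiMap (g : Metric n M) (γ : ℝ → M)
    (e : Fin (n + 1) → ∀ t, TangentSpace (𝓡 (n + 1)) (γ t)) (x : Coord n) : M :=
  geodesicExp g (γ (x 0)) (∑ m : Fin n, x m.succ • e m.succ (x 0))

/-- The Christoffel symbol `Γ^k_{ij}` in Fermi coordinates along `γ`. -/
def fermiChristoffel (g : Metric n M) (γ : ℝ → M)
    (e : Fin (n + 1) → ∀ t, TangentSpace (𝓡 (n + 1)) (γ t)) (k i j : Fin (n + 1)) :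
    Coord n → ℝ :=
  christoffel (pullbackMetric g (fermiMap g γ e)) k i j

end Manifold

/-- The point `(s, 0, …, 0)`, which represents `γ s` in Fermi coordinates. -/
def axis (n : ℕ) (s : ℝ) : Coord n := s • basisVec 0

section Minkowski

/-- The Minkowski product `⟨Df, Dh⟩` at `x` on `ℝ^{1+d}`, where coordinate `0` is time. -/
def minkD {d : ℕ} (f h : Coord d → ℝ) (x : Coord d) : ℝ :=
  -(pd 0 f x * pd 0 h x) + ∑ a : Fin d, pd a.succ f x * pd a.succ h x

/-- The wave operator on `ℝ^{1+d}`. -/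
def box {d : ℕ} (f : Coord d → ℝ) (x : Coord d) : ℝ :=
  -pd 0 (pd 0 f) x + ∑ a : Fin d, pd a.succ (pd a.succ f) x

variable {n d : ℕ}

/-- Component `i` of the wave map operator `□φ^i + Γ^i_{jk}(φ) ⟨Dφ^j, Dφ^k⟩`; the map `φ` is a
wave map if it vanishes for all `i`. -/
def waveMapOp (Γ : Fin (n + 1) → Fin (n + 1) → Fin (n + 1) → Coord n → ℝ)
    (φ : Coord d → Coord n) (i : Fin (n + 1)) (x : Coord d) : ℝ :=
  box (fun z => φ z i) x
    + ∑ j, ∑ k, Γ i j k (φ x) * minkD (fun z => φ z j) (fun z => φ z k) x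

/-- The terms linear in `u`: the sum over `m ≥ 2` of `∂_m Γ^i_{11}(ℓ,0) u^m ⟨Dℓ,Dℓ⟩`. -/
def linearPart (Γ : Fin (n + 1) → Fin (n + 1) → Fin (n + 1) → Coord n → ℝ)
    (ℓ : Coord d →L[ℝ] ℝ) (u : Coord d → Coord n) (i : Fin (n + 1)) (x : Coord d) : ℝ :=
  ∑ m : Fin n, pd m.succ (Γ i 0 0) (axis n (ℓ x)) * u x m.succ * minkD ℓ ℓ x

/-- Quadratic terms, of the form `u^m ⟨Du^1, Dℓ⟩` and `u^m ⟨Du^p, Dℓ⟩` with `m, p ≥ 2`. -/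
def quadraticPart (Γ : Fin (n + 1) → Fin (n + 1) → Fin (n + 1) → Coord n → ℝ)
    (ℓ : Coord d →L[ℝ] ℝ) (u : Coord d → Coord n) (i : Fin (n + 1)) (x : Coord d) : ℝ :=
  2 * ∑ m : Fin n, pd m.succ (Γ i 0 0) (axis n (ℓ x)) * u x m.succ
        * minkD (fun z => u z 0) ℓ x
    + 2 * ∑ m : Fin n, ∑ p : Fin n, pd m.succ (Γ i p.succ 0) (axis n (ℓ x)) * u x m.succ
        * minkD (fun z => u z p.succ) ℓ x

/-- Cubic terms; the undifferentiated factors are among the `u^m` with `m ≥ 2`. -/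
def cubicPart (Γ : Fin (n + 1) → Fin (n + 1) → Fin (n + 1) → Coord n → ℝ)
    (ℓ : Coord d →L[ℝ] ℝ) (u : Coord d → Coord n) (i : Fin (n + 1)) (x : Coord d) : ℝ :=
  ∑ m : Fin n, ∑ j, ∑ k, pd m.succ (Γ i j k) (axis n (ℓ x)) * u x m.succ
        * minkD (fun z => u z j) (fun z => u z k) x
    + ∑ m : Fin n, ∑ p : Fin n, ∑ j, pd m.succ (pd p.succ (Γ i j 0)) (axis n (ℓ x))
        * u x m.succ * u x p.succ * minkD (fun z => u z j) ℓ x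
    + (1 / 6) * ∑ m : Fin n, ∑ p : Fin n, ∑ q : Fin n,
        pd m.succ (pd p.succ (pd q.succ (Γ i 0 0))) (axis n (ℓ x))
          * u x m.succ * u x p.succ * u x q.succ * minkD ℓ ℓ x

end Minkowski

end FermiWaveMap

end

/-! In constant curvature the metric in Fermi coordinates has two symmetries: it does not depend on
x¹, and it is even in the normal coordinates. Everything claimed about Γ follows from these. A
Christoffel symbol is a sum of entries of the inverse metric times first derivatives of the metric.
A normal derivative of an even function is odd, and the derivative in direction x¹ is zero, hence
odd as well. So every Γ^k_{ij}, whatever its indices, is independent of x¹ and odd in the normal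
coordinates: each expression containing a ∂_1 vanishes, and so does an even number of derivatives on
the axis (`IsFermiMetric.isFermiFun_christoffel`, `IsFermiFun.pd`, `IsFermiFun.apply_axis`).

The symmetries are obtained without computing the metric. Its coefficients at ξ are inner products,
at time 1, of Jacobi fields along the geodesic t ↦ Φ(ξ¹, tξ⃗). In curvature κ the functions
⟨J_a,J_b⟩, its derivative, and ⟨J_a',J_b'⟩ satisfy a closed linear system, whose coefficients and
initial data involve ξ only through |ξ⃗|² and (a·ξ⃗)(b·ξ⃗). These quantities see neither ξ¹ nor a
common sign of ξ⃗, so uniqueness for the system gives the claim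
(`IsLeviCivitaOn.exists_jacobi_system`, `IsLeviCivitaOn.metric_jac_eq`,
`IsFermiBall.pullbackMetric_eq`). That the frame is parallel and orthonormal enters through the data
at time 0.

Regularity of Φ needs two facts. The exponential map is defined by choosing a geodesic, and
uniqueness of geodesics in a Hausdorff manifold makes the choice irrelevant (`geodesicExp_eq`).
Smooth dependence comes from the implicit function theorem for the integral form of the geodesic
equation in the space of continuous curves on [-1,2], at a constant curve. There the linearized
geodesic field is (y,v) ↦ (v,0), whose square is zero; so the linearized equation is I - V with V² =
0, inverted by I + V, and the solutions live on the whole interval at once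
(`exists_smooth_flow_of_nilpotent`). On the axis the differential of Φ maps the coordinate vectors
to the frame, so the pulled back metric is the identity there and nondegenerate nearby.

For the wave map operator, Γ is expanded at (ℓ,0). Independence of x¹ removes the undifferentiated
u¹, and oddness removes the orders 0 and 2; in particular the cubic sum with second derivatives of Γ
is zero. The term with σ is expanded up to an error of order |u|⁴. The terms that carry a factor Du
need only the first derivative of Γ, since an error |u|³ times |Du| or |Du|² is already of fourth
order (`waveMapOp_expansion`). Compactness of [-K,K] makes the constants uniform. -/

noncomputable section

namespace FermiWaveMap

/-! ### Smoothness of superposition operators on spaces of continuous functions. -/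

section Superposition

open Topology

universe u

variable {K : Type*} [TopologicalSpace K] [CompactSpace K]

/-- Pointwise application of operator-valued continuous functions, as a bilinear map. -/
def pointwiseApply (K : Type*) [TopologicalSpace K] [CompactSpace K] (E F : Type*)
    [NormedAddCommGroup E] [NormedSpace ℝ E] [NormedAddCommGroup F] [NormedSpace ℝ F] :
    C(K, E →L[ℝ] F) →L[ℝ] C(K, E) →L[ℝ] C(K, F) :=
  LinearMap.mkContinuous₂
    (LinearMap.mk₂ ℝ (fun (A : C(K, E →L[ℝ] F)) (a : C(K, E)) =>
        (⟨fun x => A x (a x), A.continuous.clm_apply a.continuous⟩ : C(K, F)))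
      (fun _ _ _ => by ext; simp) (fun _ _ _ => by ext; simp)
      (fun _ _ _ => by ext; simp) (fun _ _ _ => by ext; simp)) 1
    (fun A a => by
      rw [one_mul]
      refine (ContinuousMap.norm_le _ (by positivity)).2 fun x => ?_
      exact ((A x).le_opNorm (a x)).trans
        (mul_le_mul (A.norm_coe_le_norm x) (a.norm_coe_le_norm x) (norm_nonneg _) (norm_nonneg A)))

@[simp] lemma pointwiseApply_apply {E F : Type*}
    [NormedAddCommGroup E] [NormedSpace ℝ E] [NormedAddCommGroup F] [NormedSpace ℝ F]
    (A : C(K, E →L[ℝ] F)) (a : C(K, E)) (x : K) :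
    pointwiseApply K E F A a x = A x (a x) := rfl

variable {E F : Type u} [NormedAddCommGroup E] [NormedSpace ℝ E] [NormedAddCommGroup F]
  [NormedSpace ℝ F]

/-- Composition with f' is continuous in the supremum norm, so f' is close to f'(α x) along the
segment from α x to β x, uniformly in x. The mean value inequality then bounds the error for all x
at once. -/
lemma hasFDerivAt_superposition {f : E → F} {f' : E → E →L[ℝ] F}
    (hf : ∀ x, HasFDerivAt f (f' x) x) (hfc : Continuous f) (hf'c : Continuous f')
    (α : C(K, E)) :
    HasFDerivAt (fun β : C(K, E) => (⟨f, hfc⟩ : C(E, F)).comp β)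
      (pointwiseApply K E F ((⟨f', hf'c⟩ : C(E, E →L[ℝ] F)).comp α)) α := by
  rw [hasFDerivAt_iff_isLittleO, Asymptotics.isLittleO_iff]
  intro ε hε
  have hcont : Continuous fun β : C(K, E) => (⟨f', hf'c⟩ : C(E, E →L[ℝ] F)).comp β :=
    ContinuousMap.continuous_postcomp _
  obtain ⟨δ, hδ, h⟩ := (Metric.continuousAt_iff
    (f := fun β : C(K, E) => (⟨f', hf'c⟩ : C(E, E →L[ℝ] F)).comp β) (a := α)).1
    (by exact hcont.continuousAt) ε hε
  filter_upwards [Metric.ball_mem_nhds α hδ] with β hβ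
  refine (ContinuousMap.norm_le _ (by positivity)).2 fun x => ?_
  have hseg : ∀ y ∈ segment ℝ (α x) (β x), ‖f' y - f' (α x)‖ ≤ ε := by
    rintro y hy
    rw [segment_eq_image'] at hy
    obtain ⟨θ, hθ, rfl⟩ := hy
    -- A point of the segment is the value at x of the curve α + θ(β - α), which lies in the same
    -- ball as β.
    have hb : dist (α + θ • (β - α)) α < δ := by
      rw [dist_eq_norm, add_sub_cancel_left, norm_smul, Real.norm_of_nonneg hθ.1]
      refine lt_of_le_of_lt ?_ (by simpa [dist_eq_norm] using hβ : ‖β - α‖ < δ)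
      exact mul_le_of_le_one_left (norm_nonneg _) hθ.2
    have h1 : dist (f' ((α + θ • (β - α)) x)) (f' (α x)) ≤ ε :=
      (ContinuousMap.dist_apply_le_dist x).trans (h hb).le
    rw [dist_eq_norm] at h1
    exact h1
  have h2 := (convex_segment (α x) (β x)).norm_image_sub_le_of_norm_hasFDerivWithin_le'
    (fun y _ => (hf y).hasFDerivWithinAt) hseg (left_mem_segment ℝ _ _) (right_mem_segment ℝ _ _)
  refine le_trans (by simpa using h2) ?_
  gcongr
  simpa using ContinuousMap.norm_coe_le_norm (β - α) x

/-- The derivative is again a superposition operator, that of `fderiv ℝ f`, followed by a bounded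
linear map. The target must vary in the induction, because it changes from F to E →L[ℝ] F; this is
why E and F share a universe. -/
lemma contDiff_nat_superposition (k : ℕ) : ∀ {F : Type u} [NormedAddCommGroup F] [NormedSpace ℝ F]
    {f : E → F} (hf : ContDiff ℝ ∞ f),
    ContDiff ℝ k (fun β : C(K, E) => (⟨f, hf.continuous⟩ : C(E, F)).comp β) := by
  induction k with
  | zero =>
    intro F _ _ f hf
    exact contDiff_zero.2 (ContinuousMap.continuous_postcomp _)
  | succ k ih =>
    intro F _ _ f hf
    have hf' : ContDiff ℝ ∞ (fderiv ℝ f) := hf.fderiv_right (m := ∞) (by simp)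
    refine contDiff_succ_iff_hasFDerivAt (n := k) |>.2
      ⟨fun α => pointwiseApply K E F ((⟨fderiv ℝ f, hf'.continuous⟩ : C(E, E →L[ℝ] F)).comp α),
        ?_, fun α => ?_⟩
    · exact (pointwiseApply K E F).contDiff.comp (ih hf')
    · exact hasFDerivAt_superposition
        (fun x => (hf.differentiable (by simp) x).hasFDerivAt) hf.continuous hf'.continuous α

/-- The superposition operator `β ↦ f ∘ β` on continuous functions is smooth if `f` is. -/
lemma contDiff_superposition {f : E → F} (hf : ContDiff ℝ ∞ f) :
    ContDiff ℝ ∞ (fun β : C(K, E) => (⟨f, hf.continuous⟩ : C(E, F)).comp β) :=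
  contDiff_infty.2 fun k => contDiff_nat_superposition k hf

end Superposition

/-! ### Integral form of differential equations on a fixed time interval. -/

section Volterra

open Set intervalIntegral

variable {E : Type*} [NormedAddCommGroup E]

/-- The time interval `[-1, 2]`. -/
abbrev TimeIcc : Set ℝ := Icc (-1 : ℝ) 2

/-- Continuous extension of a curve on `[-1, 2]` to the line. -/
def extendCurve (α : C(TimeIcc, E)) (t : ℝ) : E :=
  α (projIcc (-1 : ℝ) 2 (by norm_num) t)

lemma continuous_extendCurve (α : C(TimeIcc, E)) : Continuous (extendCurve α) :=
  α.continuous.comp continuous_projIcc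

lemma extendCurve_coe (α : C(TimeIcc, E)) (t : TimeIcc) : extendCurve α t = α t := by
  simp [extendCurve]

lemma norm_extendCurve_le (α : C(TimeIcc, E)) (t : ℝ) : ‖extendCurve α t‖ ≤ ‖α‖ :=
  α.norm_coe_le_norm _

/-- The operator `α ↦ ∫₀ᵗ α`. -/
def volterra (E : Type*) [NormedAddCommGroup E] [NormedSpace ℝ E] :
    C(TimeIcc, E) →L[ℝ] C(TimeIcc, E) :=
  LinearMap.mkContinuous
    { toFun := fun α => ⟨fun t => ∫ τ in (0 : ℝ)..t, extendCurve α τ,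
        (continuous_primitive (fun _ _ => (continuous_extendCurve α).intervalIntegrable _ _) 0).comp
          continuous_subtype_val⟩
      map_add' := fun α β => by
        ext t
        exact integral_add ((continuous_extendCurve α).intervalIntegrable _ _)
          ((continuous_extendCurve β).intervalIntegrable _ _)
      map_smul' := fun c α => by
        ext t
        exact integral_smul c _ } 2
    (fun α => by
      refine (ContinuousMap.norm_le _ (by positivity)).2 fun t => ?_
      have h := norm_integral_le_of_norm_le_const (a := 0) (b := (t : ℝ)) (C := ‖α‖)
        (f := extendCurve α) (fun x _ => norm_extendCurve_le α x)
      refine h.trans ?_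
      rw [mul_comm]
      gcongr
      rw [abs_le]
      constructor <;> linarith [t.2.1, t.2.2])

variable [NormedSpace ℝ E]

lemma volterra_apply (α : C(TimeIcc, E)) (t : TimeIcc) :
    volterra E α t = ∫ τ in (0 : ℝ)..t, extendCurve α τ := rfl

variable [CompleteSpace E]

/-- Fundamental theorem of calculus. The endpoints are excluded because `extendCurve` is constant
beyond them. -/
lemma hasDerivAt_of_eq_volterra {z : E} {α β : C(TimeIcc, E)}
    (h : ∀ t, α t = z + volterra E β t) {t : ℝ} (ht : t ∈ Ioo (-1 : ℝ) 2) :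
    HasDerivAt (extendCurve α) (extendCurve β t) t := by
  have h1 : HasDerivAt (fun t => z + ∫ τ in (0 : ℝ)..t, extendCurve β τ) (extendCurve β t) t :=
    ((continuous_extendCurve β).integral_hasStrictDerivAt 0 t).hasDerivAt.const_add z
  refine h1.congr_of_eventuallyEq ?_
  filter_upwards [Ioo_mem_nhds ht.1 ht.2] with s hs
  have := h ⟨s, hs.1.le, hs.2.le⟩
  rw [volterra_apply] at this
  rw [← this, ← extendCurve_coe]

end Volterra

/-! ### Smooth dependence on initial values by the implicit function theorem. -/

section Flow

open Set Topology

universe u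

variable {E : Type u} [NormedAddCommGroup E] [NormedSpace ℝ E] [CompleteSpace E]

/-- The implicit function of a smooth equation is smooth in a neighborhood of the base point. -/
lemma eventually_contDiffAt_implicitFunction {F H : Type*} [NormedAddCommGroup F] [NormedSpace ℝ F]
    [CompleteSpace F] [NormedAddCommGroup H] [NormedSpace ℝ H] [CompleteSpace H]
    {Φ : E × F → H} (hΦ : ContDiff ℝ ∞ Φ) {p : E × F}
    (hinv : (fderiv ℝ Φ p ∘L .inr ℝ E F).IsInvertible) :
    ∀ᶠ z in 𝓝 p.1, ContDiffAt ℝ ∞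
      ((hΦ.contDiffAt (x := p)).implicitFunction (by simp) hinv) z := by
  have hp : ContDiffAt ℝ ∞ Φ p := hΦ.contDiffAt
  set S := hp.implicitFunction (by simp) hinv with hS
  have hSp : S p.1 = p.2 := hp.implicitFunction_apply_self (by simp) hinv
  have hSc : ContDiffAt ℝ ∞ S p.1 := hp.contDiffAt_implicitFunction (by simp) hinv
  -- Smoothness at p.1 alone gives, for each finite order, a neighborhood that may shrink with the
  -- order. So the theorem is applied afresh at each nearby z; this requires continuity of S there
  -- and invertibility of the partial derivative, an open condition.
  have hScont : ∀ᶠ z in 𝓝 p.1, ContinuousAt S z :=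
    ((hSc.of_le (m := 1) (by exact ENat.LEInfty.out)).eventually (by simp)).mono
      fun z hz => hz.continuousAt
  have hinvz : ∀ᶠ z in 𝓝 p.1, (fderiv ℝ Φ (z, S z) ∘L .inr ℝ E F).IsInvertible := by
    have h1 : ContinuousAt (fun z => fderiv ℝ Φ (z, S z) ∘L .inr ℝ E F) p.1 := by
      have h2 : ContinuousAt (fun z => fderiv ℝ Φ (z, S z)) p.1 :=
        (hΦ.continuous_fderiv (by simp)).continuousAt.comp
          (continuousAt_id.prodMk hSc.continuousAt)
      exact h2.clm_comp continuousAt_const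
    obtain ⟨e, he⟩ := hinv
    have hpp : (p.1, S p.1) = p := by rw [hSp]
    refine h1.eventually (p := fun A => A.IsInvertible) ?_
    beta_reduce
    rw [hpp, ← he]
    exact ContinuousLinearEquiv.nhds e
  have hev : ∀ᶠ z in 𝓝 p.1, Φ (z, S z) = Φ p := hp.eventually_apply_implicitFunction (by simp) hinv
  filter_upwards [hScont, hinvz, hev.eventually_nhds] with z hz1 hz2 hz3
  have hq : ContDiffAt ℝ ∞ Φ (z, S z) := hΦ.contDiffAt
  have h4 := hq.eventually_apply_eq_iff_implicitFunction (by simp) hz2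
  have h5 : ContinuousAt (fun w => (w, S w)) z := continuousAt_id.prodMk hz1
  -- Local uniqueness of solutions of the equation identifies S with the implicit function based at
  -- z.
  have h6 : S =ᶠ[𝓝 z] hq.implicitFunction (by simp) hz2 := by
    filter_upwards [h5.eventually h4, hz3] with w hw hw'
    exact (hw.1 (hw'.trans hz3.self_of_nhds.symm)).symm
  exact (hq.contDiffAt_implicitFunction (by simp) hz2).congr_of_eventuallyEq h6

/-- Smooth dependence of the solutions of `α' = f α` on the initial value, near a zero of `f` with
nilpotent linearization, over the time interval `[-1, 2]`. -/
theorem exists_smooth_flow_of_nilpotent {f : E → E} (hf : ContDiff ℝ ∞ f) {z₀ : E}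
    (hz₀ : f z₀ = 0) (hnil : ∀ v, fderiv ℝ f z₀ (fderiv ℝ f z₀ v) = 0) :
    ∃ S : E → C(TimeIcc, E), (∀ᶠ z in 𝓝 z₀, ContDiffAt ℝ ∞ S z) ∧ S z₀ = ContinuousMap.const _ z₀ ∧
      ∀ᶠ z in 𝓝 z₀, extendCurve (S z) 0 = z ∧
        ∀ t ∈ Ioo (-1 : ℝ) 2, HasDerivAt (extendCurve (S z)) (f (extendCurve (S z) t)) t := by
  let N : C(TimeIcc, E) → C(TimeIcc, E) := fun β => (⟨f, hf.continuous⟩ : C(E, E)).comp β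
  have hN : ContDiff ℝ ∞ N := contDiff_superposition hf
  let cst : E →L[ℝ] C(TimeIcc, E) :=
    LinearMap.mkContinuous
      { toFun := fun z => ContinuousMap.const _ z
        map_add' := fun _ _ => rfl
        map_smul' := fun _ _ => rfl } 1
      (fun z => by
        rw [one_mul]
        exact (ContinuousMap.norm_le _ (norm_nonneg _)).2 fun _ => le_rfl)
  let A : C(TimeIcc, E) →L[ℝ] C(TimeIcc, E) :=
    pointwiseApply TimeIcc E E ((⟨fderiv ℝ f, (hf.fderiv_right (m := ∞) (by simp)).continuous⟩ :
      C(E, E →L[ℝ] E)).comp (cst z₀))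
  let V := (volterra E).comp A
  -- The zeros of this map are the pairs (z, β) with β(t) = z + ∫₀ᵗ f(β).
  let Φ : E × C(TimeIcc, E) → C(TimeIcc, E) := fun p => p.2 - cst p.1 - volterra E (N p.2)
  have hΦ : ContDiff ℝ ∞ Φ :=
    (contDiff_snd.sub (cst.contDiff.comp contDiff_fst)).sub
      ((volterra E).contDiff.comp (hN.comp contDiff_snd))
  -- At a constant curve the linearization has the constant coefficient f'(z₀), which can be pulled
  -- out of the integral. Two applications of V thus produce f'(z₀)² = 0.
  have hVV : V.comp V = 0 := by
    ext β t
    have h_int : ∀ γ : C(TimeIcc, E), ∀ s, V γ s =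
        fderiv ℝ f z₀ (∫ τ in (0 : ℝ)..s, extendCurve γ τ) := by
      intro γ s
      rw [← ContinuousLinearMap.intervalIntegral_comp_comm _
        ((continuous_extendCurve γ).intervalIntegrable _ _)]
      rfl
    have hz : A (V β) = 0 := by
      ext s
      change fderiv ℝ f z₀ (V β s) = 0
      rw [h_int, hnil]
    change volterra E (A (V β)) t = 0
    rw [hz]; simp
  have hNd : HasFDerivAt N A (cst z₀) :=
    hasFDerivAt_superposition (fun x => (hf.differentiable (by simp) x).hasFDerivAt)
      hf.continuous (hf.fderiv_right (m := ∞) (by simp)).continuous (cst z₀)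
  have hΦd : HasFDerivAt Φ ((ContinuousLinearMap.snd ℝ E C(TimeIcc, E) -
      cst.comp (ContinuousLinearMap.fst ℝ E C(TimeIcc, E))) -
      (volterra E).comp (A.comp (ContinuousLinearMap.snd ℝ E C(TimeIcc, E)))) (z₀, cst z₀) := by
    refine (hasFDerivAt_snd.sub (cst.hasFDerivAt.comp _ hasFDerivAt_fst)).sub ?_
    have h1 : HasFDerivAt (fun p : E × C(TimeIcc, E) => N p.2)
        (A.comp (ContinuousLinearMap.snd ℝ E C(TimeIcc, E))) (z₀, cst z₀) :=
      HasFDerivAt.comp (g := N) (z₀, cst z₀) hNd hasFDerivAt_snd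
    exact (volterra E).hasFDerivAt.comp _ h1
  have hinv : (fderiv ℝ Φ (z₀, cst z₀) ∘L .inr ℝ E C(TimeIcc, E)).IsInvertible := by
    -- The Neumann series of I - V stops after the linear term, since V² = 0.
    refine ⟨ContinuousLinearEquiv.equivOfInverse (ContinuousLinearMap.id ℝ _ - V)
      (ContinuousLinearMap.id ℝ _ + V) (fun β => ?_) (fun β => ?_), ?_⟩
    · have := congrArg (fun L => L β) hVV
      simp only [ContinuousLinearMap.comp_apply, zero_apply] at this
      simp [this]
    · have := congrArg (fun L => L β) hVV
      simp only [ContinuousLinearMap.comp_apply, zero_apply] at this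
      simp [this]
    · rw [hΦd.fderiv]
      ext β t
      simp [V]
  have hΦ0 : Φ (z₀, cst z₀) = 0 := by
    have : N (cst z₀) = 0 := by
      ext t; exact hz₀
    simp [Φ, this]
  have hΦa : ContDiffAt ℝ ∞ Φ (z₀, cst z₀) := hΦ.contDiffAt
  refine ⟨hΦa.implicitFunction (by simp) hinv,
    eventually_contDiffAt_implicitFunction hΦ hinv, hΦa.implicitFunction_apply_self (by simp) hinv, ?_⟩
  filter_upwards [hΦa.eventually_apply_implicitFunction (by simp) hinv] with z hz
  set α := hΦa.implicitFunction (by simp) hinv z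
  rw [hΦ0] at hz
  have hα : ∀ t, α t = z + volterra E (N α) t := by
    intro t
    have := congrArg (fun β : C(TimeIcc, E) => β t) hz
    simp only [Φ, ContinuousMap.sub_apply, ContinuousMap.zero_apply] at this
    rw [sub_sub, sub_eq_zero] at this
    exact this
  refine ⟨?_, fun t ht => hasDerivAt_of_eq_volterra hα ht⟩
  have h0 := hα ⟨0, by norm_num, by norm_num⟩
  rw [volterra_apply] at h0
  have h1 := extendCurve_coe α ⟨0, by norm_num, by norm_num⟩
  simp only at h1
  rw [h1, h0]; simp

end Flow

/-! ### Levi-Civita connections and curvature on open subsets of a vector space. -/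

section LeviCivita

open Topology

variable {E F H : Type*} [NormedAddCommGroup E] [NormedSpace ℝ E]
  [NormedAddCommGroup F] [NormedSpace ℝ F] [NormedAddCommGroup H] [NormedSpace ℝ H]

/-- `B` is the Levi-Civita connection, in the form of its Christoffel symbols, of the smooth
Riemannian metric `G` on the open set `U` of a vector space. -/
structure IsLeviCivitaOn (G : E → E →L[ℝ] E →L[ℝ] ℝ) (B : E → E →L[ℝ] E →L[ℝ] E)
    (U : Set E) : Prop where
  isOpen : IsOpen U
  metric_contDiffAt : ∀ y ∈ U, ContDiffAt ℝ ∞ G y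
  conn_contDiffAt : ∀ y ∈ U, ContDiffAt ℝ ∞ B y
  metric_symm : ∀ y ∈ U, ∀ v w, G y v w = G y w v
  metric_pos : ∀ y ∈ U, ∀ v, v ≠ 0 → 0 < G y v v
  conn_symm : ∀ y ∈ U, ∀ v w, B y v w = B y w v
  compat : ∀ y ∈ U, ∀ u v w,
    fderiv ℝ G y u v w = G y (B y u v) w + G y v (B y u w)

/-- The curvature `R(v, w) z` of the connection with Christoffel symbols `B`. -/
def curv (B : E → E →L[ℝ] E →L[ℝ] E) (y v w z : E) : E :=
  fderiv ℝ B y v w z - fderiv ℝ B y w v z + B y v (B y w z) - B y w (B y v z)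

/-- The covariant derivative in direction `a` of the vector field `V` along `Φ`. -/
def cov (B : E → E →L[ℝ] E →L[ℝ] E) (Φ : F → E) (a : F) (V : F → E) (q : F) : E :=
  fderiv ℝ V q a + B (Φ q) (fderiv ℝ Φ q a) (V q)

lemma hasFDerivAt_bilin_comp {A : E → E →L[ℝ] E →L[ℝ] H} {Φ X Y : F → E} {q : F}
    (hA : DifferentiableAt ℝ A (Φ q)) (hΦ : DifferentiableAt ℝ Φ q)
    (hX : DifferentiableAt ℝ X q) (hY : DifferentiableAt ℝ Y q) (a : F) :
    fderiv ℝ (fun p => A (Φ p) (X p) (Y p)) q a =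
      fderiv ℝ A (Φ q) (fderiv ℝ Φ q a) (X q) (Y q) + A (Φ q) (fderiv ℝ X q a) (Y q)
        + A (Φ q) (X q) (fderiv ℝ Y q a) := by
  have h1 : HasFDerivAt (fun p => A (Φ p)) ((fderiv ℝ A (Φ q)).comp (fderiv ℝ Φ q)) q :=
    HasFDerivAt.comp (g := A) q hA.hasFDerivAt hΦ.hasFDerivAt
  have h2 := (h1.clm_apply hX.hasFDerivAt).clm_apply hY.hasFDerivAt
  rw [h2.fderiv]
  simp
  abel

lemma contDiffAt_bilin_comp {A : E → E →L[ℝ] E →L[ℝ] H} {Φ X Y : F → E} {q : F}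
    (hA : ContDiffAt ℝ ∞ A (Φ q)) (hΦ : ContDiffAt ℝ ∞ Φ q)
    (hX : ContDiffAt ℝ ∞ X q) (hY : ContDiffAt ℝ ∞ Y q) :
    ContDiffAt ℝ ∞ (fun p => A (Φ p) (X p) (Y p)) q :=
  ((hA.comp q hΦ).clm_apply hX).clm_apply hY

lemma contDiffAt_fderiv_apply {V : F → H} {q : F} (hV : ContDiffAt ℝ ∞ V q) (a : F) :
    ContDiffAt ℝ ∞ (fun p => fderiv ℝ V p a) q :=
  (hV.fderiv_right (m := ∞) (by simp)).clm_apply contDiffAt_const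

lemma fderiv_fderiv_apply {V : F → H} {q : F} (hV : ContDiffAt ℝ ∞ V q) (a b : F) :
    fderiv ℝ (fun p => fderiv ℝ V p a) q b = fderiv ℝ (fderiv ℝ V) q b a := by
  have h := ((hV.fderiv_right (m := ∞) (by simp)).differentiableAt (by simp)).hasFDerivAt.clm_apply
    (hasFDerivAt_const a q)
  rw [h.fderiv]; simp

lemma fderiv_fderiv_comm {V : F → H} {q : F} (hV : ContDiffAt ℝ ∞ V q) (a b : F) :
    fderiv ℝ (fderiv ℝ V) q a b = fderiv ℝ (fderiv ℝ V) q b a :=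
  (hV.isSymmSndFDerivAt (by simpa using ENat.LEInfty.out)) a b

lemma ContDiffAt.cov {B : E → E →L[ℝ] E →L[ℝ] E} {Φ V : F → E} {q : F}
    (hB : ContDiffAt ℝ ∞ B (Φ q)) (hΦ : ContDiffAt ℝ ∞ Φ q) (hV : ContDiffAt ℝ ∞ V q) (a : F) :
    ContDiffAt ℝ ∞ (cov B Φ a V) q :=
  (contDiffAt_fderiv_apply hV a).add
    (contDiffAt_bilin_comp hB hΦ (contDiffAt_fderiv_apply hΦ a) hV)

lemma cov_congr {B : E → E →L[ℝ] E →L[ℝ] E} {Φ V W : F → E} {q : F} (h : V =ᶠ[𝓝 q] W) (a : F) :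
    cov B Φ a V q = cov B Φ a W q := by
  simp only [cov, h.fderiv_eq, h.self_of_nhds]

namespace IsLeviCivitaOn

variable {G : E → E →L[ℝ] E →L[ℝ] ℝ} {B : E → E →L[ℝ] E →L[ℝ] E} {U : Set E}

/-- Absence of torsion along a map: second derivatives and Christoffel symbols are both symmetric.
-/
lemma cov_fderiv_comm (h : IsLeviCivitaOn G B U) {Φ : F → E} {q : F} (hq : Φ q ∈ U)
    (hΦ : ContDiffAt ℝ ∞ Φ q) (a b : F) :
    cov B Φ a (fun p => fderiv ℝ Φ p b) q = cov B Φ b (fun p => fderiv ℝ Φ p a) q := by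
  simp only [cov]
  rw [fderiv_fderiv_apply hΦ, fderiv_fderiv_apply hΦ, fderiv_fderiv_comm hΦ, h.conn_symm _ hq]

lemma fderiv_metric_cov (h : IsLeviCivitaOn G B U) {Φ V W : F → E} {q : F} (hq : Φ q ∈ U)
    (hΦ : ContDiffAt ℝ ∞ Φ q) (hV : ContDiffAt ℝ ∞ V q) (hW : ContDiffAt ℝ ∞ W q) (a : F) :
    fderiv ℝ (fun p => G (Φ p) (V p) (W p)) q a =
      G (Φ q) (cov B Φ a V q) (W q) + G (Φ q) (V q) (cov B Φ a W q) := by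
  rw [hasFDerivAt_bilin_comp ((h.metric_contDiffAt _ hq).differentiableAt (by simp))
    (hΦ.differentiableAt (by simp)) (hV.differentiableAt (by simp))
    (hW.differentiableAt (by simp)), h.compat _ hq]
  simp only [cov, map_add, add_apply]
  ring

/-- The directions a, b are constant, so no bracket term arises. In the expansion `key` everything
symmetric in a, b cancels, and the derivative of B and the terms quadratic in B remain. -/
lemma cov_cov_sub (h : IsLeviCivitaOn G B U) {Φ V : F → E} {q : F} (hq : Φ q ∈ U)
    (hΦ : ContDiffAt ℝ ∞ Φ q) (hV : ContDiffAt ℝ ∞ V q) (a b : F) :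
    cov B Φ a (cov B Φ b V) q - cov B Φ b (cov B Φ a V) q =
      curv B (Φ q) (fderiv ℝ Φ q a) (fderiv ℝ Φ q b) (V q) := by
  have hB := h.conn_contDiffAt _ hq
  have key : ∀ a b : F, cov B Φ a (cov B Φ b V) q =
      fderiv ℝ (fderiv ℝ V) q a b +
      (fderiv ℝ B (Φ q) (fderiv ℝ Φ q a) (fderiv ℝ Φ q b) (V q) +
        B (Φ q) (fderiv ℝ (fderiv ℝ Φ) q a b) (V q) + B (Φ q) (fderiv ℝ Φ q b) (fderiv ℝ V q a)) +
      (B (Φ q) (fderiv ℝ Φ q a) (fderiv ℝ V q b) +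
        B (Φ q) (fderiv ℝ Φ q a) (B (Φ q) (fderiv ℝ Φ q b) (V q))) := by
    intro a b
    have h1 : fderiv ℝ (cov B Φ b V) q a = fderiv ℝ (fderiv ℝ V) q a b +
      (fderiv ℝ B (Φ q) (fderiv ℝ Φ q a) (fderiv ℝ Φ q b) (V q) +
        B (Φ q) (fderiv ℝ (fderiv ℝ Φ) q a b) (V q) +
        B (Φ q) (fderiv ℝ Φ q b) (fderiv ℝ V q a)) := by
      have h2 : fderiv ℝ (cov B Φ b V) q = fderiv ℝ (fun p => fderiv ℝ V p b) q +
          fderiv ℝ (fun p => B (Φ p) (fderiv ℝ Φ p b) (V p)) q :=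
        fderiv_add ((contDiffAt_fderiv_apply hV b).differentiableAt (by simp))
          ((contDiffAt_bilin_comp hB hΦ (contDiffAt_fderiv_apply hΦ b) hV).differentiableAt
            (by simp))
      rw [h2, add_apply, fderiv_fderiv_apply hV,
        hasFDerivAt_bilin_comp (hB.differentiableAt (by simp)) (hΦ.differentiableAt (by simp))
          ((contDiffAt_fderiv_apply hΦ b).differentiableAt (by simp))
          (hV.differentiableAt (by simp)), fderiv_fderiv_apply hΦ]
    rw [cov, h1]
    simp only [cov, map_add]
  rw [key, key, fderiv_fderiv_comm hV a b, fderiv_fderiv_comm hΦ a b, curv]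
  abel

lemma curv_skew_left (y v w z : E) : curv B y v w z = -curv B y w v z := by
  simp only [curv]; abel

lemma fderiv_conn_symm (h : IsLeviCivitaOn G B U) {y : E} (hy : y ∈ U) (u v w : E) :
    fderiv ℝ B y u v w = fderiv ℝ B y u w v := by
  have hB := (h.conn_contDiffAt y hy).differentiableAt (by simp)
  have key : ∀ v w : E, fderiv ℝ (fun p => B p v w) y u = fderiv ℝ B y u v w := by
    intro v w
    rw [((hB.hasFDerivAt.clm_apply (hasFDerivAt_const v y)).clm_apply
      (hasFDerivAt_const w y)).fderiv]
    simp
  rw [← key, ← key]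
  have : (fun p => B p v w) =ᶠ[𝓝 y] fun p => B p w v := by
    filter_upwards [h.isOpen.mem_nhds hy] with p hp using h.conn_symm p hp v w
  rw [this.fderiv_eq]

lemma curv_bianchi (h : IsLeviCivitaOn G B U) {y : E} (hy : y ∈ U) (u v w : E) :
    curv B y u v w + curv B y v w u + curv B y w u v = 0 := by
  simp only [curv]
  rw [h.fderiv_conn_symm hy u w v, h.fderiv_conn_symm hy v w u, h.fderiv_conn_symm hy w v u,
    h.conn_symm y hy w v, h.conn_symm y hy v u, h.conn_symm y hy w u]
  abel

/-- The second derivative of the scalar function p ↦ G p z u is symmetric. Metric compatibility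
expresses it through B, and its antisymmetric part in v, w is ⟨R(v,w)z, u⟩ + ⟨z, R(v,w)u⟩. -/
lemma metric_curv_skew_right (h : IsLeviCivitaOn G B U) {y : E} (hy : y ∈ U) (v w z u : E) :
    G y (curv B y v w z) u = -G y z (curv B y v w u) := by
  have hG := h.metric_contDiffAt y hy
  have hB := h.conn_contDiffAt y hy
  set f : E → ℝ := fun p => G p z u with hf
  have hfc : ContDiffAt ℝ ∞ f y := contDiffAt_bilin_comp (Φ := id) (X := fun _ => z)
    (Y := fun _ => u) hG contDiffAt_id contDiffAt_const contDiffAt_const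
  have key : ∀ v w : E, fderiv ℝ (fderiv ℝ f) y v w =
      G y (B y v (B y w z)) u + G y (B y w z) (B y v u) + G y (fderiv ℝ B y v w z) u +
      (G y (B y v z) (B y w u) + G y z (B y v (B y w u)) + G y z (fderiv ℝ B y v w u)) := by
    intro v w
    have h2 : (fun p => fderiv ℝ f p w) =ᶠ[𝓝 y]
        fun p => G p (B p w z) u + G p z (B p w u) := by
      filter_upwards [h.isOpen.mem_nhds hy] with p hp
      rw [← h.compat p hp w z u, ((((h.metric_contDiffAt p hp).differentiableAt
        (by simp)).hasFDerivAt.clm_apply (hasFDerivAt_const z p)).clm_apply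
        (hasFDerivAt_const u p)).fderiv]
      simp
    have hBc : ∀ z : E, ContDiffAt ℝ ∞ (fun p => B p w z) y := fun z =>
      contDiffAt_bilin_comp (Φ := id) (X := fun _ => w) (Y := fun _ => z) hB contDiffAt_id
        contDiffAt_const contDiffAt_const
    have hBd : ∀ z : E, fderiv ℝ (fun p => B p w z) y v = fderiv ℝ B y v w z := by
      intro z
      rw [(((hB.differentiableAt (by simp)).hasFDerivAt.clm_apply
        (hasFDerivAt_const w y)).clm_apply (hasFDerivAt_const z y)).fderiv]
      simp
    have h3 := h.fderiv_metric_cov (Φ := id) (V := fun p => B p w z) (W := fun _ => u) (q := y) hy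
      contDiffAt_id (hBc z) contDiffAt_const v
    have h4 := h.fderiv_metric_cov (Φ := id) (V := fun _ => z) (W := fun p => B p w u) (q := y) hy
      contDiffAt_id contDiffAt_const (hBc u) v
    have hs : fderiv ℝ (fun p => G p (B p w z) u + G p z (B p w u)) y v =
        fderiv ℝ (fun p => G (id p) (B p w z) u) y v +
          fderiv ℝ (fun p => G (id p) z (B p w u)) y v := by
      have e := fderiv_add (𝕜 := ℝ) (x := y) (f := fun p => G p (B p w z) u)
        (g := fun p => G p z (B p w u))
        ((contDiffAt_bilin_comp (Φ := id) hG contDiffAt_id (hBc z)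
          contDiffAt_const).differentiableAt (by simp))
        ((contDiffAt_bilin_comp (Φ := id) hG contDiffAt_id contDiffAt_const
          (hBc u)).differentiableAt (by simp))
      exact congrArg (fun L => L v) e
    rw [← fderiv_fderiv_apply hfc, h2.fderiv_eq, hs, h3, h4]
    simp only [cov, fderiv_id, id, ContinuousLinearMap.id_apply, hBd, map_add, add_apply,
      fderiv_fun_const, Pi.zero_apply, zero_apply, zero_add]
    ring
  have h6 := fderiv_fderiv_comm hfc v w
  rw [key, key] at h6
  simp only [curv, map_add, map_sub, add_apply, sub_apply]
  linarith

/-- The classical octahedron argument: a combination of four instances of the first Bianchi identity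
and the two skew symmetries. -/
lemma metric_curv_pair_symm (h : IsLeviCivitaOn G B U) {y : E} (hy : y ∈ U) (v w z u : E) :
    G y (curv B y v w z) u = G y (curv B y z u v) w := by
  have sk1 : ∀ a b c d : E, G y (curv B y a b c) d = -G y (curv B y b a c) d := by
    intro a b c d; rw [curv_skew_left]; simp
  have sk2 : ∀ a b c d : E, G y (curv B y a b c) d = -G y (curv B y a b d) c := by
    intro a b c d; rw [h.metric_curv_skew_right hy, h.metric_symm y hy]
  have bi : ∀ a b c d : E, G y (curv B y a b c) d + G y (curv B y b c a) d +
      G y (curv B y c a b) d = 0 := by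
    intro a b c d
    have := congrArg (fun x => G y x d) (h.curv_bianchi hy a b c)
    simpa using this
  have b1 := bi v w z u
  have b2 := bi w z u v
  have b3 := bi z u v w
  have b4 := bi u v w z
  linarith [sk1 v w z u, sk2 v w z u, sk1 w z v u, sk2 w z v u, sk1 z v w u, sk2 z v w u,
    sk1 w z u v, sk1 z u w v, sk2 z u w v, sk1 u w z v, sk2 u w z v, sk1 z u v w, sk2 z u v w,
    sk1 u v z w, sk2 u v z w, sk1 v z u w, sk2 v z u w, sk1 u v w z, sk2 u v w z,
    sk1 v w u z, sk2 v w u z, sk1 w u v z, sk2 w u v z]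

/-- Polarization of the constant curvature condition. -/
lemma curv_of_sectional (h : IsLeviCivitaOn G B U) {y : E} (hy : y ∈ U) {κ : ℝ}
    (hκ : ∀ v w, G y (curv B y v w w) v = κ * (G y v v * G y w w - G y v w ^ 2)) (v w u : E) :
    G y (curv B y v w w) u = κ * (G y v u * G y w w - G y v w * G y u w) := by
  have hadd : curv B y (v + u) w w = curv B y v w w + curv B y u w w := by
    simp only [curv, map_add, add_apply]; abel
  -- The quadratic form v ↦ ⟨R(v,w)w, v⟩ is polarized; `h4` says that its two mixed terms agree.
  have h1 := hκ (v + u) w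
  rw [hadd] at h1
  have h2 := hκ v w
  have h3 := hκ u w
  have h4 : G y (curv B y u w w) v = G y (curv B y v w w) u := by
    rw [h.metric_curv_pair_symm hy, curv_skew_left, h.metric_curv_skew_right hy v w w u,
      map_neg, neg_apply, h.metric_symm y hy w, curv_skew_left, map_neg, neg_apply]
  simp only [map_add, add_apply] at h1
  have h5 := h.metric_symm y hy u v
  rw [h5] at h1
  linarith [h1, h2, h3, h4]

lemma eq_zero_of_metric (h : IsLeviCivitaOn G B U) {y : E} (hy : y ∈ U) {v : E}
    (hv : ∀ w, G y v w = 0) : v = 0 := by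
  by_contra hne
  exact (h.metric_pos y hy v hne).ne' (hv v)

/-- The transformation law of the Christoffel symbols under a change of coordinates `ψ`. -/
lemma fderiv_conn_of_isometry {G₁ : E → E →L[ℝ] E →L[ℝ] ℝ} {B₁ : E → E →L[ℝ] E →L[ℝ] E}
    {U₁ : Set E} (h : IsLeviCivitaOn G B U) (h₁ : IsLeviCivitaOn G₁ B₁ U₁) {ψ : E → E} {y : E}
    (hy : y ∈ U) (hψy : ψ y ∈ U₁) (hψ : ContDiffAt ℝ ∞ ψ y)
    (hsurj : Function.Surjective (fderiv ℝ ψ y))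
    (hiso : ∀ᶠ p in 𝓝 y, ∀ v w, G p v w = G₁ (ψ p) (fderiv ℝ ψ p v) (fderiv ℝ ψ p w))
    (v w : E) :
    fderiv ℝ ψ y (B y v w) =
      B₁ (ψ y) (fderiv ℝ ψ y v) (fderiv ℝ ψ y w) + fderiv ℝ (fderiv ℝ ψ) y v w := by
  set D : E → E → E := fun v w => fderiv ℝ ψ y (B y v w) -
    (B₁ (ψ y) (fderiv ℝ ψ y v) (fderiv ℝ ψ y w) + fderiv ℝ (fderiv ℝ ψ) y v w) with hD
  -- D is the failure of the transformation law. The trilinear form T is symmetric in its first two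
  -- arguments, because neither connection has torsion, and skew in the last two, because both are
  -- compatible with isometric metrics. Such a form vanishes.
  set T : E → E → E → ℝ := fun u v w => G₁ (ψ y) (D u v) (fderiv ℝ ψ y w) with hT
  have hsymm : ∀ u v w, T u v w = T v u w := by
    intro u v w
    simp only [hT, hD]
    rw [h.conn_symm y hy u v, h₁.conn_symm _ hψy, fderiv_fderiv_comm hψ u v]
  have hskew : ∀ u v w, T u v w = -T u w v := by
    intro u v w
    have hpt := hiso.self_of_nhds
    have h1 : fderiv ℝ G y u v w = fderiv ℝ (fun p => G p v w) y u := by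
      rw [((((h.metric_contDiffAt y hy).differentiableAt
        (by simp)).hasFDerivAt.clm_apply (hasFDerivAt_const v y)).clm_apply
        (hasFDerivAt_const w y)).fderiv]
      simp
    have h2 : (fun p => G p v w) =ᶠ[𝓝 y]
        fun p => G₁ (ψ p) (fderiv ℝ ψ p v) (fderiv ℝ ψ p w) := by
      filter_upwards [hiso] with p hp using hp v w
    have h3 := h₁.fderiv_metric_cov hψy hψ (contDiffAt_fderiv_apply hψ v)
      (contDiffAt_fderiv_apply hψ w) u
    rw [h2.fderiv_eq, h3, h.compat y hy, hpt, hpt] at h1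
    simp only [cov, fderiv_fderiv_apply hψ] at h1
    simp only [hT, hD, map_sub, map_add, sub_apply, add_apply] at h1 ⊢
    rw [h₁.metric_symm _ hψy (fderiv ℝ ψ y v) (fderiv ℝ (fderiv ℝ ψ) y u w),
      h₁.metric_symm _ hψy (fderiv ℝ ψ y v) (fderiv ℝ ψ y (B y u w)),
      h₁.metric_symm _ hψy (fderiv ℝ ψ y v)
        (B₁ (ψ y) (fderiv ℝ ψ y u) (fderiv ℝ ψ y w))] at h1
    linarith
  have hzero : D v w = 0 := by
    refine h₁.eq_zero_of_metric hψy fun x => ?_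
    obtain ⟨u, rfl⟩ := hsurj x
    change T v w u = 0
    linarith [hsymm v w u, hskew w v u, hsymm w u v, hskew u w v, hsymm u v w, hskew v u w]
  exact sub_eq_zero.1 hzero

/-- Parallel vector fields are mapped to parallel vector fields by changes of coordinates. -/
lemma hasDerivAt_parallel_of_isometry {G₁ : E → E →L[ℝ] E →L[ℝ] ℝ}
    {B₁ : E → E →L[ℝ] E →L[ℝ] E}
    {U₁ : Set E} (h : IsLeviCivitaOn G B U) (h₁ : IsLeviCivitaOn G₁ B₁ U₁) {ψ : E → E}
    {c V : ℝ → E} {t : ℝ} {c' : E}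
    (hy : c t ∈ U) (hψy : ψ (c t) ∈ U₁) (hψ : ContDiffAt ℝ ∞ ψ (c t))
    (hsurj : Function.Surjective (fderiv ℝ ψ (c t)))
    (hiso : ∀ᶠ p in 𝓝 (c t), ∀ v w, G p v w = G₁ (ψ p) (fderiv ℝ ψ p v) (fderiv ℝ ψ p w))
    (hc : HasDerivAt c c' t) (hV : HasDerivAt V (-B (c t) c' (V t)) t) :
    HasDerivAt (fun τ => fderiv ℝ ψ (c τ) (V τ))
      (-B₁ (ψ (c t)) (fderiv ℝ ψ (c t) c') (fderiv ℝ ψ (c t) (V t))) t := by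
  have h1 := ((hψ.fderiv_right (m := ∞) (by simp)).differentiableAt (by simp)).hasFDerivAt
  have h2 : HasDerivAt (fun τ => fderiv ℝ ψ (c τ)) (fderiv ℝ (fderiv ℝ ψ) (c t) c') t :=
    h1.comp_hasDerivAt t hc
  have h3 := h2.clm_apply hV
  convert h3 using 1
  rw [map_neg, h.fderiv_conn_of_isometry h₁ hy hψy hψ hsurj hiso]
  abel

/-! ### Variation fields of families of curves. -/

section Jacobi

variable {Φ : ℝ × F → E}

/-- The velocity field of a family of curves. -/
def tvel (Φ : ℝ × F → E) (q : ℝ × F) : E := fderiv ℝ Φ q (1, 0)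

/-- The variation field in direction `a` of a family of curves. -/
def jac (Φ : ℝ × F → E) (a : F) (q : ℝ × F) : E := fderiv ℝ Φ q (0, a)

/-- The covariant derivative of the variation field along the curves. -/
def jac' (B : E → E →L[ℝ] E →L[ℝ] E) (Φ : ℝ × F → E) (a : F) (q : ℝ × F) : E :=
  cov B Φ (1, 0) (jac Φ a) q

/-- The Jacobi equation. By absence of torsion J' is the covariant derivative of the velocity in
direction a. Exchanging it with the derivative in t costs a curvature term, and the geodesic
equation removes the rest. -/
lemma cov_jac' (h : IsLeviCivitaOn G B U) {q : ℝ × F} (hq : Φ q ∈ U)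
    (hΦe : ∀ᶠ p in 𝓝 q, ContDiffAt ℝ ∞ Φ p)
    (hgeo : ∀ᶠ p in 𝓝 q, cov B Φ (1, 0) (tvel Φ) p = 0) (a : F) :
    cov B Φ (1, 0) (jac' B Φ a) q = -curv B (Φ q) (jac Φ a q) (tvel Φ q) (tvel Φ q) := by
  have hΦ := hΦe.self_of_nhds
  have hev : ∀ᶠ p in 𝓝 q, Φ p ∈ U ∧ ContDiffAt ℝ ∞ Φ p :=
    (hΦ.continuousAt.eventually_mem (h.isOpen.mem_nhds hq)).and hΦe
  have h1 : jac' B Φ a =ᶠ[𝓝 q] cov B Φ (0, a) (tvel Φ) := by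
    filter_upwards [hev] with p hp using h.cov_fderiv_comm hp.1 hp.2 _ _
  have h2 : cov B Φ (1, 0) (tvel Φ) =ᶠ[𝓝 q] fun _ => 0 := hgeo
  have h3 := h.cov_cov_sub hq hΦ (V := tvel Φ) (contDiffAt_fderiv_apply hΦ _) (1, 0) (0, a)
  rw [cov_congr h1, ← curv_skew_left]
  rw [cov_congr h2 (0, a)] at h3
  have h4 : cov B Φ (0, a) (fun _ => (0 : E)) q = 0 := by simp [cov]
  rw [h4, sub_zero] at h3
  exact h3

lemma hasDerivAt_slice {H : Type*} [NormedAddCommGroup H] [NormedSpace ℝ H] {f : ℝ × F → H}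
    {t : ℝ} {ξ : F} (hf : DifferentiableAt ℝ f (t, ξ)) :
    HasDerivAt (fun τ => f (τ, ξ)) (fderiv ℝ f (t, ξ) (1, 0)) t := by
  have h1 : HasDerivAt (fun τ : ℝ => (τ, ξ)) ((1 : ℝ), (0 : F)) t :=
    (hasDerivAt_id t).prodMk (hasDerivAt_const t ξ)
  exact HasFDerivAt.comp_hasDerivAt (f := fun τ : ℝ => (τ, ξ)) t hf.hasFDerivAt h1

lemma hasDerivAt_metric_slice (h : IsLeviCivitaOn G B U) {V W : ℝ × F → E} {t : ℝ} {ξ : F}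
    (hq : Φ (t, ξ) ∈ U) (hΦ : ContDiffAt ℝ ∞ Φ (t, ξ)) (hV : ContDiffAt ℝ ∞ V (t, ξ))
    (hW : ContDiffAt ℝ ∞ W (t, ξ)) :
    HasDerivAt (fun τ => G (Φ (τ, ξ)) (V (τ, ξ)) (W (τ, ξ)))
      (G (Φ (t, ξ)) (cov B Φ (1, 0) V (t, ξ)) (W (t, ξ)) +
        G (Φ (t, ξ)) (V (t, ξ)) (cov B Φ (1, 0) W (t, ξ))) t := by
  rw [← h.fderiv_metric_cov hq hΦ hV hW]
  exact hasDerivAt_slice ((contDiffAt_bilin_comp (h.metric_contDiffAt _ hq) hΦ hV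
    hW).differentiableAt (by simp))

end Jacobi

end IsLeviCivitaOn

end LeviCivita

/-! ### Inner products of Jacobi fields in constant curvature. -/

section JacobiComparison

open Topology Set

/-- Uniqueness for the linear system satisfied by the inner products of Jacobi fields. -/
lemma jacobi_system_unique {κ ρ θ : ℝ} {f p h f₂ p₂ h₂ : ℝ → ℝ}
    (hf : ∀ t ∈ Icc (0 : ℝ) 1, HasDerivAt f (p t) t)
    (hp : ∀ t ∈ Icc (0 : ℝ) 1,
      HasDerivAt p (2 * h t - 2 * κ * (ρ * f t - θ * t ^ 2)) t)
    (hh : ∀ t ∈ Icc (0 : ℝ) 1, HasDerivAt h (-κ * (ρ * p t - 2 * θ * t)) t)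
    (hf₂ : ∀ t ∈ Icc (0 : ℝ) 1, HasDerivAt f₂ (p₂ t) t)
    (hp₂ : ∀ t ∈ Icc (0 : ℝ) 1,
      HasDerivAt p₂ (2 * h₂ t - 2 * κ * (ρ * f₂ t - θ * t ^ 2)) t)
    (hh₂ : ∀ t ∈ Icc (0 : ℝ) 1, HasDerivAt h₂ (-κ * (ρ * p₂ t - 2 * θ * t)) t)
    (hf0 : f 0 = f₂ 0) (hp0 : p 0 = p₂ 0) (hh0 : h 0 = h₂ 0) : f 1 = f₂ 1 := by
  -- The forcing terms with θ cancel in the difference of two solutions, which therefore solves the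
  -- homogeneous system x' = L x.
  let L : ℝ × ℝ × ℝ →L[ℝ] ℝ × ℝ × ℝ := LinearMap.toContinuousLinearMap
    { toFun := fun x => (x.2.1, 2 * x.2.2 - 2 * κ * (ρ * x.1), -κ * (ρ * x.2.1))
      map_add' := fun x y => by ext <;> simp <;> ring
      map_smul' := fun c x => by ext <;> simp <;> ring }
  have hL : ∀ x, L x = (x.2.1, 2 * x.2.2 - 2 * κ * (ρ * x.1), -κ * (ρ * x.2.1)) := fun _ => rfl
  have hd : ∀ t ∈ Icc (0 : ℝ) 1, HasDerivAt (fun t => (f t - f₂ t, p t - p₂ t, h t - h₂ t))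
      (L (f t - f₂ t, p t - p₂ t, h t - h₂ t)) t := by
    intro t ht
    have h1 := ((hf t ht).sub (hf₂ t ht)).prodMk
      (((hp t ht).sub (hp₂ t ht)).prodMk ((hh t ht).sub (hh₂ t ht)))
    refine h1.congr_deriv ?_
    rw [hL]
    ext <;> simp <;> ring
  have hu := ODE_solution_unique (v := fun _ => L) (K := ‖L‖₊) (a := 0) (b := 1)
    (f := fun t => (f t - f₂ t, p t - p₂ t, h t - h₂ t)) (g := fun _ => 0)
    (fun _ => L.lipschitz) (fun t ht => (hd t ht).continuousAt.continuousWithinAt)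
    (fun t ht => (hd t (Ico_subset_Icc_self ht)).hasDerivWithinAt) continuousOn_const
    (fun t _ => by simpa using (hasDerivAt_const t (0 : ℝ × ℝ × ℝ)).hasDerivWithinAt)
    (by simp [hf0, hp0, hh0])
  have h1 := hu (right_mem_Icc.2 zero_le_one)
  have h2 := congrArg Prod.fst h1
  exact sub_eq_zero.1 h2

lemma eq_of_hasDerivAt_zero {f : ℝ → ℝ} (hf : ∀ t ∈ Icc (0 : ℝ) 1, HasDerivAt f 0 t) {t : ℝ}
    (ht : t ∈ Icc (0 : ℝ) 1) : f t = f 0 :=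
  constant_of_has_deriv_right_zero (fun s hs => (hf s hs).continuousAt.continuousWithinAt)
    (fun s hs => (hf s (Ico_subset_Icc_self hs)).hasDerivWithinAt) t ht

variable {E F : Type*} [NormedAddCommGroup E] [NormedSpace ℝ E]
  [NormedAddCommGroup F] [NormedSpace ℝ F]

/-- Near `[0, 1] × {ξ}`, `Φ` is a smooth family of geodesics in `U`. -/
def IsGeodesicFamilyAt (B : E → E →L[ℝ] E →L[ℝ] E) (U : Set E) (Φ : ℝ × F → E) (ξ : F) : Prop :=
  ∀ t ∈ Icc (0 : ℝ) 1, Φ (t, ξ) ∈ U ∧ (∀ᶠ p in 𝓝 (t, ξ), ContDiffAt ℝ ∞ Φ p) ∧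
    ∀ᶠ p in 𝓝 (t, ξ), cov B Φ (1, 0) (IsLeviCivitaOn.tvel Φ) p = 0

namespace IsLeviCivitaOn

variable {G : E → E →L[ℝ] E →L[ℝ] ℝ} {B : E → E →L[ℝ] E →L[ℝ] E} {U : Set E}
  {Φ : ℝ × F → E} {κ : ℝ}

/-- With T the velocity, f = ⟨J_a,J_b⟩, p = f', h = ⟨J_a',J_b'⟩. In curvature κ the Jacobi equation
reads J'' = -κ(ρJ - ⟨J,T⟩T), so the system would close but for the products ⟨J_a,T⟩⟨J_b,T⟩. As the
fields start orthogonal to T, each factor is linear in t, and the product is θt². -/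
lemma exists_jacobi_system (h : IsLeviCivitaOn G B U)
    (hκ : ∀ y ∈ U, ∀ v w, G y (curv B y v w w) v = κ * (G y v v * G y w w - G y v w ^ 2))
    {ξ : F} (hΦ : IsGeodesicFamilyAt B U Φ ξ) (a b : F)
    (ha : G (Φ (0, ξ)) (jac Φ a (0, ξ)) (tvel Φ (0, ξ)) = 0)
    (hb : G (Φ (0, ξ)) (jac Φ b (0, ξ)) (tvel Φ (0, ξ)) = 0) {ρ θ : ℝ}
    (hρ : G (Φ (0, ξ)) (tvel Φ (0, ξ)) (tvel Φ (0, ξ)) = ρ)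
    (hθ : G (Φ (0, ξ)) (jac' B Φ a (0, ξ)) (tvel Φ (0, ξ)) *
      G (Φ (0, ξ)) (jac' B Φ b (0, ξ)) (tvel Φ (0, ξ)) = θ) :
    ∃ f p h : ℝ → ℝ, (∀ t ∈ Icc (0 : ℝ) 1, HasDerivAt f (p t) t) ∧
      (∀ t ∈ Icc (0 : ℝ) 1, HasDerivAt p (2 * h t - 2 * κ * (ρ * f t - θ * t ^ 2)) t) ∧
      (∀ t ∈ Icc (0 : ℝ) 1, HasDerivAt h (-κ * (ρ * p t - 2 * θ * t)) t) ∧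
      (∀ t, f t = G (Φ (t, ξ)) (jac Φ a (t, ξ)) (jac Φ b (t, ξ))) ∧
      p 0 = G (Φ (0, ξ)) (jac' B Φ a (0, ξ)) (jac Φ b (0, ξ)) +
        G (Φ (0, ξ)) (jac Φ a (0, ξ)) (jac' B Φ b (0, ξ)) ∧
      h 0 = G (Φ (0, ξ)) (jac' B Φ a (0, ξ)) (jac' B Φ b (0, ξ)) := by
  have hT : ∀ t ∈ Icc (0 : ℝ) 1, ContDiffAt ℝ ∞ (tvel Φ) (t, ξ) := fun t ht =>
    contDiffAt_fderiv_apply (hΦ t ht).2.1.self_of_nhds _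
  have hJ : ∀ a, ∀ t ∈ Icc (0 : ℝ) 1, ContDiffAt ℝ ∞ (jac Φ a) (t, ξ) := fun a t ht =>
    contDiffAt_fderiv_apply (hΦ t ht).2.1.self_of_nhds _
  have hJ' : ∀ a, ∀ t ∈ Icc (0 : ℝ) 1, ContDiffAt ℝ ∞ (jac' B Φ a) (t, ξ) := fun a t ht =>
    ContDiffAt.cov (h.conn_contDiffAt _ (hΦ t ht).1) (hΦ t ht).2.1.self_of_nhds (hJ a t ht) _
  have hTd : ∀ t ∈ Icc (0 : ℝ) 1, cov B Φ (1, 0) (tvel Φ) (t, ξ) = 0 := fun t ht =>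
    (hΦ t ht).2.2.self_of_nhds
  have hder : ∀ {V W : ℝ × F → E} {t : ℝ}, t ∈ Icc (0 : ℝ) 1 → ContDiffAt ℝ ∞ V (t, ξ) →
      ContDiffAt ℝ ∞ W (t, ξ) →
      HasDerivAt (fun τ => G (Φ (τ, ξ)) (V (τ, ξ)) (W (τ, ξ)))
      (G (Φ (t, ξ)) (cov B Φ (1, 0) V (t, ξ)) (W (t, ξ)) +
        G (Φ (t, ξ)) (V (t, ξ)) (cov B Φ (1, 0) W (t, ξ))) t := fun ht hV hW =>
    h.hasDerivAt_metric_slice (hΦ _ ht).1 (hΦ _ ht).2.1.self_of_nhds hV hW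
  have hρt : ∀ t ∈ Icc (0 : ℝ) 1, G (Φ (t, ξ)) (tvel Φ (t, ξ)) (tvel Φ (t, ξ)) = ρ := by
    intro t ht
    rw [← hρ]
    refine eq_of_hasDerivAt_zero (f := fun t => G (Φ (t, ξ)) (tvel Φ (t, ξ)) (tvel Φ (t, ξ)))
      (fun s hs => ?_) ht
    have := hder hs (hT s hs) (hT s hs)
    simpa [hTd s hs] using this
  have hJJ : ∀ a, ∀ t ∈ Icc (0 : ℝ) 1, ∀ u, G (Φ (t, ξ)) (cov B Φ (1, 0) (jac' B Φ a) (t, ξ)) u =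
      -κ * (ρ * G (Φ (t, ξ)) (jac Φ a (t, ξ)) u -
        G (Φ (t, ξ)) (jac Φ a (t, ξ)) (tvel Φ (t, ξ)) * G (Φ (t, ξ)) u (tvel Φ (t, ξ))) := by
    intro a t ht u
    rw [h.cov_jac' (hΦ t ht).1 (hΦ t ht).2.1 (hΦ t ht).2.2, map_neg, neg_apply,
      h.curv_of_sectional (hΦ t ht).1 (hκ _ (hΦ t ht).1), hρt t ht]
    ring
  -- ⟨J',T⟩ is constant, because J'' is orthogonal to T and T is parallel.
  have hα : ∀ a, ∀ t ∈ Icc (0 : ℝ) 1, G (Φ (t, ξ)) (jac' B Φ a (t, ξ)) (tvel Φ (t, ξ)) =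
      G (Φ (0, ξ)) (jac' B Φ a (0, ξ)) (tvel Φ (0, ξ)) := by
    intro a t ht
    refine eq_of_hasDerivAt_zero
      (f := fun t => G (Φ (t, ξ)) (jac' B Φ a (t, ξ)) (tvel Φ (t, ξ))) (fun s hs => ?_) ht
    have h1 := hder hs (hJ' a s hs) (hT s hs)
    rw [hTd s hs, hJJ a s hs, hρt s hs] at h1
    refine h1.congr_deriv ?_
    simp; ring_nf; simp
  have hA : ∀ a, G (Φ (0, ξ)) (jac Φ a (0, ξ)) (tvel Φ (0, ξ)) = 0 → ∀ t ∈ Icc (0 : ℝ) 1,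
      G (Φ (t, ξ)) (jac Φ a (t, ξ)) (tvel Φ (t, ξ)) =
        G (Φ (0, ξ)) (jac' B Φ a (0, ξ)) (tvel Φ (0, ξ)) * t := by
    intro a ha t ht
    have h2 := eq_of_hasDerivAt_zero
      (f := fun t => G (Φ (t, ξ)) (jac Φ a (t, ξ)) (tvel Φ (t, ξ)) -
        G (Φ (0, ξ)) (jac' B Φ a (0, ξ)) (tvel Φ (0, ξ)) * t) (fun s hs => ?_) ht
    · simp only [ha, mul_zero, sub_zero] at h2
      linarith
    · have h1 := (hder hs (hJ a s hs) (hT s hs)).sub ((hasDerivAt_id s).const_mul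
        (G (Φ (0, ξ)) (jac' B Φ a (0, ξ)) (tvel Φ (0, ξ))))
      rw [hTd s hs] at h1
      refine h1.congr_deriv ?_
      rw [← hα a s hs]
      simp [jac']
  refine ⟨fun t => G (Φ (t, ξ)) (jac Φ a (t, ξ)) (jac Φ b (t, ξ)),
    fun t => G (Φ (t, ξ)) (jac' B Φ a (t, ξ)) (jac Φ b (t, ξ)) +
        G (Φ (t, ξ)) (jac Φ a (t, ξ)) (jac' B Φ b (t, ξ)),
    fun t => G (Φ (t, ξ)) (jac' B Φ a (t, ξ)) (jac' B Φ b (t, ξ)), fun t ht => ?_, fun t ht => ?_,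
    fun t ht => ?_, fun t => rfl, rfl, rfl⟩
  · exact hder ht (hJ a t ht) (hJ b t ht)
  · have h1 := (hder ht (hJ' a t ht) (hJ b t ht)).add (hder ht (hJ a t ht) (hJ' b t ht))
    have hs := h.metric_symm _ (hΦ t ht).1
    rw [hs (jac Φ a (t, ξ)) (cov B Φ (1, 0) (jac' B Φ b) (t, ξ)), hJJ a t ht, hJJ b t ht,
      hA a ha t ht, hA b hb t ht] at h1
    refine h1.congr_deriv ?_
    rw [← hθ, hs (jac Φ b (t, ξ)) (jac Φ a (t, ξ))]
    simp only [jac']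
    ring
  · have h1 := hder ht (hJ' a t ht) (hJ' b t ht)
    have hs := h.metric_symm _ (hΦ t ht).1
    rw [hs (jac' B Φ a (t, ξ)) (cov B Φ (1, 0) (jac' B Φ b) (t, ξ)), hJJ a t ht, hJJ b t ht,
      hA a ha t ht, hA b hb t ht, hα b t ht, hα a t ht] at h1
    refine h1.congr_deriv ?_
    rw [← hθ, hs (jac Φ b (t, ξ)) (jac' B Φ a (t, ξ))]
    ring

/-- In constant curvature the inner products of Jacobi fields at time `1` are determined by the
initial data. -/
theorem metric_jac_eq (h : IsLeviCivitaOn G B U)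
    (hκ : ∀ y ∈ U, ∀ v w, G y (curv B y v w w) v = κ * (G y v v * G y w w - G y v w ^ 2))
    {ξ₁ ξ₂ : F} (h₁ : IsGeodesicFamilyAt B U Φ ξ₁) (h₂ : IsGeodesicFamilyAt B U Φ ξ₂) (a b : F)
    {ρ θ f₀ p₀ h₀ : ℝ}
    (hdata : ∀ ξ, ξ = ξ₁ ∨ ξ = ξ₂ →
      G (Φ (0, ξ)) (jac Φ a (0, ξ)) (tvel Φ (0, ξ)) = 0 ∧
      G (Φ (0, ξ)) (jac Φ b (0, ξ)) (tvel Φ (0, ξ)) = 0 ∧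
      G (Φ (0, ξ)) (tvel Φ (0, ξ)) (tvel Φ (0, ξ)) = ρ ∧
      G (Φ (0, ξ)) (jac' B Φ a (0, ξ)) (tvel Φ (0, ξ)) *
        G (Φ (0, ξ)) (jac' B Φ b (0, ξ)) (tvel Φ (0, ξ)) = θ ∧
      G (Φ (0, ξ)) (jac Φ a (0, ξ)) (jac Φ b (0, ξ)) = f₀ ∧
      G (Φ (0, ξ)) (jac' B Φ a (0, ξ)) (jac Φ b (0, ξ)) +
        G (Φ (0, ξ)) (jac Φ a (0, ξ)) (jac' B Φ b (0, ξ)) = p₀ ∧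
      G (Φ (0, ξ)) (jac' B Φ a (0, ξ)) (jac' B Φ b (0, ξ)) = h₀) :
    G (Φ (1, ξ₁)) (jac Φ a (1, ξ₁)) (jac Φ b (1, ξ₁)) =
      G (Φ (1, ξ₂)) (jac Φ a (1, ξ₂)) (jac Φ b (1, ξ₂)) := by
  obtain ⟨d1, d2, d3, d4, d5, d6, d7⟩ := hdata ξ₁ (Or.inl rfl)
  obtain ⟨e1, e2, e3, e4, e5, e6, e7⟩ := hdata ξ₂ (Or.inr rfl)
  obtain ⟨f, p, q, i1, i2, i3, i4, i5, i6⟩ := h.exists_jacobi_system hκ h₁ a b d1 d2 d3 d4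
  obtain ⟨f', p', q', j1, j2, j3, j4, j5, j6⟩ := h.exists_jacobi_system hκ h₂ a b e1 e2 e3 e4
  rw [← i4, ← j4]
  refine jacobi_system_unique i1 i2 i3 j1 j2 j3 ?_ ?_ ?_
  · rw [i4, j4, d5, e5]
  · rw [i5, j5, d6, e6]
  · rw [i6, j6, d7, e7]

end IsLeviCivitaOn

end JacobiComparison

/-! ### Metrics and Christoffel symbols given by coefficients. -/

section Coordinates

variable {n : ℕ}

/-- Serves to check identities between multilinear expressions on coordinate vectors only. -/
lemma coord_induction {P : Coord n → Prop} (hbasis : ∀ i, P (basisVec i))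
    (hadd : ∀ v w, P v → P w → P (v + w)) (hsmul : ∀ (c : ℝ) v, P v → P (c • v)) (v : Coord n) :
    P v := by
  have hv : v = ∑ i, v i • basisVec i := by
    ext j
    simp [basisVec, Finset.sum_apply, Pi.single_apply]
  have h0 : P 0 := by simpa using hsmul 0 _ (hbasis 0)
  rw [hv]
  exact Finset.sum_induction _ P hadd h0 fun i _ => hsmul _ _ (hbasis i)

lemma sum_triple_comm {ι : Type*} [Fintype ι] (f : ι → ι → ι → ι → ℝ) :
    ∑ i, ∑ j, ∑ k, ∑ l, f i j k l = ∑ l, ∑ i, ∑ j, ∑ k, f i j k l :=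
  calc ∑ i, ∑ j, ∑ k, ∑ l, f i j k l = ∑ i, ∑ j, ∑ l, ∑ k, f i j k l :=
        Finset.sum_congr rfl fun _ _ => Finset.sum_congr rfl fun _ _ => Finset.sum_comm
    _ = ∑ i, ∑ l, ∑ j, ∑ k, f i j k l := Finset.sum_congr rfl fun _ _ => Finset.sum_comm
    _ = _ := Finset.sum_comm

lemma basisVec_apply (i j : Fin (n + 1)) : (basisVec i : Coord n) j = if j = i then 1 else 0 := by
  simp [basisVec]

/-- The bilinear form with coefficients `Gm`. -/
def formOf (Gm : Coord n → Matrix (Fin (n + 1)) (Fin (n + 1)) ℝ) (y : Coord n) :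
    Coord n →L[ℝ] Coord n →L[ℝ] ℝ :=
  ∑ i, ∑ j, Gm y i j • (EuclideanSpace.proj i : Coord n →L[ℝ] ℝ).smulRight
    (EuclideanSpace.proj j : Coord n →L[ℝ] ℝ)

/-- The Christoffel symbols of `Gm` as a bilinear map. -/
def connOf (Gm : Coord n → Matrix (Fin (n + 1)) (Fin (n + 1)) ℝ) (y : Coord n) :
    Coord n →L[ℝ] Coord n →L[ℝ] Coord n :=
  ∑ k, ∑ i, ∑ j, christoffel Gm k i j y • (EuclideanSpace.proj i : Coord n →L[ℝ] ℝ).smulRight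
    ((EuclideanSpace.proj j : Coord n →L[ℝ] ℝ).smulRight (basisVec k))

variable {Gm : Coord n → Matrix (Fin (n + 1)) (Fin (n + 1)) ℝ}

lemma formOf_apply (y v w : Coord n) : formOf Gm y v w = pairing Gm y v w := by
  simp [formOf, pairing, mul_assoc]

lemma formOf_basisVec (y : Coord n) (i j : Fin (n + 1)) :
    formOf Gm y (basisVec i) (basisVec j) = Gm y i j := by
  simp [formOf_apply, pairing, basisVec_apply]

lemma connOf_apply (y v w : Coord n) (k : Fin (n + 1)) :
    connOf Gm y v w k = ∑ i, ∑ j, christoffel Gm k i j y * v i * w j := by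
  simp [connOf, basisVec_apply, Finset.sum_apply, mul_assoc]

lemma connOf_basisVec (y : Coord n) (i j k : Fin (n + 1)) :
    connOf Gm y (basisVec i) (basisVec j) k = christoffel Gm k i j y := by
  simp [connOf_apply, basisVec_apply]

lemma contDiffAt_det {ι : Type*} [Fintype ι] [DecidableEq ι] {E : Type*} [NormedAddCommGroup E]
    [NormedSpace ℝ E] {A : E → Matrix ι ι ℝ} {y : E} {m : WithTop ℕ∞}
    (hA : ∀ i j, ContDiffAt ℝ m (fun z => A z i j) y) : ContDiffAt ℝ m (fun z => (A z).det) y := by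
  simp only [Matrix.det_apply]
  refine ContDiffAt.sum fun σ _ => ?_
  refine ContDiffAt.const_smul _ ?_
  exact contDiffAt_prod fun i _ => hA _ _

/-- Cramer's rule: the entries of the adjugate are determinants of matrices with smooth entries. -/
lemma contDiffAt_matrix_inv {ι : Type*} [Fintype ι] [DecidableEq ι] {E : Type*}
    [NormedAddCommGroup E] [NormedSpace ℝ E] {A : E → Matrix ι ι ℝ} {y : E} {m : WithTop ℕ∞}
    (hA : ∀ i j, ContDiffAt ℝ m (fun z => A z i j) y) (hdet : (A y).det ≠ 0) (i j : ι) :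
    ContDiffAt ℝ m (fun z => (A z)⁻¹ i j) y := by
  have h1 : (fun z => (A z)⁻¹ i j) = fun z => (A z).det⁻¹ * (A z).adjugate i j := by
    funext z
    simp [Matrix.inv_def, Ring.inverse_eq_inv']
  rw [h1]
  refine ((contDiffAt_det hA).inv hdet).mul ?_
  simp only [Matrix.adjugate_apply]
  refine contDiffAt_det fun k l => ?_
  simp only [Matrix.updateRow_apply]
  split_ifs
  · exact contDiffAt_const
  · exact hA _ _

lemma contDiffAt_pd {f : Coord n → ℝ} {y : Coord n} (hf : ContDiffAt ℝ ∞ f y) (i : Fin (n + 1)) :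
    ContDiffAt ℝ ∞ (pd i f) y := contDiffAt_fderiv_apply hf _

lemma contDiffAt_christoffel {y : Coord n}
    (hG : ∀ i j, ContDiffAt ℝ ∞ (fun z => Gm z i j) y) (hdet : (Gm y).det ≠ 0)
    (k i j : Fin (n + 1)) : ContDiffAt ℝ ∞ (christoffel Gm k i j) y := by
  refine contDiffAt_const.mul (ContDiffAt.sum fun l _ => ?_)
  exact (contDiffAt_matrix_inv hG hdet k l).mul
    (((contDiffAt_pd (hG j l) i).add (contDiffAt_pd (hG i l) j)).sub (contDiffAt_pd (hG i j) l))

/-- `Gm` is a smooth Riemannian metric on the open set `U`. -/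
structure IsMetricOn (Gm : Coord n → Matrix (Fin (n + 1)) (Fin (n + 1)) ℝ) (U : Set (Coord n)) :
    Prop where
  isOpen : IsOpen U
  contDiffAt : ∀ y ∈ U, ∀ i j, ContDiffAt ℝ ∞ (fun z => Gm z i j) y
  symm : ∀ y ∈ U, ∀ i j, Gm y i j = Gm y j i
  pos : ∀ y ∈ U, ∀ v, v ≠ 0 → 0 < pairing Gm y v v

namespace IsMetricOn

variable {U : Set (Coord n)}

lemma det_ne_zero (h : IsMetricOn Gm U) {y : Coord n} (hy : y ∈ U) : (Gm y).det ≠ 0 := by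
  intro h0
  obtain ⟨v, hv, hv0⟩ := Matrix.exists_mulVec_eq_zero_iff.2 h0
  have hne : (WithLp.toLp 2 v : Coord n) ≠ 0 := by
    intro h1
    apply hv
    funext i
    exact congrArg (fun x : Coord n => x i) h1
  have h1 := h.pos y hy _ hne
  have h2 : pairing Gm y (WithLp.toLp 2 v) (WithLp.toLp 2 v) = ∑ i, v i * (Gm y).mulVec v i := by
    simp only [pairing, Matrix.mulVec, dotProduct, Finset.mul_sum]
    exact Finset.sum_congr rfl fun i _ => Finset.sum_congr rfl fun j _ => by ring
  rw [h2, hv0] at h1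
  simp at h1

/-- The Koszul formula in coordinates; lowering the index cancels the inverse matrix. -/
lemma lower_christoffel (h : IsMetricOn Gm U) {y : Coord n} (hy : y ∈ U) (i j k : Fin (n + 1)) :
    ∑ l, Gm y k l * christoffel Gm l i j y = 1 / 2 * (pd i (fun z => Gm z j k) y +
      pd j (fun z => Gm z i k) y - pd k (fun z => Gm z i j) y) := by
  have h1 : Gm y * (Gm y)⁻¹ = 1 := Matrix.mul_nonsing_inv _ (h.det_ne_zero hy).isUnit
  simp only [christoffel, Finset.mul_sum]
  rw [Finset.sum_comm]
  have h2 : ∀ q, ∑ l, Gm y k l * (1 / 2 * ((Gm y)⁻¹ l q * (pd i (fun z => Gm z j q) y +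
      pd j (fun z => Gm z i q) y - pd q (fun z => Gm z i j) y))) =
      (1 : Matrix (Fin (n + 1)) (Fin (n + 1)) ℝ) k q * (1 / 2 * (pd i (fun z => Gm z j q) y +
      pd j (fun z => Gm z i q) y - pd q (fun z => Gm z i j) y)) := by
    intro q
    rw [← h1, Matrix.mul_apply, Finset.sum_mul]
    exact Finset.sum_congr rfl fun l _ => by ring
  simp only [h2, Matrix.one_apply]
  simp

lemma formOf_connOf_basisVec (h : IsMetricOn Gm U) {y : Coord n} (hy : y ∈ U)
    (i j k : Fin (n + 1)) :
    formOf Gm y (connOf Gm y (basisVec i) (basisVec j)) (basisVec k) =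
      1 / 2 * (pd i (fun z => Gm z j k) y +
      pd j (fun z => Gm z i k) y - pd k (fun z => Gm z i j) y) := by
  rw [← h.lower_christoffel hy, formOf_apply, pairing]
  simp only [connOf_basisVec, basisVec_apply, mul_ite, mul_one, mul_zero, Finset.sum_ite_eq',
    Finset.mem_univ, if_true]
  exact Finset.sum_congr rfl fun l _ => by rw [h.symm y hy]

lemma pairing_symm (h : IsMetricOn Gm U) {y : Coord n} (hy : y ∈ U) (v w : Coord n) :
    pairing Gm y v w = pairing Gm y w v := by
  simp only [pairing]
  rw [Finset.sum_comm]
  exact Finset.sum_congr rfl fun i _ => Finset.sum_congr rfl fun j _ => by rw [h.symm y hy]; ring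

set_option synthInstance.maxHeartbeats 200000 in
set_option maxSynthPendingDepth 6 in
lemma contDiffAt_formOf (h : IsMetricOn Gm U) {y : Coord n} (hy : y ∈ U) :
    ContDiffAt ℝ ∞ (formOf Gm) y :=
  ContDiffAt.sum fun i _ => ContDiffAt.sum fun j _ => (h.contDiffAt y hy i j).smul contDiffAt_const

set_option synthInstance.maxHeartbeats 200000 in
set_option maxSynthPendingDepth 6 in
lemma contDiffAt_connOf (h : IsMetricOn Gm U) {y : Coord n} (hy : y ∈ U) :
    ContDiffAt ℝ ∞ (connOf Gm) y :=
  ContDiffAt.sum fun k _ => ContDiffAt.sum fun i _ => ContDiffAt.sum fun j _ =>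
    (contDiffAt_christoffel (h.contDiffAt y hy) (h.det_ne_zero hy) k i j).smul contDiffAt_const

lemma christoffel_symm (h : IsMetricOn Gm U) {y : Coord n} (hy : y ∈ U) (k i j : Fin (n + 1)) :
    christoffel Gm k i j y = christoffel Gm k j i y := by
  have h1 : ∀ l, pd l (fun z => Gm z i j) y = pd l (fun z => Gm z j i) y := by
    intro l
    have : (fun z => Gm z i j) =ᶠ[nhds y] fun z => Gm z j i := by
      filter_upwards [h.isOpen.mem_nhds hy] with z hz using h.symm z hz i j
    rw [pd, pd, this.fderiv_eq]
  simp only [christoffel, h1]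
  congr 1
  exact Finset.sum_congr rfl fun l _ => by ring

/-- The bridge from coefficients to the invariant formalism. Compatibility is the sum of two Koszul
formulas on coordinate vectors, in which all derivatives of the metric but one cancel. -/
lemma isLeviCivitaOn (h : IsMetricOn Gm U) : IsLeviCivitaOn (formOf Gm) (connOf Gm) U where
  isOpen := h.isOpen
  metric_contDiffAt _ hy := h.contDiffAt_formOf hy
  conn_contDiffAt _ hy := h.contDiffAt_connOf hy
  metric_symm y hy v w := by rw [formOf_apply, formOf_apply, h.pairing_symm hy]
  metric_pos y hy v hv := by rw [formOf_apply]; exact h.pos y hy v hv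
  conn_symm y hy v w := by
    ext k
    rw [connOf_apply, connOf_apply, Finset.sum_comm]
    exact Finset.sum_congr rfl fun i _ => Finset.sum_congr rfl fun j _ => by
      rw [h.christoffel_symm hy]; ring
  compat y hy u v w := by
    induction u using coord_induction generalizing v w with
    | hadd a b ha hb => simp only [map_add, add_apply, ha, hb]; ring
    | hsmul c a ha => simp only [map_smul, smul_apply, ha, smul_eq_mul]; ring
    | hbasis i =>
    induction v using coord_induction generalizing w with
    | hadd a b ha hb => simp only [map_add, add_apply, ha, hb]; ring
    | hsmul c a ha => simp only [map_smul, smul_apply, ha, smul_eq_mul]; ring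
    | hbasis j =>
    induction w using coord_induction with
    | hadd a b ha hb => simp only [map_add, ha, hb]; ring
    | hsmul c a ha => simp only [map_smul, ha, smul_eq_mul]; ring
    | hbasis k =>
    have h1 : fderiv ℝ (formOf Gm) y (basisVec i) (basisVec j) (basisVec k) =
        pd i (fun z => Gm z j k) y := by
      have h2 := (((h.contDiffAt_formOf hy).differentiableAt (by simp)).hasFDerivAt.clm_apply
        (hasFDerivAt_const (basisVec j) y)).clm_apply (hasFDerivAt_const (basisVec k) y)
      simp only [formOf_basisVec] at h2
      rw [pd, h2.fderiv]
      simp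
    have h3 : formOf Gm y (basisVec j) (connOf Gm y (basisVec i) (basisVec k)) =
        formOf Gm y (connOf Gm y (basisVec i) (basisVec k)) (basisVec j) := by
      rw [formOf_apply, formOf_apply, h.pairing_symm hy]
    have h4 : ∀ l a b, pd l (fun z => Gm z a b) y = pd l (fun z => Gm z b a) y := by
      intro l a b
      have : (fun z => Gm z a b) =ᶠ[nhds y] fun z => Gm z b a := by
        filter_upwards [h.isOpen.mem_nhds hy] with z hz using h.symm z hz a b
      rw [pd, pd, this.fderiv_eq]
    rw [h1, h3, h.formOf_connOf_basisVec hy, h.formOf_connOf_basisVec hy, h4 i k j]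
    ring

lemma curv_basisVec (h : IsMetricOn Gm U) {y : Coord n} (hy : y ∈ U) (l i j k : Fin (n + 1)) :
    curv (connOf Gm) y (basisVec i) (basisVec j) (basisVec k) l = riemann Gm l i j k y := by
  have h1 : ∀ i j, fderiv ℝ (connOf Gm) y (basisVec i) (basisVec j) (basisVec k) l =
      pd i (christoffel Gm l j k) y := by
    intro i j
    have h2 := (((h.contDiffAt_connOf hy).differentiableAt (by simp)).hasFDerivAt.clm_apply
      (hasFDerivAt_const (basisVec j) y)).clm_apply (hasFDerivAt_const (basisVec k) y)
    have h3 := (EuclideanSpace.proj l : Coord n →L[ℝ] ℝ).hasFDerivAt.comp y h2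
    have h4 : ((EuclideanSpace.proj l : Coord n →L[ℝ] ℝ) ∘
        fun z => connOf Gm z (basisVec j) (basisVec k)) = christoffel Gm l j k := by
      funext z; exact connOf_basisVec z j k l
    rw [h4] at h3
    rw [pd, h3.fderiv]
    simp
  have h5 : ∀ i (v : Coord n), connOf Gm y (basisVec i) v l =
      ∑ m, christoffel Gm l i m y * v m := by
    intro i v
    rw [connOf_apply]
    simp [basisVec_apply]
  simp only [curv, PiLp.add_apply, PiLp.sub_apply, h1, h5, connOf_basisVec, riemann,
    Finset.sum_sub_distrib]
  ring

lemma curv_apply (h : IsMetricOn Gm U) {y : Coord n} (hy : y ∈ U) (v w z : Coord n)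
    (l : Fin (n + 1)) :
    curv (connOf Gm) y v w z l = ∑ i, ∑ j, ∑ k, riemann Gm l i j k y * v i * w j * z k := by
  induction v using coord_induction generalizing w z with
  | hadd a b ha hb =>
    have : curv (connOf Gm) y (a + b) w z = curv (connOf Gm) y a w z + curv (connOf Gm) y b w z := by
      simp only [curv, map_add, add_apply]; abel
    rw [this, PiLp.add_apply, ha, hb]
    simp only [PiLp.add_apply, mul_add, add_mul, Finset.sum_add_distrib]
  | hsmul c a ha =>
    have : curv (connOf Gm) y (c • a) w z = c • curv (connOf Gm) y a w z := by
      simp only [curv, map_smul, smul_apply, smul_add, smul_sub]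
    rw [this, PiLp.smul_apply, ha, smul_eq_mul]
    simp only [PiLp.smul_apply, smul_eq_mul, Finset.mul_sum]
    exact Finset.sum_congr rfl fun i _ => Finset.sum_congr rfl fun j _ =>
      Finset.sum_congr rfl fun k _ => by ring
  | hbasis i =>
  induction w using coord_induction generalizing z with
  | hadd a b ha hb =>
    have : curv (connOf Gm) y (basisVec i) (a + b) z =
        curv (connOf Gm) y (basisVec i) a z + curv (connOf Gm) y (basisVec i) b z := by
      simp only [curv, map_add, add_apply]; abel
    rw [this, PiLp.add_apply, ha, hb]
    simp only [PiLp.add_apply, mul_add, add_mul, Finset.sum_add_distrib]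
  | hsmul c a ha =>
    have : curv (connOf Gm) y (basisVec i) (c • a) z = c • curv (connOf Gm) y (basisVec i) a z := by
      simp only [curv, map_smul, smul_apply, smul_add, smul_sub]
    rw [this, PiLp.smul_apply, ha, smul_eq_mul]
    simp only [PiLp.smul_apply, smul_eq_mul, Finset.mul_sum]
    exact Finset.sum_congr rfl fun i _ => Finset.sum_congr rfl fun j _ =>
      Finset.sum_congr rfl fun k _ => by ring
  | hbasis j =>
  induction z using coord_induction with
  | hadd a b ha hb =>
    have : curv (connOf Gm) y (basisVec i) (basisVec j) (a + b) =
        curv (connOf Gm) y (basisVec i) (basisVec j) a +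
          curv (connOf Gm) y (basisVec i) (basisVec j) b := by
      simp only [curv, map_add]; abel
    rw [this, PiLp.add_apply, ha, hb]
    simp only [PiLp.add_apply, mul_add, Finset.sum_add_distrib]
  | hsmul c a ha =>
    have : curv (connOf Gm) y (basisVec i) (basisVec j) (c • a) =
        c • curv (connOf Gm) y (basisVec i) (basisVec j) a := by
      simp only [curv, map_smul, smul_add, smul_sub]
    rw [this, PiLp.smul_apply, ha, smul_eq_mul]
    simp only [PiLp.smul_apply, smul_eq_mul, Finset.mul_sum]
    exact Finset.sum_congr rfl fun i _ => Finset.sum_congr rfl fun j _ =>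
      Finset.sum_congr rfl fun k _ => by ring
  | hbasis k =>
  rw [h.curv_basisVec hy]
  simp [basisVec_apply]

/-- Translates the curvature hypothesis, given by index sums, into the form used for Jacobi fields.
-/
lemma curvatureForm_eq (h : IsMetricOn Gm U) {y : Coord n} (hy : y ∈ U) (v w : Coord n) :
    curvatureForm Gm y v w = formOf Gm y (curv (connOf Gm) y v w w) v := by
  rw [formOf_apply, pairing]
  simp only [h.curv_apply hy, curvatureForm, Finset.mul_sum, Finset.sum_mul]
  rw [sum_triple_comm]
  refine Finset.sum_congr rfl fun l _ => ?_
  rw [sum_triple_comm]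
  exact Finset.sum_congr rfl fun q _ => Finset.sum_congr rfl fun i _ =>
    Finset.sum_congr rfl fun j _ => Finset.sum_congr rfl fun k _ => by ring

end IsMetricOn

end Coordinates

/-! ### The metric and parallel transport in charts of the manifold. -/

section Charts

open Topology Set

variable {n : ℕ} {M : Type*} [TopologicalSpace M] [ChartedSpace (Coord n) M]

/-- The differential of the inverse of the chart around `x₀`. -/
def chartVec (x₀ : M) (y v : Coord n) :
    TangentSpace (𝓡 (n + 1)) ((extChartAt (𝓡 (n + 1)) x₀).symm y) :=
  mfderiv 𝓘(ℝ, Coord n) (𝓡 (n + 1)) (extChartAt (𝓡 (n + 1)) x₀).symm y v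

lemma chartComp_smul (x₀ : M) {x : M} (c : ℝ) (v : TangentSpace (𝓡 (n + 1)) x) :
    chartComp x₀ (c • v) = c • chartComp x₀ v := map_smul _ c v

/-- All tangent spaces are the same type `Coord n`, so one vector can be read at two points that are
equal only propositionally, such as x and its image under the chart and back. -/
lemma chartComp_congr_point (x₁ : M) {x x' : M} (h : x' = x) (v : Coord n) :
    chartComp x₁ (x := x') v = chartComp x₁ (x := x) v := by
  subst h; rfl

variable [IsManifold (𝓡 (n + 1)) ∞ M]

lemma contMDiffAt_chart_symm {x₀ : M} {y : Coord n}
    (hy : y ∈ (extChartAt (𝓡 (n + 1)) x₀).target) :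
    ContMDiffAt 𝓘(ℝ, Coord n) (𝓡 (n + 1)) ∞ (extChartAt (𝓡 (n + 1)) x₀).symm y :=
  (contMDiffOn_extChartAt_symm x₀).contMDiffAt (extChartAt_target_mem_nhds' hy)

lemma contMDiffAt_chart {x₀ x : M} (hx : x ∈ (extChartAt (𝓡 (n + 1)) x₀).source) :
    ContMDiffAt (𝓡 (n + 1)) 𝓘(ℝ, Coord n) ∞ (extChartAt (𝓡 (n + 1)) x₀) x :=
  contMDiffAt_extChartAt' (by rwa [← extChartAt_source (𝓡 (n + 1))])

lemma chartComp_mfderiv {x₀ : M} {E : Type*} [NormedAddCommGroup E] [NormedSpace ℝ E]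
    {ψ : E → M} {y : E} (hψ : MDifferentiableAt 𝓘(ℝ, E) (𝓡 (n + 1)) ψ y)
    (hy : ψ y ∈ (extChartAt (𝓡 (n + 1)) x₀).source) (v : E) :
    chartComp x₀ (mfderiv 𝓘(ℝ, E) (𝓡 (n + 1)) ψ y v) =
      fderiv ℝ (fun z => extChartAt (𝓡 (n + 1)) x₀ (ψ z)) y v := by
  have h := mfderiv_comp (I'' := 𝓘(ℝ, Coord n)) y
    ((contMDiffAt_chart hy).mdifferentiableAt (by simp)) hψ
  rw [mfderiv_eq_fderiv] at h
  exact (congrArg (fun L : E →L[ℝ] Coord n => L v) h).symm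

lemma differentiableAt_chart_comp {x₀ : M} {E : Type*} [NormedAddCommGroup E] [NormedSpace ℝ E]
    {ψ : E → M} {y : E} (hψ : MDifferentiableAt 𝓘(ℝ, E) (𝓡 (n + 1)) ψ y)
    (hy : ψ y ∈ (extChartAt (𝓡 (n + 1)) x₀).source) :
    DifferentiableAt ℝ (fun z => extChartAt (𝓡 (n + 1)) x₀ (ψ z)) y :=
  (((contMDiffAt_chart hy).mdifferentiableAt (by simp)).comp y hψ).differentiableAt

lemma contDiffAt_chart_comp {x₀ : M} {E : Type*} [NormedAddCommGroup E] [NormedSpace ℝ E]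
    {ψ : E → M} {y : E} (hψ : ContMDiffAt 𝓘(ℝ, E) (𝓡 (n + 1)) ∞ ψ y)
    (hy : ψ y ∈ (extChartAt (𝓡 (n + 1)) x₀).source) :
    ContDiffAt ℝ ∞ (fun z => extChartAt (𝓡 (n + 1)) x₀ (ψ z)) y :=
  ((contMDiffAt_chart hy).comp y hψ).contDiffAt

lemma chartComp_chartVec {x₀ : M} {y : Coord n} (hy : y ∈ (extChartAt (𝓡 (n + 1)) x₀).target)
    (v : Coord n) : chartComp x₀ (chartVec x₀ y v) = v := by
  have h := chartComp_mfderiv (x₀ := x₀)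
    ((contMDiffAt_chart_symm hy).mdifferentiableAt (by simp))
    ((extChartAt (𝓡 (n + 1)) x₀).map_target hy) v
  refine h.trans ?_
  have h1 : (fun z => extChartAt (𝓡 (n + 1)) x₀ ((extChartAt (𝓡 (n + 1)) x₀).symm z)) =ᶠ[𝓝 y]
      id := by
    filter_upwards [extChartAt_target_mem_nhds' hy] with z hz using
      (extChartAt (𝓡 (n + 1)) x₀).right_inv hz
  rw [h1.fderiv_eq, fderiv_id]
  rfl

lemma chartVec_chartComp {x₀ x : M} (hx : x ∈ (extChartAt (𝓡 (n + 1)) x₀).source)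
    (v : TangentSpace (𝓡 (n + 1)) x) :
    (chartVec x₀ (extChartAt (𝓡 (n + 1)) x₀ x) (chartComp x₀ v) : Coord n) = (v : Coord n) := by
  have hy := (extChartAt (𝓡 (n + 1)) x₀).map_source hx
  have h := mfderiv_comp (I := 𝓡 (n + 1)) (I'' := 𝓡 (n + 1)) x
    ((contMDiffAt_chart_symm hy).mdifferentiableAt (by simp))
    ((contMDiffAt_chart hx).mdifferentiableAt (by simp))
  have h1 : ((extChartAt (𝓡 (n + 1)) x₀).symm ∘ (extChartAt (𝓡 (n + 1)) x₀)) =ᶠ[𝓝 x] id := by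
    filter_upwards [extChartAt_source_mem_nhds' hx] with z hz using
      (extChartAt (𝓡 (n + 1)) x₀).left_inv hz
  rw [h1.mfderiv_eq, mfderiv_id] at h
  exact (congrArg (fun L : Coord n →L[ℝ] Coord n => L v) h).symm

lemma chartComp_injective {x₀ x : M} (hx : x ∈ (extChartAt (𝓡 (n + 1)) x₀).source)
    {v w : TangentSpace (𝓡 (n + 1)) x} (h : chartComp x₀ v = chartComp x₀ w) : v = w := by
  have h1 := chartVec_chartComp hx v
  rw [h, chartVec_chartComp hx w] at h1
  exact h1.symm

lemma formOf_chartMetric (g : Metric n M) (x₀ : M) (y v w : Coord n) :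
    formOf (chartMetric g x₀) y v w =
      g.inner ((extChartAt (𝓡 (n + 1)) x₀).symm y) (chartVec x₀ y v) (chartVec x₀ y w) := by
  have hadd : ∀ a b, chartVec x₀ y (a + b) = chartVec x₀ y a + chartVec x₀ y b :=
    fun a b => map_add _ a b
  have hsmul : ∀ (c : ℝ) a, chartVec x₀ y (c • a) = c • chartVec x₀ y a :=
    fun c a => map_smul _ c a
  induction v using coord_induction generalizing w with
  | hadd a b ha hb => rw [hadd, map_add, map_add, add_apply, add_apply, ha, hb]
  | hsmul c a ha => rw [hsmul, map_smul, map_smul, smul_apply, smul_apply, ha]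
  | hbasis i =>
  induction w using coord_induction with
  | hadd a b ha hb => rw [hadd, map_add, map_add, ha, hb]
  | hsmul c a ha => rw [hsmul, map_smul, map_smul, ha]
  | hbasis j =>
  rw [formOf_basisVec]
  rfl

lemma inner_congr_point (g : Metric n M) {x x' : M} (h : x' = x) (v w : Coord n) :
    g.inner x' (v : TangentSpace (𝓡 (n + 1)) x') (w : TangentSpace (𝓡 (n + 1)) x') =
      g.inner x (v : TangentSpace (𝓡 (n + 1)) x) (w : TangentSpace (𝓡 (n + 1)) x) := by
  subst h; rfl

lemma inner_eq_formOf (g : Metric n M) {x₀ x : M} (hx : x ∈ (extChartAt (𝓡 (n + 1)) x₀).source)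
    (v w : TangentSpace (𝓡 (n + 1)) x) :
    g.inner x v w = formOf (chartMetric g x₀) (extChartAt (𝓡 (n + 1)) x₀ x)
      (chartComp x₀ v) (chartComp x₀ w) := by
  rw [formOf_chartMetric]
  refine Eq.trans ?_ (inner_congr_point g ((extChartAt (𝓡 (n + 1)) x₀).left_inv hx) _ _).symm
  rw [chartVec_chartComp hx v, chartVec_chartComp hx w]

lemma pullbackMetric_eq_formOf (g : Metric n M) {x₀ : M} {ψ : Coord n → M} {y : Coord n}
    (hψ : MDifferentiableAt 𝓘(ℝ, Coord n) (𝓡 (n + 1)) ψ y)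
    (hy : ψ y ∈ (extChartAt (𝓡 (n + 1)) x₀).source) (i j : Fin (n + 1)) :
    pullbackMetric g ψ y i j = formOf (chartMetric g x₀) (extChartAt (𝓡 (n + 1)) x₀ (ψ y))
      (fderiv ℝ (fun z => extChartAt (𝓡 (n + 1)) x₀ (ψ z)) y (basisVec i))
      (fderiv ℝ (fun z => extChartAt (𝓡 (n + 1)) x₀ (ψ z)) y (basisVec j)) := by
  rw [← chartComp_mfderiv hψ hy, ← chartComp_mfderiv hψ hy, ← inner_eq_formOf g hy]
  rfl

/-- A coordinate field is the tangent map of the inverse chart applied to a constant section. Its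
smoothness into the tangent bundle allows it to be inserted into the smooth section g. -/
lemma contMDiffAt_chartVec {x₀ : M} {y : Coord n}
    (hy : y ∈ (extChartAt (𝓡 (n + 1)) x₀).target) (v : Coord n) :
    ContMDiffAt 𝓘(ℝ, Coord n) (𝓡 (n + 1)).tangent ∞
      (fun z => (⟨(extChartAt (𝓡 (n + 1)) x₀).symm z, chartVec x₀ z v⟩ :
        TangentBundle (𝓡 (n + 1)) M)) y := by
  have ht : IsOpen (extChartAt (𝓡 (n + 1)) x₀).target := isOpen_extChartAt_target x₀
  have h1 := (contMDiffOn_extChartAt_symm (n := ∞) (I := 𝓡 (n + 1)) x₀).contMDiffOn_tangentMapWithin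
    (m := ∞) (by simp) ht.uniqueMDiffOn
  have h2 : ContMDiff 𝓘(ℝ, Coord n) 𝓘(ℝ, Coord n).tangent ∞
      (fun z => (⟨z, v⟩ : TangentBundle 𝓘(ℝ, Coord n) (Coord n))) :=
    contMDiff_vectorSpace_iff_contDiff.2 contDiff_const
  have h3 := h1.comp (s := (extChartAt (𝓡 (n + 1)) x₀).target) h2.contMDiffOn (fun z hz => hz)
  refine (h3.contMDiffAt (ht.mem_nhds hy)).congr_of_eventuallyEq ?_
  filter_upwards [ht.mem_nhds hy] with z hz
  simp only [Function.comp_apply, tangentMapWithin, mfderivWithin_of_isOpen ht hz]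
  rfl

lemma contDiffAt_chartMetric (g : Metric n M) {x₀ : M} {y : Coord n}
    (hy : y ∈ (extChartAt (𝓡 (n + 1)) x₀).target) (i j : Fin (n + 1)) :
    ContDiffAt ℝ ∞ (fun z => chartMetric g x₀ z i j) y := by
  have h1 : ContMDiffAt 𝓘(ℝ, Coord n) ((𝓡 (n + 1)).prod 𝓘(ℝ)) ∞
      (fun z => Bundle.TotalSpace.mk' ℝ (E := Bundle.Trivial M ℝ)
        ((extChartAt (𝓡 (n + 1)) x₀).symm z)
        (g.inner ((extChartAt (𝓡 (n + 1)) x₀).symm z) (chartVec x₀ z (basisVec i))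
          (chartVec x₀ z (basisVec j)))) y := by
    apply ContMDiffAt.clm_bundle_apply₂ (F₁ := Coord n) (F₂ := Coord n)
    · exact g.contMDiff.contMDiffAt.comp y (contMDiffAt_chart_symm hy)
    · exact contMDiffAt_chartVec hy _
    · exact contMDiffAt_chartVec hy _
  simp only [Bundle.contMDiffAt_totalSpace] at h1
  exact h1.2.contDiffAt

lemma isMetricOn_chartMetric (g : Metric n M) (x₀ : M) :
    IsMetricOn (chartMetric g x₀) (extChartAt (𝓡 (n + 1)) x₀).target where
  isOpen := isOpen_extChartAt_target x₀
  contDiffAt _ hy := contDiffAt_chartMetric g hy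
  symm _ _ _ _ := g.symm _ _ _
  pos y hy v hv := by
    rw [← formOf_apply, formOf_chartMetric]
    refine g.pos _ _ fun h0 => hv ?_
    rw [← chartComp_chartVec hy v, h0]
    exact map_zero _

lemma isLeviCivitaOn_chart (g : Metric n M) (x₀ : M) :
    IsLeviCivitaOn (formOf (chartMetric g x₀)) (connOf (chartMetric g x₀))
      (extChartAt (𝓡 (n + 1)) x₀).target :=
  (isMetricOn_chartMetric g x₀).isLeviCivitaOn

/-- The change of coordinates from the chart around `x₀` to the chart around `x₁`. -/
def chartChange (x₀ x₁ : M) (y : Coord n) : Coord n :=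
  extChartAt (𝓡 (n + 1)) x₁ ((extChartAt (𝓡 (n + 1)) x₀).symm y)

lemma fderiv_chartChange {x₀ x₁ : M} {y : Coord n}
    (hy : y ∈ (extChartAt (𝓡 (n + 1)) x₀).target)
    (hy₁ : (extChartAt (𝓡 (n + 1)) x₀).symm y ∈ (extChartAt (𝓡 (n + 1)) x₁).source) (v : Coord n) :
    fderiv ℝ (chartChange x₀ x₁) y v = chartComp x₁ (chartVec x₀ y v) :=
  (chartComp_mfderiv ((contMDiffAt_chart_symm hy).mdifferentiableAt (by simp)) hy₁ v).symm

lemma chartComp_eq_fderiv_chartChange {x₀ x₁ x : M}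
    (hx : x ∈ (extChartAt (𝓡 (n + 1)) x₀).source) (hx₁ : x ∈ (extChartAt (𝓡 (n + 1)) x₁).source)
    (v : TangentSpace (𝓡 (n + 1)) x) :
    chartComp x₁ v =
      fderiv ℝ (chartChange x₀ x₁) (extChartAt (𝓡 (n + 1)) x₀ x) (chartComp x₀ v) := by
  have hl := (extChartAt (𝓡 (n + 1)) x₀).left_inv hx
  rw [fderiv_chartChange ((extChartAt (𝓡 (n + 1)) x₀).map_source hx) (by rwa [hl])]
  refine Eq.trans ?_ (chartComp_congr_point x₁ hl _).symm
  rw [chartVec_chartComp hx v]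

lemma chartComp_surjective {x₀ x : M} (hx : x ∈ (extChartAt (𝓡 (n + 1)) x₀).source) (w : Coord n) :
    ∃ v : TangentSpace (𝓡 (n + 1)) x, chartComp x₀ v = w :=
  ⟨(chartVec x₀ (extChartAt (𝓡 (n + 1)) x₀ x) w : Coord n),
    (chartComp_congr_point x₀ ((extChartAt (𝓡 (n + 1)) x₀).left_inv hx) _).symm.trans
      (chartComp_chartVec ((extChartAt (𝓡 (n + 1)) x₀).map_source hx) w)⟩

/-- Parallel transport in one chart is parallel transport in every chart. -/
lemma hasDerivAt_chartComp_of_chart (g : Metric n M) {x₀ x₁ : M} {c : ℝ → M}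
    {V : ∀ t, TangentSpace (𝓡 (n + 1)) (c t)} {t : ℝ}
    (hc : MDifferentiableAt 𝓘(ℝ, ℝ) (𝓡 (n + 1)) c t)
    (h₀ : c t ∈ (extChartAt (𝓡 (n + 1)) x₀).source)
    (h₁ : c t ∈ (extChartAt (𝓡 (n + 1)) x₁).source)
    (hV : HasDerivAt (fun τ => chartComp x₀ (V τ))
      (-connOf (chartMetric g x₀) (extChartAt (𝓡 (n + 1)) x₀ (c t))
        (chartComp x₀ (velocity c t)) (chartComp x₀ (V t))) t) :
    HasDerivAt (fun τ => chartComp x₁ (V τ))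
      (-connOf (chartMetric g x₁) (extChartAt (𝓡 (n + 1)) x₁ (c t))
        (chartComp x₁ (velocity c t)) (chartComp x₁ (V t))) t := by
  have hl := (extChartAt (𝓡 (n + 1)) x₀).left_inv h₀
  have hy := (extChartAt (𝓡 (n + 1)) x₀).map_source h₀
  have hchange : chartChange x₀ x₁ (extChartAt (𝓡 (n + 1)) x₀ (c t)) =
      extChartAt (𝓡 (n + 1)) x₁ (c t) := by rw [chartChange, hl]
  have hsymm := continuousAt_extChartAt_symm'' hy
  have hsrc : ∀ᶠ p in 𝓝 (extChartAt (𝓡 (n + 1)) x₀ (c t)),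
      (extChartAt (𝓡 (n + 1)) x₀).symm p ∈ (extChartAt (𝓡 (n + 1)) x₁).source :=
    hsymm.eventually_mem ((isOpen_extChartAt_source x₁).mem_nhds (by rwa [hl]))
  have key := (isLeviCivitaOn_chart g x₀).hasDerivAt_parallel_of_isometry
    (isLeviCivitaOn_chart g x₁) (ψ := chartChange x₀ x₁)
    (c := fun τ => extChartAt (𝓡 (n + 1)) x₀ (c τ)) (V := fun τ => chartComp x₀ (V τ)) (t := t)
    (c' := chartComp x₀ (velocity c t)) hy
    (by rw [hchange]; exact (extChartAt (𝓡 (n + 1)) x₁).map_source h₁)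
    (contDiffAt_chart_comp (contMDiffAt_chart_symm hy) (by rwa [hl])) ?_ ?_ ?_ hV
  · rw [hchange, ← chartComp_eq_fderiv_chartChange h₀ h₁,
      ← chartComp_eq_fderiv_chartChange h₀ h₁] at key
    refine key.congr_of_eventuallyEq ?_
    filter_upwards [hc.continuousAt.eventually_mem ((isOpen_extChartAt_source x₀).mem_nhds h₀),
      hc.continuousAt.eventually_mem ((isOpen_extChartAt_source x₁).mem_nhds h₁)] with τ hτ₀ hτ₁
    exact chartComp_eq_fderiv_chartChange hτ₀ hτ₁ _
  -- The differential of the chart change is onto, because every vector is the component vector of a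
  -- tangent vector in either chart.
  · intro w
    obtain ⟨v, rfl⟩ := chartComp_surjective h₁ w
    exact ⟨chartComp x₀ v, (chartComp_eq_fderiv_chartChange h₀ h₁ v).symm⟩
  · filter_upwards [hsrc, extChartAt_target_mem_nhds' hy] with p hp hpt
    intro v w
    rw [fderiv_chartChange hpt hp, fderiv_chartChange hpt hp, formOf_chartMetric,
      inner_eq_formOf g hp]
    rfl
  · have h3 := chartComp_mfderiv hc h₀ (1 : ℝ)
    have h4 := (differentiableAt_chart_comp hc h₀).hasDerivAt
    rw [← fderiv_apply_one_eq_deriv] at h4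
    rw [← h3] at h4
    exact h4

lemma hasDerivAt_coord {f : ℝ → Coord n} {f' : Coord n} {t : ℝ} :
    HasDerivAt f f' t ↔ ∀ k, HasDerivAt (fun τ => f τ k) (f' k) t := by
  constructor
  · intro h k
    exact (EuclideanSpace.proj k : Coord n →L[ℝ] ℝ).hasFDerivAt.comp_hasDerivAt t h
  · intro h
    have h1 : HasDerivAt (fun τ => WithLp.ofLp (f τ)) (WithLp.ofLp f') t := hasDerivAt_pi.2 h
    exact (PiLp.continuousLinearEquiv 2 ℝ (fun _ : Fin (n + 1) => ℝ)).symm.hasFDerivAt.comp_hasDerivAt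
      t h1

lemma isParallelOn_iff (g : Metric n M) {c : ℝ → M} {V : ∀ t, TangentSpace (𝓡 (n + 1)) (c t)}
    {s : Set ℝ} : IsParallelOn g c V s ↔
      ∀ t ∈ s, ∀ x₀ : M, c t ∈ (extChartAt (𝓡 (n + 1)) x₀).source →
        HasDerivAt (fun τ => chartComp x₀ (V τ))
          (-connOf (chartMetric g x₀) (extChartAt (𝓡 (n + 1)) x₀ (c t))
            (chartComp x₀ (velocity c t)) (chartComp x₀ (V t))) t := by
  simp only [IsParallelOn, hasDerivAt_coord, PiLp.neg_apply, connOf_apply]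

end Charts

/-! ### Geodesics, their uniqueness, and the exponential map. -/

section Geodesics

open Topology Set

/-- Solutions of smooth differential equations are smooth. -/
lemma contDiffOn_of_hasDerivAt {E : Type*} [NormedAddCommGroup E] [NormedSpace ℝ E] {s : Set ℝ}
    (hs : IsOpen s) {z : ℝ → E} {F : ℝ × E → E} (hF : ∀ t ∈ s, ContDiffAt ℝ ∞ F (t, z t))
    (hz : ∀ t ∈ s, HasDerivAt z (F (t, z t)) t) : ContDiffOn ℝ ∞ z s := by
  refine contDiffOn_infty.2 fun k => ?_
  induction k with
  | zero =>
    exact contDiffOn_zero.2 fun t ht => (hz t ht).continuousAt.continuousWithinAt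
  | succ k ih =>
    -- Bootstrapping: a solution of class C^k has a right hand side of class C^k, hence is of class
    -- C^(k+1).
    have h1 : ContDiffOn ℝ k (fun t => F (t, z t)) s := fun t ht =>
      ((hF t ht).of_le (by exact_mod_cast le_top)).comp_contDiffWithinAt t
        (contDiffWithinAt_id.prodMk (ih t ht))
    refine (contDiffOn_succ_iff_deriv_of_isOpen (n := k) hs).2
      ⟨fun t ht => (hz t ht).differentiableAt.differentiableWithinAt, by simp, ?_⟩
    exact h1.congr fun t ht => (hz t ht).deriv

/-- The vector field on `E × E` whose integral curves are the geodesics and their velocities. -/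
def geodesicField {E : Type*} [NormedAddCommGroup E] [NormedSpace ℝ E]
    (B : E → E →L[ℝ] E →L[ℝ] E) (z : E × E) : E × E := (z.2, -B z.1 z.2 z.2)

lemma contDiffAt_geodesicField {E : Type*} [NormedAddCommGroup E] [NormedSpace ℝ E]
    {B : E → E →L[ℝ] E →L[ℝ] E} {z : E × E} (hB : ContDiffAt ℝ ∞ B z.1) :
    ContDiffAt ℝ ∞ (geodesicField B) z :=
  contDiffAt_snd.prodMk (contDiffAt_bilin_comp (Φ := Prod.fst) hB contDiffAt_fst contDiffAt_snd
    contDiffAt_snd).neg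

variable {n : ℕ} {M : Type*} [TopologicalSpace M] [ChartedSpace (Coord n) M]
  [IsManifold (𝓡 (n + 1)) ∞ M]

lemma hasDerivAt_chart_comp {x₀ : M} {c : ℝ → M} {t : ℝ}
    (hc : MDifferentiableAt 𝓘(ℝ, ℝ) (𝓡 (n + 1)) c t)
    (h₀ : c t ∈ (extChartAt (𝓡 (n + 1)) x₀).source) :
    HasDerivAt (fun τ => extChartAt (𝓡 (n + 1)) x₀ (c τ)) (chartComp x₀ (velocity c t)) t := by
  have h3 := chartComp_mfderiv hc h₀ (1 : ℝ)
  have h4 := (differentiableAt_chart_comp hc h₀).hasDerivAt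
  rw [← fderiv_apply_one_eq_deriv] at h4
  rw [← h3] at h4
  exact h4

/-- By invariance under chart changes the equation need only be verified in one chart at each time.
-/
lemma isGeodesicOn_iff (g : Metric n M) {c : ℝ → M} {s : Set ℝ} (hs : IsOpen s) :
    IsGeodesicOn g c s ↔ ContMDiffOn 𝓘(ℝ, ℝ) (𝓡 (n + 1)) ∞ c s ∧
      ∀ t ∈ s, ∃ x₀ : M, c t ∈ (extChartAt (𝓡 (n + 1)) x₀).source ∧
        HasDerivAt (fun τ => chartComp x₀ (velocity c τ))
          (-connOf (chartMetric g x₀) (extChartAt (𝓡 (n + 1)) x₀ (c t))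
            (chartComp x₀ (velocity c t)) (chartComp x₀ (velocity c t))) t := by
  rw [IsGeodesicOn, isParallelOn_iff]
  refine and_congr_right fun hc => ⟨fun h t ht => ?_, fun h t ht x₁ hx₁ => ?_⟩
  · exact ⟨c t, mem_extChartAt_source (c t), h t ht _ (mem_extChartAt_source (c t))⟩
  · obtain ⟨x₀, hx₀, h0⟩ := h t ht
    exact hasDerivAt_chartComp_of_chart g
      ((hc.contMDiffAt (hs.mem_nhds ht)).mdifferentiableAt (by simp)) hx₀ hx₁ h0

/-- `(α, β)` is a solution of the geodesic equation in the chart around `x₀`. -/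
def IsChartGeodesicOn (g : Metric n M) (x₀ : M) (z : ℝ → Coord n × Coord n) (s : Set ℝ) : Prop :=
  ∀ t ∈ s, (z t).1 ∈ (extChartAt (𝓡 (n + 1)) x₀).target ∧
    HasDerivAt z (geodesicField (connOf (chartMetric g x₀)) (z t)) t

namespace IsChartGeodesicOn

variable {g : Metric n M} {x₀ : M} {z : ℝ → Coord n × Coord n} {s : Set ℝ}

lemma hasDerivAt_fst (hz : IsChartGeodesicOn g x₀ z s) {t : ℝ} (ht : t ∈ s) :
    HasDerivAt (fun τ => (z τ).1) (z t).2 t :=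
  HasFDerivAt.comp_hasDerivAt (x := t) (f := z) (l := Prod.fst) hasFDerivAt_fst (hz t ht).2

lemma hasDerivAt_snd (hz : IsChartGeodesicOn g x₀ z s) {t : ℝ} (ht : t ∈ s) :
    HasDerivAt (fun τ => (z τ).2) (-connOf (chartMetric g x₀) (z t).1 (z t).2 (z t).2) t :=
  HasFDerivAt.comp_hasDerivAt (x := t) (f := z) (l := Prod.snd) hasFDerivAt_snd (hz t ht).2

lemma contDiffOn (hz : IsChartGeodesicOn g x₀ z s) (hs : IsOpen s) : ContDiffOn ℝ ∞ z s :=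
  contDiffOn_of_hasDerivAt hs (F := fun p => geodesicField (connOf (chartMetric g x₀)) p.2)
    (fun t ht => ContDiffAt.comp (t, z t) (f := Prod.snd) (contDiffAt_geodesicField
      ((isMetricOn_chartMetric g x₀).contDiffAt_connOf (hz t ht).1)) contDiffAt_snd)
    fun t ht => (hz t ht).2

lemma contMDiffOn (hz : IsChartGeodesicOn g x₀ z s) (hs : IsOpen s) :
    ContMDiffOn 𝓘(ℝ, ℝ) (𝓡 (n + 1)) ∞
      (fun t => (extChartAt (𝓡 (n + 1)) x₀).symm (z t).1) s := by
  intro t ht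
  have h1 : ContMDiffAt 𝓘(ℝ, ℝ) 𝓘(ℝ, Coord n) ∞ (fun τ => (z τ).1) t :=
    (((hz.contDiffOn hs).contDiffAt (hs.mem_nhds ht)).fst).contMDiffAt
  exact (ContMDiffAt.comp t (g := (extChartAt (𝓡 (n + 1)) x₀).symm)
    (contMDiffAt_chart_symm (hz t ht).1) h1).contMDiffWithinAt

lemma chartComp_velocity (hz : IsChartGeodesicOn g x₀ z s) (hs : IsOpen s) {t : ℝ} (ht : t ∈ s) :
    chartComp x₀ (velocity (fun t => (extChartAt (𝓡 (n + 1)) x₀).symm (z t).1) t) = (z t).2 := by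
  have h1 := hasDerivAt_chart_comp (x₀ := x₀)
    (((hz.contMDiffOn hs).contMDiffAt (hs.mem_nhds ht)).mdifferentiableAt (by simp))
    ((extChartAt (𝓡 (n + 1)) x₀).map_target (hz t ht).1)
  refine h1.unique ((hz.hasDerivAt_fst ht).congr_of_eventuallyEq ?_)
  filter_upwards [hs.mem_nhds ht] with τ hτ
  exact (extChartAt (𝓡 (n + 1)) x₀).right_inv (hz τ hτ).1

/-- A solution of the geodesic equation in one chart is a geodesic. -/
lemma isGeodesicOn (hz : IsChartGeodesicOn g x₀ z s) (hs : IsOpen s) :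
    IsGeodesicOn g (fun t => (extChartAt (𝓡 (n + 1)) x₀).symm (z t).1) s := by
  rw [isGeodesicOn_iff g hs]
  refine ⟨hz.contMDiffOn hs, fun t ht =>
    ⟨x₀, (extChartAt (𝓡 (n + 1)) x₀).map_target (hz t ht).1, ?_⟩⟩
  rw [hz.chartComp_velocity hs ht, (extChartAt (𝓡 (n + 1)) x₀).right_inv (hz t ht).1]
  refine (hz.hasDerivAt_snd ht).congr_of_eventuallyEq ?_
  filter_upwards [hs.mem_nhds ht] with τ hτ
  exact hz.chartComp_velocity hs hτ

/-- Affine reparametrization of geodesics. -/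
lemma scale (hz : IsChartGeodesicOn g x₀ z s) (r : ℝ) :
    IsChartGeodesicOn g x₀ (fun t => ((z (r * t)).1, r • (z (r * t)).2)) {t | r * t ∈ s} := by
  intro t ht
  refine ⟨(hz _ ht).1, ?_⟩
  have hr : HasDerivAt (fun t : ℝ => r * t) r t := by simpa using (hasDerivAt_id t).const_mul r
  have h1 : HasDerivAt (fun t => (z (r * t)).1) (r • (z (r * t)).2) t :=
    HasDerivAt.scomp t (hz.hasDerivAt_fst ht) hr
  have h2 : HasDerivAt (fun t => (z (r * t)).2)
      (r • (-connOf (chartMetric g x₀) (z (r * t)).1 (z (r * t)).2 (z (r * t)).2)) t :=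
    HasDerivAt.scomp t (hz.hasDerivAt_snd ht) hr
  refine (h1.prodMk (h2.const_smul r)).congr_deriv ?_
  simp [geodesicField, smul_smul]

end IsChartGeodesicOn

/-- A geodesic satisfies the geodesic equation in every chart. -/
lemma IsGeodesicOn.isChartGeodesicOn {g : Metric n M} {c : ℝ → M} {s : Set ℝ} (hs : IsOpen s)
    (hc : IsGeodesicOn g c s) (x₀ : M) :
    IsChartGeodesicOn g x₀ (fun t => (extChartAt (𝓡 (n + 1)) x₀ (c t), chartComp x₀ (velocity c t)))
      (s ∩ c ⁻¹' (extChartAt (𝓡 (n + 1)) x₀).source) := by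
  rintro t ⟨ht, hts⟩
  refine ⟨(extChartAt (𝓡 (n + 1)) x₀).map_source hts, ?_⟩
  exact (hasDerivAt_chart_comp ((hc.1.contMDiffAt (hs.mem_nhds ht)).mdifferentiableAt (by simp))
    hts).prodMk ((isParallelOn_iff g).1 hc.2 t ht x₀ hts)

lemma IsChartGeodesicOn.eventuallyEq {g : Metric n M} {x₀ : M} {z₁ z₂ : ℝ → Coord n × Coord n}
    {s : Set ℝ} {t : ℝ} (hs : s ∈ 𝓝 t) (h₁ : IsChartGeodesicOn g x₀ z₁ s)
    (h₂ : IsChartGeodesicOn g x₀ z₂ s) (h : z₁ t = z₂ t) : z₁ =ᶠ[𝓝 t] z₂ := by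
  have ht := mem_of_mem_nhds hs
  have hf : ContDiffAt ℝ ∞ (geodesicField (connOf (chartMetric g x₀))) (z₁ t) :=
    contDiffAt_geodesicField ((isMetricOn_chartMetric g x₀).contDiffAt_connOf (h₁ t ht).1)
  obtain ⟨K, u, hu, hK⟩ := (hf.of_le (m := 1) ENat.LEInfty.out).exists_lipschitzOnWith
  refine ODE_solution_unique_of_eventually (s := fun _ => u)
    (v := fun _ => geodesicField (connOf (chartMetric g x₀))) (Filter.Eventually.of_forall
      fun _ => hK) ?_ ?_ h
  · filter_upwards [hs, (h₁ t ht).2.continuousAt.eventually_mem hu] with τ hτ hτ'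
    exact ⟨(h₁ τ hτ).2, hτ'⟩
  · filter_upwards [hs, (h₂ t ht).2.continuousAt.eventually_mem (h ▸ hu)] with τ hτ hτ'
    exact ⟨(h₂ τ hτ).2, hτ'⟩

/-- Two geodesics that are tangent at `t` coincide near `t`. -/
lemma IsGeodesicOn.eventuallyEq {g : Metric n M} {c₁ c₂ : ℝ → M} {s : Set ℝ} (hs : IsOpen s)
    (h₁ : IsGeodesicOn g c₁ s) (h₂ : IsGeodesicOn g c₂ s) {t : ℝ} (ht : t ∈ s) {x₀ : M}
    (hx₀ : c₁ t ∈ (extChartAt (𝓡 (n + 1)) x₀).source) (hpt : c₁ t = c₂ t)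
    (hvel : chartComp x₀ (velocity (n := n) c₁ t) = chartComp x₀ (velocity (n := n) c₂ t)) :
    c₁ =ᶠ[𝓝 t] c₂ := by
  have hn₁ : c₁ ⁻¹' (extChartAt (𝓡 (n + 1)) x₀).source ∈ 𝓝 t :=
    (h₁.1.contMDiffAt (hs.mem_nhds ht)).continuousAt.preimage_mem_nhds
      ((isOpen_extChartAt_source x₀).mem_nhds hx₀)
  have hn₂ : c₂ ⁻¹' (extChartAt (𝓡 (n + 1)) x₀).source ∈ 𝓝 t :=
    (h₂.1.contMDiffAt (hs.mem_nhds ht)).continuousAt.preimage_mem_nhds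
      ((isOpen_extChartAt_source x₀).mem_nhds (hpt ▸ hx₀))
  have g₁ := h₁.isChartGeodesicOn hs x₀
  have g₂ := h₂.isChartGeodesicOn hs x₀
  have hmem := Filter.inter_mem (hs.mem_nhds ht) (Filter.inter_mem hn₁ hn₂)
  have key := IsChartGeodesicOn.eventuallyEq hmem
    (fun τ hτ => g₁ τ ⟨hτ.1, hτ.2.1⟩) (fun τ hτ => g₂ τ ⟨hτ.1, hτ.2.2⟩)
    (by simp only [hvel, hpt])
  filter_upwards [key, hmem] with τ hτ hm
  exact (extChartAt (𝓡 (n + 1)) x₀).injOn hm.2.1 hm.2.2 (congrArg Prod.fst hτ)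

/-- Uniqueness of geodesics with given initial velocity in Hausdorff manifolds. -/
theorem IsGeodesicOn.eqOn [T2Space M] {g : Metric n M} {c₁ c₂ : ℝ → M} {s : Set ℝ}
    (hs : IsOpen s) (hconn : IsPreconnected s)
    (h₁ : IsGeodesicOn g c₁ s) (h₂ : IsGeodesicOn g c₂ s) {t₀ : ℝ} (ht₀ : t₀ ∈ s)
    (h₀ : (⟨c₁ t₀, velocity c₁ t₀⟩ : TangentBundle (𝓡 (n + 1)) M) = ⟨c₂ t₀, velocity c₂ t₀⟩) :
    EqOn c₁ c₂ s := by
  set A : Set ℝ := {t | c₁ =ᶠ[𝓝 t] c₂} with hA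
  have hAo : IsOpen A := isOpen_iff_mem_nhds.2 fun t ht => by
    have : ∀ᶠ τ in 𝓝 t, c₁ =ᶠ[𝓝 τ] c₂ := Filter.Eventually.eventually_nhds ht
    exact this
  have hsub : s ⊆ A := by
    -- The times near which the curves coincide form an open set A. It is relatively closed: at a
    -- limit time the positions agree since M is Hausdorff, the velocities agree by continuity in a
    -- chart, and local uniqueness applies.
    refine hconn.subset_of_closure_inter_subset hAo ⟨t₀, ht₀, ?_⟩ ?_
    · refine h₁.eventuallyEq hs h₂ ht₀ (x₀ := c₁ t₀) (mem_extChartAt_source _)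
        (congrArg Bundle.TotalSpace.proj h₀) ?_
      exact congrArg (fun q : TangentBundle (𝓡 (n + 1)) M => chartComp (c₁ t₀) q.2) h₀
    · rintro t ⟨htA, hts⟩
      have hfreq : ∃ᶠ τ in 𝓝 t, τ ∈ A := mem_closure_iff_frequently.1 htA
      have hk₁ := (h₁.1.contMDiffAt (hs.mem_nhds hts)).continuousAt
      have hk₂ := (h₂.1.contMDiffAt (hs.mem_nhds hts)).continuousAt
      have hpt : c₁ t = c₂ t := tendsto_nhds_unique_of_frequently_eq hk₁ hk₂
        (hfreq.mono fun τ hτ => Filter.EventuallyEq.eq_of_nhds hτ)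
      have hsrc : c₁ t ∈ (extChartAt (𝓡 (n + 1)) (c₁ t)).source := mem_extChartAt_source _
      have hv₁ := ((isParallelOn_iff g).1 h₁.2 t hts (c₁ t) hsrc).continuousAt
      have hv₂ := ((isParallelOn_iff g).1 h₂.2 t hts (c₁ t) (hpt ▸ hsrc)).continuousAt
      refine h₁.eventuallyEq hs h₂ hts hsrc hpt ?_
      refine tendsto_nhds_unique_of_frequently_eq hv₁ hv₂ ?_
      have hev : ∀ᶠ τ in 𝓝 t, τ ∈ s ∧ c₁ τ ∈ (extChartAt (𝓡 (n + 1)) (c₁ t)).source :=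
        (hs.eventually_mem hts).and (hk₁.eventually_mem ((isOpen_extChartAt_source _).mem_nhds hsrc))
      refine (hfreq.and_eventually hev).mono fun τ hτ => ?_
      have hd₁ := hasDerivAt_chart_comp (x₀ := c₁ t)
        ((h₁.1.contMDiffAt (hs.mem_nhds hτ.2.1)).mdifferentiableAt (by simp)) hτ.2.2
      have hτe : c₁ τ = c₂ τ := Filter.EventuallyEq.eq_of_nhds hτ.1
      have hd₂ := hasDerivAt_chart_comp (x₀ := c₁ t)
        ((h₂.1.contMDiffAt (hs.mem_nhds hτ.2.1)).mdifferentiableAt (by simp)) (hτe ▸ hτ.2.2)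
      refine hd₁.unique (hd₂.congr_of_eventuallyEq ?_)
      exact (show c₁ =ᶠ[𝓝 τ] c₂ from hτ.1).fun_comp _
  exact fun t ht => Filter.EventuallyEq.eq_of_nhds (hsub ht)

/-- The definition picks an unspecified geodesic on an unspecified interval. Uniqueness on the
smaller of the two intervals makes the value at time 1 computable from any geodesic with the right
initial velocity. -/
lemma geodesicExp_eq [T2Space M] {g : Metric n M} {c : ℝ → M} {ε : ℝ} (hε : 0 < ε)
    (hc : IsGeodesicOn g c (Ioo (-ε) (1 + ε))) {p : M} {v : TangentSpace (𝓡 (n + 1)) p}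
    (h₀ : (⟨c 0, velocity c 0⟩ : TangentBundle (𝓡 (n + 1)) M) = ⟨p, v⟩) :
    geodesicExp g p v = c 1 := by
  have hex : ∃ c : ℝ → M, (∃ ε > 0, IsGeodesicOn g c (Set.Ioo (-ε) (1 + ε))) ∧
      (⟨c 0, velocity c 0⟩ : TangentBundle (𝓡 (n + 1)) M) = ⟨p, v⟩ := ⟨c, ⟨ε, hε, hc⟩, h₀⟩
  rw [geodesicExp, dif_pos hex]
  obtain ⟨⟨ε', hε', hc'⟩, h₀'⟩ := hex.choose_spec
  have hm : 0 < min ε ε' := lt_min hε hε'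
  have hmono : ∀ δ, min ε ε' ≤ δ → Ioo (-(min ε ε')) (1 + min ε ε') ⊆ Ioo (-δ) (1 + δ) :=
    fun δ hδ => Ioo_subset_Ioo (by linarith) (by linarith)
  have hres : ∀ {c : ℝ → M} {a b : Set ℝ}, a ⊆ b → IsGeodesicOn g c b → IsGeodesicOn g c a :=
    fun hab h => ⟨h.1.mono hab, fun t ht => h.2 t (hab ht)⟩
  exact IsGeodesicOn.eqOn isOpen_Ioo isPreconnected_Ioo
    (hres (hmono ε' (min_le_right _ _)) hc') (hres (hmono ε (min_le_left _ _)) hc)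
    (t₀ := 0) ⟨by linarith, by linarith⟩ (h₀'.trans h₀.symm) ⟨by linarith, by linarith⟩

lemma tangentBundle_ext {x₀ x p : M} (hp : p ∈ (extChartAt (𝓡 (n + 1)) x₀).source)
    {w : TangentSpace (𝓡 (n + 1)) x} {v : TangentSpace (𝓡 (n + 1)) p} (hx : x = p)
    (h : chartComp x₀ w = chartComp x₀ v) :
    (⟨x, w⟩ : TangentBundle (𝓡 (n + 1)) M) = ⟨p, v⟩ := by
  subst hx
  rw [chartComp_injective hp h]

/-- The exponential map in a chart. -/
lemma geodesicExp_smul_eq_of_chart [T2Space M] {g : Metric n M} {x₀ : M}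
    {z : ℝ → Coord n × Coord n} (hz : IsChartGeodesicOn g x₀ z (Ioo (-1) 2)) {p : M}
    (hp : p ∈ (extChartAt (𝓡 (n + 1)) x₀).source) {v : TangentSpace (𝓡 (n + 1)) p}
    (hz₀ : z 0 = (extChartAt (𝓡 (n + 1)) x₀ p, chartComp x₀ v)) {r : ℝ}
    (hr : r ∈ Ioo (-1 : ℝ) 2) :
    geodesicExp g p (r • v) = (extChartAt (𝓡 (n + 1)) x₀).symm (z r).1 := by
  have hscale := hz.scale r
  have ho : IsOpen {t : ℝ | r * t ∈ Ioo (-1 : ℝ) 2} :=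
    isOpen_Ioo.preimage (continuous_const.mul continuous_id)
  have hgeo := hscale.isGeodesicOn ho
  -- A quarter of the distance of r to the ends of (-1, 2) suffices, because |r| < 2.
  obtain ⟨ε, hε, hsub⟩ : ∃ ε > 0, Ioo (-ε) (1 + ε) ⊆ {t : ℝ | r * t ∈ Ioo (-1 : ℝ) 2} := by
    have h1 := min_le_left (2 - r) (1 + r)
    have h2 := min_le_right (2 - r) (1 + r)
    have h3 : 0 < min (2 - r) (1 + r) := lt_min (by linarith [hr.2]) (by linarith [hr.1])
    refine ⟨min (2 - r) (1 + r) / 4, by linarith, fun t ht => ?_⟩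
    rcases le_total 0 r with h | h
    · exact ⟨by nlinarith [ht.1, ht.2, hr.2], by nlinarith [ht.1, ht.2, hr.2]⟩
    · exact ⟨by nlinarith [ht.1, ht.2, hr.1], by nlinarith [ht.1, ht.2, hr.1]⟩
  have h0mem : (0 : ℝ) ∈ {t : ℝ | r * t ∈ Ioo (-1 : ℝ) 2} := by simp
  have h := geodesicExp_eq hε ⟨hgeo.1.mono hsub, fun t ht => hgeo.2 t (hsub ht)⟩ (p := p)
    (v := r • v) ?_
  · rw [h, mul_one]
  · refine tangentBundle_ext hp ?_ ?_
    · simp only [mul_zero, hz₀]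
      exact (extChartAt (𝓡 (n + 1)) x₀).left_inv hp
    · rw [hscale.chartComp_velocity ho h0mem, chartComp_smul]
      simp [hz₀]

end Geodesics

/-! ### The normal exponential map in a chart around a point of γ. -/

section FermiChart

open Topology Set

variable {n : ℕ}

/-- Multiplication of all coordinates but the first by `r`. -/
def radial (r : ℝ) (ξ : Coord n) : Coord n := ξ 0 • basisVec 0 + r • (ξ - ξ 0 • basisVec 0)

@[simp] lemma radial_zero_coord (r : ℝ) (ξ : Coord n) : radial r ξ 0 = ξ 0 := by
  simp [radial, basisVec_apply]

@[simp] lemma radial_succ_coord (r : ℝ) (ξ : Coord n) (m : Fin n) :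
    radial r ξ m.succ = r * ξ m.succ := by
  simp [radial, basisVec_apply]

@[simp] lemma radial_one (ξ : Coord n) : radial 1 ξ = ξ := by simp [radial]

lemma radial_zero (ξ : Coord n) : radial 0 ξ = axis n (ξ 0) := by simp [radial, axis]

@[simp] lemma axis_zero_coord (s : ℝ) : axis n s 0 = s := by simp [axis, basisVec_apply]

@[simp] lemma axis_succ_coord (s : ℝ) (m : Fin n) : axis n s m.succ = 0 := by
  simp [axis, basisVec_apply]

lemma coord_ext {ξ η : Coord n} (h₀ : ξ 0 = η 0) (h : ∀ m : Fin n, ξ m.succ = η m.succ) :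
    ξ = η := by
  ext i
  exact Fin.cases h₀ h i

lemma contDiff_coord (i : Fin (n + 1)) : ContDiff ℝ ∞ (fun ξ : Coord n => ξ i) :=
  (EuclideanSpace.proj i : Coord n →L[ℝ] ℝ).contDiff

lemma contDiff_radial : ContDiff ℝ ∞ (fun p : ℝ × Coord n => radial p.1 p.2) := by
  have h0 : ContDiff ℝ ∞ (fun p : ℝ × Coord n => p.2 0 • (basisVec 0 : Coord n)) :=
    ((contDiff_coord 0).comp contDiff_snd).smul contDiff_const
  exact h0.add (contDiff_fst.smul (contDiff_snd.sub h0))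

lemma contDiff_bump_smul {F : Type*} [NormedAddCommGroup F] [NormedSpace ℝ F] {y₀ : Coord n}
    (χ : ContDiffBump y₀) {B : Coord n → F}
    (hB : ∀ y ∈ Metric.closedBall y₀ χ.rOut, ContDiffAt ℝ ∞ B y) :
    ContDiff ℝ ∞ (fun y => χ y • B y) := by
  rw [contDiff_iff_contDiffAt]
  intro y
  by_cases hy : y ∈ Metric.closedBall y₀ χ.rOut
  · exact χ.contDiffAt.smul (hB y hy)
  · have h1 : (fun y => χ y • B y) =ᶠ[𝓝 y] fun _ => 0 := by
      filter_upwards [Metric.isClosed_closedBall.isOpen_compl.mem_nhds hy] with y' hy'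
      rw [χ.zero_of_le_dist (le_of_lt (by simpa using hy')), zero_smul]
    exact contDiffAt_const.congr_of_eventuallyEq h1

variable {M : Type*} [TopologicalSpace M] [ChartedSpace (Coord n) M]

lemma mem_target_of_source {x₀ x : M} (hx : x ∈ (extChartAt (𝓡 (n + 1)) x₀).source) :
    extChartAt (𝓡 (n + 1)) x₀ x ∈ (extChartAt (𝓡 (n + 1)) x₀).target :=
  (extChartAt (𝓡 (n + 1)) x₀).map_source hx

/-- Initial velocity, in the chart around `x₀`, of the geodesics normal to `γ`. -/
def normalVec {γ : ℝ → M} (e : Fin (n + 1) → ∀ t, TangentSpace (𝓡 (n + 1)) (γ t)) (x₀ : M)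
    (ξ : Coord n) : Coord n := ∑ m : Fin n, ξ m.succ • chartComp x₀ (e m.succ (ξ 0))

lemma chartComp_normal {γ : ℝ → M} {e : Fin (n + 1) → ∀ t, TangentSpace (𝓡 (n + 1)) (γ t)}
    (x₀ : M) (ξ : Coord n) :
    chartComp x₀ (∑ m : Fin n, ξ m.succ • e m.succ (ξ 0)) = normalVec e x₀ ξ := by
  simp only [normalVec, chartComp, map_sum, map_smul]
  rfl

variable [IsManifold (𝓡 (n + 1)) ∞ M]

/-- Geodesics in a chart with small initial velocity exist for times in `(-1, 2)` and depend
smoothly on their initial data. -/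
theorem exists_chart_geodesic_flow (g : Metric n M) (x₀ : M) :
    ∃ S : Coord n × Coord n → C(TimeIcc, Coord n × Coord n),
      ∀ᶠ z in 𝓝 (extChartAt (𝓡 (n + 1)) x₀ x₀, (0 : Coord n)), ContDiffAt ℝ ∞ S z ∧
        extendCurve (S z) 0 = z ∧ IsChartGeodesicOn g x₀ (extendCurve (S z)) (Ioo (-1) 2) := by
  set y₀ := extChartAt (𝓡 (n + 1)) x₀ x₀ with hy₀
  set B := connOf (chartMetric g x₀) with hB
  have hmet := isMetricOn_chartMetric g x₀
  obtain ⟨ρ, hρ, hball⟩ := Metric.nhds_basis_closedBall.mem_iff.1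
    (hmet.isOpen.mem_nhds (mem_extChartAt_target x₀) :
      (extChartAt (𝓡 (n + 1)) x₀).target ∈ 𝓝 y₀)
  let χ : ContDiffBump y₀ := ⟨ρ / 2, ρ, by linarith, by linarith⟩
  -- The superposition argument needs a field smooth on the whole space, so the Christoffel symbols
  -- are cut off. Near the center χ = 1 and nothing changes.
  let Bc : Coord n → Coord n →L[ℝ] Coord n →L[ℝ] Coord n := fun y => χ y • B y
  have hBc : ContDiff ℝ ∞ Bc := by
    exact contDiff_bump_smul χ fun y hy => hmet.contDiffAt_connOf (hball hy)
  set f := geodesicField Bc with hf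
  have hfc : ContDiff ℝ ∞ f :=
    contDiff_iff_contDiffAt.2 fun z => contDiffAt_geodesicField hBc.contDiffAt
  have hf0 : f (y₀, 0) = 0 := by simp [hf, geodesicField]
  -- The acceleration is quadratic in the velocity, so it does not contribute to the linearization
  -- at velocity zero, whose square is therefore zero.
  have hfd : ∀ v, fderiv ℝ f (y₀, 0) v = (v.2, 0) := by
    intro v
    have h1 : DifferentiableAt ℝ (fun z : Coord n × Coord n => Bc z.1 z.2 z.2) (y₀, 0) :=
      (contDiffAt_bilin_comp (Φ := Prod.fst) hBc.contDiffAt contDiffAt_fst contDiffAt_snd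
        contDiffAt_snd).differentiableAt (by simp)
    have h2 := hasFDerivAt_bilin_comp (A := Bc) (Φ := Prod.fst) (X := Prod.snd) (Y := Prod.snd)
      (q := (y₀, (0 : Coord n))) (hBc.differentiable (by simp) _) differentiableAt_fst
      differentiableAt_snd differentiableAt_snd v
    have h3 : fderiv ℝ f (y₀, 0) = (ContinuousLinearMap.snd ℝ (Coord n) (Coord n)).prod
        (-fderiv ℝ (fun z : Coord n × Coord n => Bc z.1 z.2 z.2) (y₀, 0)) :=
      (hasFDerivAt_snd.prodMk h1.hasFDerivAt.neg).fderiv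
    rw [h3, ContinuousLinearMap.prod_apply, neg_apply, h2]
    simp
  obtain ⟨S, hS1, hS2, hS3⟩ := exists_smooth_flow_of_nilpotent hfc hf0
    (fun v => by rw [hfd, hfd]; rfl)
  refine ⟨S, ?_⟩
  -- Continuity of S in the supremum norm keeps the whole curve in the ball of radius ρ/2 on which χ
  -- = 1.
  have hcont : ∀ᶠ z in 𝓝 (y₀, (0 : Coord n)), dist (S z) (S (y₀, 0)) < ρ / 2 :=
    Metric.continuousAt_iff'.1 hS1.self_of_nhds.continuousAt (ρ / 2) (by linarith)
  filter_upwards [hS1, hS3, hcont] with z h1 h2 h3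
  refine ⟨h1, h2.1, fun t ht => ?_⟩
  have h4 : dist (extendCurve (S z) t).1 y₀ < ρ / 2 := by
    have h5 : dist (extendCurve (S z) t) (y₀, 0) < ρ / 2 := by
      refine lt_of_le_of_lt ?_ h3
      rw [hS2]
      exact ContinuousMap.dist_apply_le_dist (f := S z) (g := ContinuousMap.const _ (y₀, 0)) _
    exact lt_of_le_of_lt (le_max_left _ _) h5
  have hχ : χ (extendCurve (S z) t).1 = 1 := χ.one_of_mem_closedBall (by simpa [χ] using h4.le)
  refine ⟨hball (Metric.mem_closedBall.2 (by linarith)), ?_⟩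
  have h6 := h2.2 t ht
  have h7 : f (extendCurve (S z) t) = geodesicField B (extendCurve (S z) t) := by
    simp [hf, geodesicField, Bc, hχ]
  rwa [h7] at h6

/-! ### The parallel frame and local existence of Fermi coordinates. -/

section Frame

variable {g : Metric n M} {γ : ℝ → M} {e : Fin (n + 1) → ∀ t, TangentSpace (𝓡 (n + 1)) (γ t)}

lemma isOpen_preimage_chart (hγ : IsGeodesicOn g γ univ) (x₀ : M) :
    IsOpen (γ ⁻¹' (extChartAt (𝓡 (n + 1)) x₀).source) :=
  (isOpen_extChartAt_source x₀).preimage (contMDiffOn_univ.1 hγ.1).continuous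

lemma hasDerivAt_base (hγ : IsGeodesicOn g γ univ) (he : IsParallelFrame g γ e) {x₀ : M} {t : ℝ}
    (ht : γ t ∈ (extChartAt (𝓡 (n + 1)) x₀).source) :
    HasDerivAt (fun τ => extChartAt (𝓡 (n + 1)) x₀ (γ τ)) (chartComp x₀ (e 0 t)) t := by
  rw [he.first]
  exact hasDerivAt_chart_comp ((contMDiffOn_univ.1 hγ.1).mdifferentiable (by simp) t) ht

lemma hasDerivAt_frame (he : IsParallelFrame g γ e) {x₀ : M} {t : ℝ}
    (ht : γ t ∈ (extChartAt (𝓡 (n + 1)) x₀).source) (i : Fin (n + 1)) :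
    HasDerivAt (fun τ => chartComp x₀ (e i τ))
      (-connOf (chartMetric g x₀) (extChartAt (𝓡 (n + 1)) x₀ (γ t)) (chartComp x₀ (e 0 t))
        (chartComp x₀ (e i t))) t := by
  rw [he.first]
  exact (isParallelOn_iff g).1 (he.parallel i) t (mem_univ t) x₀ ht

/-- Parallelism only asserts a first derivative of the frame. Position, velocity and frame vector
together solve an autonomous smooth equation, which yields smoothness. -/
lemma contDiffOn_base_frame (hγ : IsGeodesicOn g γ univ) (he : IsParallelFrame g γ e) (x₀ : M)
    (i : Fin (n + 1)) :
    ContDiffOn ℝ ∞ (fun τ => (extChartAt (𝓡 (n + 1)) x₀ (γ τ), chartComp x₀ (e 0 τ),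
      chartComp x₀ (e i τ))) (γ ⁻¹' (extChartAt (𝓡 (n + 1)) x₀).source) := by
  have hmet := isMetricOn_chartMetric g x₀
  refine contDiffOn_of_hasDerivAt (isOpen_preimage_chart hγ x₀)
    (F := fun p => (p.2.2.1, -connOf (chartMetric g x₀) p.2.1 p.2.2.1 p.2.2.1,
      -connOf (chartMetric g x₀) p.2.1 p.2.2.1 p.2.2.2)) (fun t ht => ?_) (fun t ht => ?_)
  · have hB := hmet.contDiffAt_connOf (mem_target_of_source ht)
    have c1 : ContDiff ℝ ∞ (fun p : ℝ × Coord n × Coord n × Coord n => p.2.1) :=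
      contDiff_fst.comp contDiff_snd
    have c2 : ContDiff ℝ ∞ (fun p : ℝ × Coord n × Coord n × Coord n => p.2.2.1) :=
      contDiff_fst.comp (contDiff_snd.comp contDiff_snd)
    have c3 : ContDiff ℝ ∞ (fun p : ℝ × Coord n × Coord n × Coord n => p.2.2.2) :=
      contDiff_snd.comp (contDiff_snd.comp contDiff_snd)
    exact c2.contDiffAt.prodMk
      ((contDiffAt_bilin_comp (Φ := fun p : ℝ × Coord n × Coord n × Coord n => p.2.1) hB
        c1.contDiffAt c2.contDiffAt c2.contDiffAt).neg.prodMk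
      (contDiffAt_bilin_comp (Φ := fun p : ℝ × Coord n × Coord n × Coord n => p.2.1) hB
        c1.contDiffAt c2.contDiffAt c3.contDiffAt).neg)
  · exact (hasDerivAt_base hγ he ht).prodMk
      ((hasDerivAt_frame he ht 0).prodMk (hasDerivAt_frame he ht i))

lemma contDiffAt_base (hγ : IsGeodesicOn g γ univ) (he : IsParallelFrame g γ e) {x₀ : M} {t : ℝ}
    (ht : γ t ∈ (extChartAt (𝓡 (n + 1)) x₀).source) :
    ContDiffAt ℝ ∞ (fun τ => extChartAt (𝓡 (n + 1)) x₀ (γ τ)) t :=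
  ((contDiffOn_base_frame hγ he x₀ 0).contDiffAt
    ((isOpen_preimage_chart hγ x₀).mem_nhds ht)).fst

lemma contDiffAt_frame (hγ : IsGeodesicOn g γ univ) (he : IsParallelFrame g γ e) {x₀ : M} {t : ℝ}
    (ht : γ t ∈ (extChartAt (𝓡 (n + 1)) x₀).source) (i : Fin (n + 1)) :
    ContDiffAt ℝ ∞ (fun τ => chartComp x₀ (e i τ)) t :=
  (((contDiffOn_base_frame hγ he x₀ i).contDiffAt
    ((isOpen_preimage_chart hγ x₀).mem_nhds ht)).snd).snd

/-- The parallel frame is orthonormal at all times. -/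
lemma frame_orthonormal (hγ : IsGeodesicOn g γ univ) (he : IsParallelFrame g γ e) (t : ℝ)
    (i j : Fin (n + 1)) : g.inner (γ t) (e i t) (e j t) = if i = j then 1 else 0 := by
  rw [← he.orthonormal i j]
  have hd : ∀ t, HasDerivAt (fun τ => g.inner (γ τ) (e i τ) (e j τ)) 0 t := by
    intro t
    set x₀ := γ t with hx₀
    have ht : γ t ∈ (extChartAt (𝓡 (n + 1)) x₀).source := mem_extChartAt_source _
    have hL := isLeviCivitaOn_chart g x₀
    have h1 : (fun τ => g.inner (γ τ) (e i τ) (e j τ)) =ᶠ[𝓝 t] fun τ =>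
        formOf (chartMetric g x₀) (extChartAt (𝓡 (n + 1)) x₀ (γ τ)) (chartComp x₀ (e i τ))
          (chartComp x₀ (e j τ)) := by
      filter_upwards [(isOpen_preimage_chart hγ x₀).mem_nhds ht] with τ hτ
      exact inner_eq_formOf g hτ _ _
    have hmt := mem_target_of_source ht
    have h2 : HasDerivAt (fun τ => formOf (chartMetric g x₀) (extChartAt (𝓡 (n + 1)) x₀ (γ τ)))
        (fderiv ℝ (formOf (chartMetric g x₀)) (extChartAt (𝓡 (n + 1)) x₀ (γ t))
          (chartComp x₀ (e 0 t))) t :=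
      HasFDerivAt.comp_hasDerivAt (l := formOf (chartMetric g x₀)) t
        ((hL.metric_contDiffAt _ hmt).differentiableAt (by simp)).hasFDerivAt
        (hasDerivAt_base hγ he ht)
    have h3 := (h2.clm_apply (hasDerivAt_frame he ht i)).clm_apply (hasDerivAt_frame he ht j)
    refine (h3.congr_deriv ?_).congr_of_eventuallyEq h1
    simp only [add_apply, map_neg, neg_apply]
    rw [hL.compat _ hmt]
    ring
  exact is_const_of_deriv_eq_zero (fun t => (hd t).differentiableAt) (fun t => (hd t).deriv) t 0

lemma frame_form (hγ : IsGeodesicOn g γ univ) (he : IsParallelFrame g γ e) {x₀ : M} {t : ℝ}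
    (ht : γ t ∈ (extChartAt (𝓡 (n + 1)) x₀).source) (i j : Fin (n + 1)) :
    formOf (chartMetric g x₀) (extChartAt (𝓡 (n + 1)) x₀ (γ t)) (chartComp x₀ (e i t))
      (chartComp x₀ (e j t)) = if i = j then 1 else 0 := by
  rw [← inner_eq_formOf g ht, frame_orthonormal hγ he]

lemma contDiffAt_base_coord (hγ : IsGeodesicOn g γ univ) (he : IsParallelFrame g γ e) {x₀ : M}
    {ξ : Coord n} (hξ : γ (ξ 0) ∈ (extChartAt (𝓡 (n + 1)) x₀).source) :
    ContDiffAt ℝ ∞ (fun η : Coord n => extChartAt (𝓡 (n + 1)) x₀ (γ (η 0))) ξ :=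
  ContDiffAt.comp ξ (g := fun τ => extChartAt (𝓡 (n + 1)) x₀ (γ τ)) (f := fun η : Coord n => η 0)
    (contDiffAt_base hγ he hξ) (contDiff_coord 0).contDiffAt

lemma contDiffAt_frame_coord (hγ : IsGeodesicOn g γ univ) (he : IsParallelFrame g γ e) {x₀ : M}
    {ξ : Coord n} (hξ : γ (ξ 0) ∈ (extChartAt (𝓡 (n + 1)) x₀).source) (i : Fin (n + 1)) :
    ContDiffAt ℝ ∞ (fun η : Coord n => chartComp x₀ (e i (η 0))) ξ :=
  ContDiffAt.comp ξ (g := fun τ => chartComp x₀ (e i τ)) (f := fun η : Coord n => η 0)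
    (contDiffAt_frame hγ he hξ i) (contDiff_coord 0).contDiffAt

lemma contDiffAt_normalVec (hγ : IsGeodesicOn g γ univ) (he : IsParallelFrame g γ e) {x₀ : M}
    {ξ : Coord n} (hξ : γ (ξ 0) ∈ (extChartAt (𝓡 (n + 1)) x₀).source) :
    ContDiffAt ℝ ∞ (normalVec e x₀) ξ :=
  ContDiffAt.sum fun m _ => (contDiff_coord m.succ).contDiffAt.smul
    (contDiffAt_frame_coord hγ he hξ m.succ)

lemma fermiMap_radial (r : ℝ) (ξ : Coord n) :
    fermiMap g γ e (radial r ξ) =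
      geodesicExp g (γ (ξ 0)) (r • ∑ m : Fin n, ξ m.succ • e m.succ (ξ 0)) := by
  have h0 := radial_zero_coord r ξ
  -- The type of the frame vectors depends on the base time, so the time is generalized before it is
  -- replaced.
  have : ∀ s, s = ξ 0 → geodesicExp g (γ s) (∑ m : Fin n, radial r ξ m.succ • e m.succ s) =
      geodesicExp g (γ (ξ 0)) (r • ∑ m : Fin n, ξ m.succ • e m.succ (ξ 0)) := by
    rintro s rfl
    congr 1
    simp only [radial_succ_coord, Finset.smul_sum, smul_smul]
  exact this _ h0

/-- Local description of the normal exponential map by geodesics in a chart. -/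
theorem exists_fermi_chart [T2Space M] (hγ : IsGeodesicOn g γ univ) (he : IsParallelFrame g γ e)
    (s₀ : ℝ) :
    ∃ ε > 0, ∃ Z : Coord n → ℝ → Coord n × Coord n, ∀ ξ ∈ Metric.ball (axis n s₀) ε,
      γ (ξ 0) ∈ (extChartAt (𝓡 (n + 1)) (γ s₀)).source ∧
      ContMDiffAt 𝓘(ℝ, Coord n) (𝓡 (n + 1)) ∞ (fermiMap g γ e) ξ ∧
      fermiMap g γ e ξ ∈ (extChartAt (𝓡 (n + 1)) (γ s₀)).source ∧
      IsChartGeodesicOn g (γ s₀) (Z ξ) (Ioo (-1) 2) ∧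
      Z ξ 0 = (extChartAt (𝓡 (n + 1)) (γ s₀) (γ (ξ 0)), normalVec e (γ s₀) ξ) ∧
      ∀ r ∈ Ioo (-1 : ℝ) 2, fermiMap g γ e (radial r ξ) =
        (extChartAt (𝓡 (n + 1)) (γ s₀)).symm (Z ξ r).1 := by
  set x₀ := γ s₀ with hx₀
  obtain ⟨S, hS⟩ := exists_chart_geodesic_flow g x₀
  set z : Coord n → Coord n × Coord n := fun ξ =>
    (extChartAt (𝓡 (n + 1)) x₀ (γ (ξ 0)), normalVec e x₀ ξ) with hz
  have hsrc : ∀ᶠ ξ in 𝓝 (axis n s₀), γ (ξ 0) ∈ (extChartAt (𝓡 (n + 1)) x₀).source := by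
    have h1 : ContinuousAt (fun ξ : Coord n => ξ 0) (axis n s₀) :=
      (contDiff_coord 0).continuous.continuousAt
    refine h1.eventually_mem ((isOpen_preimage_chart hγ x₀).mem_nhds ?_)
    simp [hx₀]
  have hzc : ∀ᶠ ξ in 𝓝 (axis n s₀), ContDiffAt ℝ ∞ z ξ := by
    filter_upwards [hsrc] with ξ hξ
    exact (contDiffAt_base_coord hγ he hξ).prodMk (contDiffAt_normalVec hγ he hξ)
  have hz0 : z (axis n s₀) = (extChartAt (𝓡 (n + 1)) x₀ x₀, 0) := by
    simp [hz, normalVec, hx₀]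
  have hSz := (hzc.self_of_nhds.continuousAt).eventually (hz0 ▸ hS)
  have key : ∀ᶠ ξ in 𝓝 (axis n s₀), ∀ r ∈ Ioo (-1 : ℝ) 2, fermiMap g γ e (radial r ξ) =
        (extChartAt (𝓡 (n + 1)) x₀).symm (extendCurve (S (z ξ)) r).1 := by
    filter_upwards [hsrc, hSz] with ξ h1 h2 r hr
    rw [fermiMap_radial]
    refine geodesicExp_smul_eq_of_chart h2.2.2 h1 ?_ hr
    rw [h2.2.1, chartComp_normal]
  have hall : ∀ᶠ ξ in 𝓝 (axis n s₀),
      γ (ξ 0) ∈ (extChartAt (𝓡 (n + 1)) x₀).source ∧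
      ContMDiffAt 𝓘(ℝ, Coord n) (𝓡 (n + 1)) ∞ (fermiMap g γ e) ξ ∧
      fermiMap g γ e ξ ∈ (extChartAt (𝓡 (n + 1)) x₀).source ∧
      IsChartGeodesicOn g x₀ (extendCurve (S (z ξ))) (Ioo (-1) 2) ∧
      extendCurve (S (z ξ)) 0 = (extChartAt (𝓡 (n + 1)) x₀ (γ (ξ 0)), normalVec e x₀ ξ) ∧
      ∀ r ∈ Ioo (-1 : ℝ) 2, fermiMap g γ e (radial r ξ) =
        (extChartAt (𝓡 (n + 1)) x₀).symm (extendCurve (S (z ξ)) r).1 := by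
    filter_upwards [hsrc, hzc, hSz, key.eventually_nhds] with ξ h1 h2 h3 h4
    have h1mem : (1 : ℝ) ∈ Ioo (-1 : ℝ) 2 := by norm_num
    have htar := (h3.2.2 1 h1mem).1
    refine ⟨h1, ?_, ?_, h3.2.2, h3.2.1, h4.self_of_nhds⟩
    -- Evaluation at time 1 is linear and continuous on curves, so it keeps the smooth dependence on
    -- η.
    · have h5 : ContDiffAt ℝ ∞ (fun η => (extendCurve (S (z η)) 1).1) ξ := by
        have h6 : ContDiffAt ℝ ∞ (fun η => S (z η)) ξ := h3.1.comp ξ h2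
        have h7 : ContDiffAt ℝ ∞ (fun η => S (z η) ⟨1, by norm_num⟩) ξ :=
          ContDiffAt.comp ξ (g := fun α : C(TimeIcc, Coord n × Coord n) => α ⟨1, by norm_num⟩)
            (ContinuousMap.evalCLM ℝ (M := Coord n × Coord n)
              (⟨1, by norm_num⟩ : TimeIcc)).contDiff.contDiffAt h6
        have h8 : (fun η => (extendCurve (S (z η)) 1).1) =
            fun η => (S (z η) ⟨1, by norm_num⟩).1 := by
          funext η
          rw [← extendCurve_coe (S (z η)) ⟨1, by norm_num⟩]
        rw [h8]
        exact h7.fst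
      have h9 : ContMDiffAt 𝓘(ℝ, Coord n) (𝓡 (n + 1)) ∞
          (fun η => (extChartAt (𝓡 (n + 1)) x₀).symm (extendCurve (S (z η)) 1).1) ξ :=
        ContMDiffAt.comp ξ (g := (extChartAt (𝓡 (n + 1)) x₀).symm)
          (contMDiffAt_chart_symm htar) h5.contMDiffAt
      refine h9.congr_of_eventuallyEq ?_
      filter_upwards [h4] with η hη
      rw [← hη 1 h1mem, radial_one]
    · have h10 := h4.self_of_nhds 1 h1mem
      rw [radial_one] at h10
      rw [h10]
      exact (extChartAt (𝓡 (n + 1)) x₀).map_target htar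
  obtain ⟨ε, hε, h⟩ := Metric.eventually_nhds_iff_ball.1 hall
  exact ⟨ε, hε, fun ξ => extendCurve (S (z ξ)), h⟩

end Frame

end FermiChart

/-! ### Symmetries of the metric in Fermi coordinates. -/

section FermiMetric

open Topology Set IsLeviCivitaOn

variable {n : ℕ}

lemma dist_axis_sq (ξ : Coord n) (s : ℝ) :
    dist ξ (axis n s) ^ 2 = (ξ 0 - s) ^ 2 + ∑ m : Fin n, ξ m.succ ^ 2 := by
  rw [EuclideanSpace.dist_eq, Real.sq_sqrt (Finset.sum_nonneg fun _ _ => sq_nonneg _),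
    Fin.sum_univ_succ]
  simp [Real.dist_eq, sq_abs]

/-- Needed both for times t in [0, 1] along the normal geodesics and for the reflection t = -1. -/
lemma radial_mem_ball {s ε t : ℝ} (ht : t ^ 2 ≤ 1) {ξ : Coord n}
    (hξ : ξ ∈ Metric.ball (axis n s) ε) : radial t ξ ∈ Metric.ball (axis n s) ε := by
  rw [Metric.mem_ball] at hξ ⊢
  refine lt_of_le_of_lt ?_ hξ
  refine (sq_le_sq₀ dist_nonneg dist_nonneg).1 ?_
  rw [dist_axis_sq, dist_axis_sq]
  simp only [radial_zero_coord, radial_succ_coord]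
  refine add_le_add le_rfl (Finset.sum_le_sum fun m _ => ?_)
  nlinarith [sq_nonneg (ξ m.succ)]

/-- The derivative in the second variable only. -/
lemma fderiv_snd_slice {F H : Type*} [NormedAddCommGroup F] [NormedSpace ℝ F]
    [NormedAddCommGroup H] [NormedSpace ℝ H] {f : ℝ × F → H} {t : ℝ} {ξ : F}
    (hf : DifferentiableAt ℝ f (t, ξ)) (a : F) :
    fderiv ℝ f (t, ξ) (0, a) = fderiv ℝ (fun η => f (t, η)) ξ a := by
  have h2 : HasFDerivAt (fun η => f (t, η)) _ ξ :=
    HasFDerivAt.comp ξ (g := f) hf.hasFDerivAt (hasFDerivAt_prodMk_right t ξ)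
  rw [h2.fderiv]
  simp

variable {M : Type*} [TopologicalSpace M] [ChartedSpace (Coord n) M]
  [IsManifold (𝓡 (n + 1)) ∞ M]

/-- The normal exponential map in the chart around `x₀`. -/
def fermiChart (g : Metric n M) (γ : ℝ → M) (e : Fin (n + 1) → ∀ t, TangentSpace (𝓡 (n + 1)) (γ t))
    (x₀ : M) (ξ : Coord n) : Coord n := extChartAt (𝓡 (n + 1)) x₀ (fermiMap g γ e ξ)

/-- The geodesics normal to `γ`, in the chart around `x₀`. -/
def normalFamily (g : Metric n M) (γ : ℝ → M)
    (e : Fin (n + 1) → ∀ t, TangentSpace (𝓡 (n + 1)) (γ t)) (x₀ : M) (p : ℝ × Coord n) : Coord n :=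
  fermiChart g γ e x₀ (radial p.1 p.2)

/-- On the ball of radius `ε` around `(s₀, 0)` the normal exponential map stays in the chart
around `γ s₀`, where `Z ξ` is the normal geodesic with initial velocity given by `ξ`. -/
structure IsFermiBall (g : Metric n M) (γ : ℝ → M)
    (e : Fin (n + 1) → ∀ t, TangentSpace (𝓡 (n + 1)) (γ t)) (s₀ ε : ℝ)
    (Z : Coord n → ℝ → Coord n × Coord n) : Prop where
  pos : 0 < ε
  isGeodesicOn : IsGeodesicOn g γ univ
  isParallelFrame : IsParallelFrame g γ e
  base_mem : ∀ ξ ∈ Metric.ball (axis n s₀) ε, γ (ξ 0) ∈ (extChartAt (𝓡 (n + 1)) (γ s₀)).source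
  contMDiffAt : ∀ ξ ∈ Metric.ball (axis n s₀) ε,
    ContMDiffAt 𝓘(ℝ, Coord n) (𝓡 (n + 1)) ∞ (fermiMap g γ e) ξ
  mem_source : ∀ ξ ∈ Metric.ball (axis n s₀) ε,
    fermiMap g γ e ξ ∈ (extChartAt (𝓡 (n + 1)) (γ s₀)).source
  geodesic : ∀ ξ ∈ Metric.ball (axis n s₀) ε, IsChartGeodesicOn g (γ s₀) (Z ξ) (Ioo (-1) 2)
  init : ∀ ξ ∈ Metric.ball (axis n s₀) ε,
    Z ξ 0 = (extChartAt (𝓡 (n + 1)) (γ s₀) (γ (ξ 0)), normalVec e (γ s₀) ξ)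
  eq_symm : ∀ ξ ∈ Metric.ball (axis n s₀) ε, ∀ r ∈ Ioo (-1 : ℝ) 2, fermiMap g γ e (radial r ξ) =
    (extChartAt (𝓡 (n + 1)) (γ s₀)).symm (Z ξ r).1

lemma exists_isFermiBall [T2Space M] {g : Metric n M} {γ : ℝ → M}
    {e : Fin (n + 1) → ∀ t, TangentSpace (𝓡 (n + 1)) (γ t)}
    (hγ : IsGeodesicOn g γ univ) (he : IsParallelFrame g γ e) (s₀ : ℝ) :
    ∃ ε Z, IsFermiBall g γ e s₀ ε Z := by
  obtain ⟨ε, hε, Z, h⟩ := exists_fermi_chart hγ he s₀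
  exact ⟨ε, Z, hε, hγ, he, fun ξ hξ => (h ξ hξ).1, fun ξ hξ => (h ξ hξ).2.1,
    fun ξ hξ => (h ξ hξ).2.2.1, fun ξ hξ => (h ξ hξ).2.2.2.1, fun ξ hξ => (h ξ hξ).2.2.2.2.1,
    fun ξ hξ => (h ξ hξ).2.2.2.2.2⟩

namespace IsFermiBall

variable {g : Metric n M} {γ : ℝ → M} {e : Fin (n + 1) → ∀ t, TangentSpace (𝓡 (n + 1)) (γ t)}
  {s₀ ε : ℝ} {Z : Coord n → ℝ → Coord n × Coord n}

lemma contDiffAt_fermiChart (h : IsFermiBall g γ e s₀ ε Z) {ξ : Coord n}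
    (hξ : ξ ∈ Metric.ball (axis n s₀) ε) : ContDiffAt ℝ ∞ (fermiChart g γ e (γ s₀)) ξ :=
  contDiffAt_chart_comp (h.contMDiffAt ξ hξ) (h.mem_source ξ hξ)

lemma contDiffAt_normalFamily (h : IsFermiBall g γ e s₀ ε Z) {p : ℝ × Coord n}
    (hp : radial p.1 p.2 ∈ Metric.ball (axis n s₀) ε) :
    ContDiffAt ℝ ∞ (normalFamily g γ e (γ s₀)) p :=
  ContDiffAt.comp p (g := fermiChart g γ e (γ s₀)) (f := fun p : ℝ × Coord n => radial p.1 p.2)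
    (h.contDiffAt_fermiChart hp) contDiff_radial.contDiffAt

lemma normalFamily_eq (h : IsFermiBall g γ e s₀ ε Z) {ξ : Coord n}
    (hξ : ξ ∈ Metric.ball (axis n s₀) ε) {t : ℝ} (ht : t ∈ Ioo (-1 : ℝ) 2) :
    normalFamily g γ e (γ s₀) (t, ξ) = (Z ξ t).1 := by
  rw [normalFamily, fermiChart, h.eq_symm ξ hξ t ht]
  exact (extChartAt (𝓡 (n + 1)) (γ s₀)).right_inv (h.geodesic ξ hξ t ht).1

/-- The set on which the family of normal geodesics is controlled. -/
def domain (n : ℕ) (s₀ ε : ℝ) : Set (ℝ × Coord n) :=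
  {p | p.1 ∈ Ioo (-1 : ℝ) 2 ∧ p.2 ∈ Metric.ball (axis n s₀) ε ∧
    radial p.1 p.2 ∈ Metric.ball (axis n s₀) ε}

lemma isOpen_domain : IsOpen (domain n s₀ ε) :=
  (isOpen_Ioo.preimage continuous_fst).inter ((Metric.isOpen_ball.preimage continuous_snd).inter
    (Metric.isOpen_ball.preimage contDiff_radial.continuous))

lemma mem_domain {ξ : Coord n} (hξ : ξ ∈ Metric.ball (axis n s₀) ε) {t : ℝ}
    (ht : t ∈ Icc (0 : ℝ) 1) : (t, ξ) ∈ domain n s₀ ε :=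
  ⟨⟨by linarith [ht.1], by linarith [ht.2]⟩, hξ, radial_mem_ball (by nlinarith [ht.1, ht.2]) hξ⟩

lemma tvel_eq (h : IsFermiBall g γ e s₀ ε Z) {p : ℝ × Coord n} (hp : p ∈ domain n s₀ ε) :
    tvel (normalFamily g γ e (γ s₀)) p = (Z p.2 p.1).2 := by
  obtain ⟨t, ξ⟩ := p
  have h1 := hasDerivAt_slice (f := normalFamily g γ e (γ s₀)) (t := t) (ξ := ξ)
    ((h.contDiffAt_normalFamily hp.2.2).differentiableAt (by simp))
  have h2 := (h.geodesic ξ hp.2.1).hasDerivAt_fst hp.1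
  refine h1.unique (h2.congr_of_eventuallyEq ?_)
  filter_upwards [isOpen_Ioo.mem_nhds hp.1] with τ hτ
  exact h.normalFamily_eq hp.2.1 hτ

lemma cov_tvel_eq_zero (h : IsFermiBall g γ e s₀ ε Z) {p : ℝ × Coord n}
    (hp : p ∈ domain n s₀ ε) :
    cov (connOf (chartMetric g (γ s₀))) (normalFamily g γ e (γ s₀)) (1, 0)
      (tvel (normalFamily g γ e (γ s₀))) p = 0 := by
  obtain ⟨t, ξ⟩ := p
  have h0 := h.contDiffAt_normalFamily hp.2.2
  have h1 := hasDerivAt_slice (f := tvel (normalFamily g γ e (γ s₀))) (t := t) (ξ := ξ)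
    ((contDiffAt_fderiv_apply h0 _).differentiableAt (by simp))
  have h2 := (h.geodesic ξ hp.2.1).hasDerivAt_snd hp.1
  have hc : ContinuousAt (fun τ : ℝ => (τ, ξ)) t := by fun_prop
  have h3 : (fun τ => tvel (normalFamily g γ e (γ s₀)) (τ, ξ)) =ᶠ[𝓝 t] fun τ => (Z ξ τ).2 := by
    filter_upwards [hc.eventually_mem (isOpen_domain.mem_nhds hp)] with τ hτ
    exact h.tvel_eq hτ
  have h4 := h1.unique (h2.congr_of_eventuallyEq h3)
  have h5 : fderiv ℝ (normalFamily g γ e (γ s₀)) (t, ξ) (1, 0) = (Z ξ t).2 := h.tvel_eq hp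
  rw [cov, h4, h5, h.tvel_eq hp, h.normalFamily_eq hp.2.1 hp.1]
  exact neg_add_cancel _

lemma isGeodesicFamilyAt (h : IsFermiBall g γ e s₀ ε Z) {ξ : Coord n}
    (hξ : ξ ∈ Metric.ball (axis n s₀) ε) :
    IsGeodesicFamilyAt (connOf (chartMetric g (γ s₀))) (extChartAt (𝓡 (n + 1)) (γ s₀)).target
      (normalFamily g γ e (γ s₀)) ξ := by
  intro t ht
  have hp := mem_domain hξ ht
  refine ⟨?_, ?_, ?_⟩
  · rw [h.normalFamily_eq hξ hp.1]
    exact (h.geodesic ξ hξ t hp.1).1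
  · filter_upwards [isOpen_domain.mem_nhds hp] with p hp using h.contDiffAt_normalFamily hp.2.2
  · filter_upwards [isOpen_domain.mem_nhds hp] with p hp using h.cov_tvel_eq_zero hp

lemma normalFamily_zero (h : IsFermiBall g γ e s₀ ε Z) {ξ : Coord n}
    (hξ : ξ ∈ Metric.ball (axis n s₀) ε) :
    normalFamily g γ e (γ s₀) (0, ξ) = extChartAt (𝓡 (n + 1)) (γ s₀) (γ (ξ 0)) := by
  rw [h.normalFamily_eq hξ (by norm_num), h.init ξ hξ]

lemma tvel_zero (h : IsFermiBall g γ e s₀ ε Z) {ξ : Coord n}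
    (hξ : ξ ∈ Metric.ball (axis n s₀) ε) :
    tvel (normalFamily g γ e (γ s₀)) (0, ξ) = normalVec e (γ s₀) ξ := by
  rw [h.tvel_eq (mem_domain hξ (by simp)), h.init ξ hξ]

/-- All geodesics of the family start on γ, so at time 0 only the first coordinate moves the point.
-/
lemma jac_zero (h : IsFermiBall g γ e s₀ ε Z) {ξ : Coord n}
    (hξ : ξ ∈ Metric.ball (axis n s₀) ε) (a : Coord n) :
    jac (normalFamily g γ e (γ s₀)) a (0, ξ) = a 0 • chartComp (γ s₀) (e 0 (ξ 0)) := by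
  rw [jac, fderiv_snd_slice ((h.contDiffAt_normalFamily
    (mem_domain hξ (by simp)).2.2).differentiableAt (by simp))]
  have h1 : (fun η => normalFamily g γ e (γ s₀) (0, η)) =ᶠ[𝓝 ξ]
      fun η => extChartAt (𝓡 (n + 1)) (γ s₀) (γ (η 0)) := by
    filter_upwards [Metric.isOpen_ball.mem_nhds hξ] with η hη using h.normalFamily_zero hη
  have h2 := HasFDerivAt.comp ξ (g := fun τ => extChartAt (𝓡 (n + 1)) (γ s₀) (γ τ))
    (hasDerivAt_base h.isGeodesicOn h.isParallelFrame (h.base_mem ξ hξ)).hasFDerivAt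
    (EuclideanSpace.proj 0 : Coord n →L[ℝ] ℝ).hasFDerivAt
  rw [(h2.congr_of_eventuallyEq h1).fderiv]
  simp

/-- J'(0) is the covariant derivative of the initial velocity Σ ξ^m e_m in direction a. As the frame
is parallel along γ, only the coefficients are differentiated. -/
lemma jac'_zero (h : IsFermiBall g γ e s₀ ε Z) {ξ : Coord n}
    (hξ : ξ ∈ Metric.ball (axis n s₀) ε) (a : Coord n) :
    jac' (connOf (chartMetric g (γ s₀))) (normalFamily g γ e (γ s₀)) a (0, ξ) =
      ∑ m : Fin n, a m.succ • chartComp (γ s₀) (e m.succ (ξ 0)) := by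
  have hdom := mem_domain hξ (t := 0) (by simp)
  have hsm := h.contDiffAt_normalFamily hdom.2.2
  have htar : normalFamily g γ e (γ s₀) (0, ξ) ∈ (extChartAt (𝓡 (n + 1)) (γ s₀)).target :=
    ((h.isGeodesicFamilyAt hξ) 0 (by simp)).1
  have h0 : jac' (connOf (chartMetric g (γ s₀))) (normalFamily g γ e (γ s₀)) a (0, ξ) =
      cov (connOf (chartMetric g (γ s₀))) (normalFamily g γ e (γ s₀)) (0, a)
        (tvel (normalFamily g γ e (γ s₀))) (0, ξ) :=
    (isLeviCivitaOn_chart g (γ s₀)).cov_fderiv_comm htar hsm _ _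
  have h1 : (fun η => tvel (normalFamily g γ e (γ s₀)) (0, η)) =ᶠ[𝓝 ξ] normalVec e (γ s₀) := by
    filter_upwards [Metric.isOpen_ball.mem_nhds hξ] with η hη using h.tvel_zero hη
  have h2 : ∀ m : Fin n, HasFDerivAt (fun η : Coord n => η m.succ • chartComp (γ s₀) (e m.succ (η 0)))
      _ ξ := fun m => HasFDerivAt.smul (EuclideanSpace.proj m.succ : Coord n →L[ℝ] ℝ).hasFDerivAt
        (HasFDerivAt.comp ξ (g := fun τ => chartComp (γ s₀) (e m.succ τ))
          (hasDerivAt_frame h.isParallelFrame (h.base_mem ξ hξ) m.succ).hasFDerivAt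
          (EuclideanSpace.proj 0 : Coord n →L[ℝ] ℝ).hasFDerivAt)
  have h3 := HasFDerivAt.fun_sum (u := Finset.univ) fun m _ => h2 m
  have h4 : fderiv ℝ (normalVec e (γ s₀)) ξ = _ := h3.fderiv
  have h5 : fderiv ℝ (normalFamily g γ e (γ s₀)) (0, ξ) (0, a) = _ := h.jac_zero hξ a
  have h6 : DifferentiableAt ℝ (tvel (normalFamily g γ e (γ s₀))) (0, ξ) :=
    (contDiffAt_fderiv_apply hsm _).differentiableAt (by simp)
  rw [h0, cov, h5, fderiv_snd_slice h6, h1.fderiv_eq, h4, h.tvel_zero hξ, h.normalFamily_zero hξ]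
  simp only [normalVec, sum_apply, map_sum, map_smul]
  rw [← Finset.sum_add_distrib]
  refine Finset.sum_congr rfl fun m _ => ?_
  simp only [smul_apply, add_apply, ContinuousLinearMap.comp_apply,
    ContinuousLinearMap.toSpanSingleton_apply, ContinuousLinearMap.smulRight_apply,
    PiLp.proj_apply, smul_neg]
  abel

lemma jac_one (h : IsFermiBall g γ e s₀ ε Z) {ξ : Coord n}
    (hξ : ξ ∈ Metric.ball (axis n s₀) ε) (a : Coord n) :
    jac (normalFamily g γ e (γ s₀)) a (1, ξ) = fderiv ℝ (fermiChart g γ e (γ s₀)) ξ a := by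
  rw [jac, fderiv_snd_slice ((h.contDiffAt_normalFamily
    (mem_domain hξ (by simp)).2.2).differentiableAt (by simp))]
  simp only [normalFamily, radial_one]

lemma form_frame_sum (h : IsFermiBall g γ e s₀ ε Z) {ξ : Coord n}
    (hξ : ξ ∈ Metric.ball (axis n s₀) ε) (a b : Coord n) :
    formOf (chartMetric g (γ s₀)) (extChartAt (𝓡 (n + 1)) (γ s₀) (γ (ξ 0)))
      (∑ m : Fin n, a m.succ • chartComp (γ s₀) (e m.succ (ξ 0)))
      (∑ m : Fin n, b m.succ • chartComp (γ s₀) (e m.succ (ξ 0))) =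
      ∑ m : Fin n, a m.succ * b m.succ := by
  simp only [map_sum, map_smul, sum_apply, smul_apply,
    frame_form h.isGeodesicOn h.isParallelFrame (h.base_mem ξ hξ), Fin.succ_inj, smul_eq_mul,
    mul_ite, mul_one, mul_zero, Finset.sum_ite_eq', Finset.mem_univ, if_true]
  exact Finset.sum_congr rfl fun m _ => mul_comm _ _

lemma form_first_sum (h : IsFermiBall g γ e s₀ ε Z) {ξ : Coord n}
    (hξ : ξ ∈ Metric.ball (axis n s₀) ε) (c : ℝ) (b : Coord n) :
    formOf (chartMetric g (γ s₀)) (extChartAt (𝓡 (n + 1)) (γ s₀) (γ (ξ 0)))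
      (c • chartComp (γ s₀) (e 0 (ξ 0)))
      (∑ m : Fin n, b m.succ • chartComp (γ s₀) (e m.succ (ξ 0))) = 0 := by
  simp only [map_sum, map_smul, smul_apply,
    frame_form h.isGeodesicOn h.isParallelFrame (h.base_mem ξ hξ), (Fin.succ_ne_zero _).symm,
    if_false, smul_zero, Finset.sum_const_zero]

/-- The pulled back metric does not depend on the first coordinate, and it is even in the others. -/
theorem pullbackMetric_eq (h : IsFermiBall g γ e s₀ ε Z) {κ : ℝ} (hκ : HasConstantCurvature g κ)
    {ξ η : Coord n} (hξ : ξ ∈ Metric.ball (axis n s₀) ε) (hη : η ∈ Metric.ball (axis n s₀) ε)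
    {σ : ℝ} (hσ : σ ^ 2 = 1) (hξη : ∀ m : Fin n, η m.succ = σ * ξ m.succ) :
    pullbackMetric g (fermiMap g γ e) ξ = pullbackMetric g (fermiMap g γ e) η := by
  have hmet := isMetricOn_chartMetric g (γ s₀)
  have hL := isLeviCivitaOn_chart g (γ s₀)
  have hcurv : ∀ y ∈ (extChartAt (𝓡 (n + 1)) (γ s₀)).target, ∀ v w,
      formOf (chartMetric g (γ s₀)) y (curv (connOf (chartMetric g (γ s₀))) y v w w) v =
        κ * (formOf (chartMetric g (γ s₀)) y v v * formOf (chartMetric g (γ s₀)) y w w -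
          formOf (chartMetric g (γ s₀)) y v w ^ 2) := by
    intro y hy v w
    rw [← hmet.curvatureForm_eq hy, hκ _ y hy]
    simp only [formOf_apply]
  ext i j
  rw [pullbackMetric_eq_formOf g ((h.contMDiffAt ξ hξ).mdifferentiableAt (by simp))
      (h.mem_source ξ hξ),
    pullbackMetric_eq_formOf g ((h.contMDiffAt η hη).mdifferentiableAt (by simp))
      (h.mem_source η hη)]
  -- All data are Euclidean products in the frame. J(0) is tangent to γ while J'(0) and the velocity
  -- are normal, which gives p₀ = 0; ξ enters only through the quadratic quantities ρ and θ.
  have key := hL.metric_jac_eq hcurv (h.isGeodesicFamilyAt hξ) (h.isGeodesicFamilyAt hη)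
    (basisVec i) (basisVec j) (ρ := ∑ m : Fin n, ξ m.succ * ξ m.succ)
    (θ := (∑ m : Fin n, (basisVec i : Coord n) m.succ * ξ m.succ) *
      ∑ m : Fin n, (basisVec j : Coord n) m.succ * ξ m.succ)
    (f₀ := (basisVec i : Coord n) 0 * (basisVec j : Coord n) 0) (p₀ := 0)
    (h₀ := ∑ m : Fin n, (basisVec i : Coord n) m.succ * (basisVec j : Coord n) m.succ) ?_
  · rw [h.jac_one hξ, h.jac_one hξ, h.jac_one hη, h.jac_one hη] at key
    simp only [normalFamily, radial_one] at key
    exact key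
  · intro ζ hζ
    have hζb : ζ ∈ Metric.ball (axis n s₀) ε := by rcases hζ with rfl | rfl <;> assumption
    -- Both points are treated at once as τ times the normal part of ξ; then ρ and θ acquire the
    -- factor τ² = 1.
    have hζσ : ∃ τ : ℝ, τ ^ 2 = 1 ∧ ∀ m : Fin n, ζ m.succ = τ * ξ m.succ := by
      rcases hζ with rfl | rfl
      · exact ⟨1, by norm_num, fun m => by ring⟩
      · exact ⟨σ, hσ, hξη⟩
    obtain ⟨τ, hτ, hζξ⟩ := hζσ
    have hsymm := hL.metric_symm _ (mem_target_of_source (h.base_mem ζ hζb))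
    rw [h.normalFamily_zero hζb, h.tvel_zero hζb, h.jac_zero hζb, h.jac_zero hζb,
      h.jac'_zero hζb, h.jac'_zero hζb, normalVec]
    refine ⟨h.form_first_sum hζb _ _, h.form_first_sum hζb _ _, ?_, ?_, ?_, ?_,
      h.form_frame_sum hζb _ _⟩
    · rw [h.form_frame_sum hζb]
      refine Finset.sum_congr rfl fun m _ => ?_
      rw [hζξ]
      linear_combination (ξ m.succ * ξ m.succ) * hτ
    · rw [h.form_frame_sum hζb, h.form_frame_sum hζb]
      have : ∀ a : Coord n, ∑ m : Fin n, a m.succ * ζ m.succ =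
          τ * ∑ m : Fin n, a m.succ * ξ m.succ := fun a => by
        rw [Finset.mul_sum]
        exact Finset.sum_congr rfl fun m _ => by rw [hζξ]; ring
      rw [this, this]
      linear_combination ((∑ m : Fin n, (basisVec i : Coord n) m.succ * ξ m.succ) *
        ∑ m : Fin n, (basisVec j : Coord n) m.succ * ξ m.succ) * hτ
    · rw [map_smul, map_smul, smul_apply,
        frame_form h.isGeodesicOn h.isParallelFrame (h.base_mem ζ hζb)]
      simp [mul_comm]
    · rw [h.form_first_sum hζb, hsymm, h.form_first_sum hζb, add_zero]

lemma axis_mem (h : IsFermiBall g γ e s₀ ε Z) : axis n s₀ ∈ Metric.ball (axis n s₀) ε :=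
  Metric.mem_ball_self h.pos

lemma fermiMap_axis (h : IsFermiBall g γ e s₀ ε Z) {ξ : Coord n}
    (hξ : ξ ∈ Metric.ball (axis n s₀) ε) : fermiMap g γ e (axis n (ξ 0)) = γ (ξ 0) := by
  rw [← radial_zero, h.eq_symm ξ hξ 0 (by norm_num), h.init ξ hξ]
  exact (extChartAt (𝓡 (n + 1)) (γ s₀)).left_inv (h.base_mem ξ hξ)

lemma fderiv_fermiChart_first (h : IsFermiBall g γ e s₀ ε Z) :
    fderiv ℝ (fermiChart g γ e (γ s₀)) (axis n s₀) (basisVec 0) =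
      chartComp (γ s₀) (e 0 s₀) := by
  have h1 : HasDerivAt (axis n) (basisVec 0) s₀ := by
    exact ((hasDerivAt_id s₀).smul_const (basisVec 0 : Coord n)).congr_deriv (one_smul _ _)
  have h2 := HasFDerivAt.comp_hasDerivAt s₀
    ((h.contDiffAt_fermiChart h.axis_mem).differentiableAt (by simp)).hasFDerivAt h1
  have h3 := hasDerivAt_base h.isGeodesicOn h.isParallelFrame (x₀ := γ s₀) (t := s₀)
    (mem_extChartAt_source _)
  refine h2.unique (h3.congr_of_eventuallyEq ?_)
  filter_upwards [h1.continuousAt.eventually_mem (Metric.isOpen_ball.mem_nhds h.axis_mem)] with s hs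
  have := h.fermiMap_axis hs
  rw [axis_zero_coord] at this
  simp [fermiChart, this]

/-- The derivative along the ray is the initial velocity of a normal geodesic. This is known only
inside the ball, so v is first scaled by a small c ≠ 0. -/
lemma fderiv_fermiChart_normal (h : IsFermiBall g γ e s₀ ε Z) {v : Coord n} (hv : v 0 = 0) :
    fderiv ℝ (fermiChart g γ e (γ s₀)) (axis n s₀) v =
      ∑ m : Fin n, v m.succ • chartComp (γ s₀) (e m.succ s₀) := by
  obtain ⟨c, hc, hcv⟩ : ∃ c : ℝ, c ≠ 0 ∧ axis n s₀ + c • v ∈ Metric.ball (axis n s₀) ε := by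
    have h1 : ContinuousAt (fun c : ℝ => axis n s₀ + c • v) 0 := by fun_prop
    have h2 := h1.eventually_mem (s := Metric.ball (axis n s₀) ε)
      (Metric.isOpen_ball.mem_nhds (by simpa using h.pos))
    obtain ⟨c, h3, h4⟩ := ((h2.filter_mono nhdsWithin_le_nhds).and
      (self_mem_nhdsWithin (s := {(0 : ℝ)}ᶜ))).exists
    exact ⟨c, h4, h3⟩
  set ξ := axis n s₀ + c • v with hξ
  have hξ0 : ξ 0 = s₀ := by simp [hξ, hv]
  have hrad : ∀ r, radial r ξ = axis n s₀ + r • (c • v) := by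
    intro r
    rw [radial, hξ0]
    simp [hξ, axis]
  have h1 : HasDerivAt (fun r => radial r ξ) (c • v) 0 := by
    simp only [hrad]
    simpa using ((hasDerivAt_id (0 : ℝ)).smul_const (c • v)).const_add (axis n s₀)
  have h0 : radial 0 ξ = axis n s₀ := by simp [hrad]
  have h2 := HasFDerivAt.comp_hasDerivAt (0 : ℝ) (l := fermiChart g γ e (γ s₀))
    ((h.contDiffAt_fermiChart (by rw [h0]; exact h.axis_mem)).differentiableAt
      (by simp)).hasFDerivAt h1
  have h3 := hasDerivAt_slice (f := normalFamily g γ e (γ s₀)) (t := 0) (ξ := ξ)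
    ((h.contDiffAt_normalFamily (mem_domain hcv (by simp)).2.2).differentiableAt (by simp))
  have h4 := (h2.unique h3).trans (h.tvel_zero hcv)
  rw [h0, map_smul, normalVec, hξ0] at h4
  have h5 : ∑ m : Fin n, ξ m.succ • chartComp (γ s₀) (e m.succ s₀) =
      c • ∑ m : Fin n, v m.succ • chartComp (γ s₀) (e m.succ s₀) := by
    rw [Finset.smul_sum]
    exact Finset.sum_congr rfl fun m _ => by simp [hξ, smul_smul]
  rw [h5] at h4
  exact smul_right_injective _ hc h4

lemma fderiv_fermiChart_axis (h : IsFermiBall g γ e s₀ ε Z) (i : Fin (n + 1)) :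
    fderiv ℝ (fermiChart g γ e (γ s₀)) (axis n s₀) (basisVec i) = chartComp (γ s₀) (e i s₀) := by
  induction i using Fin.cases with
  | zero => exact h.fderiv_fermiChart_first
  | succ m =>
    rw [h.fderiv_fermiChart_normal (by simp [basisVec_apply, (Fin.succ_ne_zero _).symm])]
    simp [basisVec_apply]

lemma pullbackMetric_axis (h : IsFermiBall g γ e s₀ ε Z) :
    pullbackMetric g (fermiMap g γ e) (axis n s₀) = 1 := by
  ext i j
  rw [pullbackMetric_eq_formOf g ((h.contMDiffAt _ h.axis_mem).mdifferentiableAt (by simp))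
      (h.mem_source _ h.axis_mem)]
  have h1 := h.fermiMap_axis h.axis_mem
  rw [axis_zero_coord] at h1
  have h2 := h.fderiv_fermiChart_axis
  unfold fermiChart at h2
  rw [h1, h2, h2, frame_form h.isGeodesicOn h.isParallelFrame (mem_extChartAt_source _),
    Matrix.one_apply]

lemma contDiffAt_pullbackMetric (h : IsFermiBall g γ e s₀ ε Z) {ξ : Coord n}
    (hξ : ξ ∈ Metric.ball (axis n s₀) ε) (i j : Fin (n + 1)) :
    ContDiffAt ℝ ∞ (fun η => pullbackMetric g (fermiMap g γ e) η i j) ξ := by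
  have hsm := h.contDiffAt_fermiChart hξ
  have h1 : (fun η => pullbackMetric g (fermiMap g γ e) η i j) =ᶠ[𝓝 ξ] fun η =>
      formOf (chartMetric g (γ s₀)) (fermiChart g γ e (γ s₀) η)
        (fderiv ℝ (fermiChart g γ e (γ s₀)) η (basisVec i))
        (fderiv ℝ (fermiChart g γ e (γ s₀)) η (basisVec j)) := by
    filter_upwards [Metric.isOpen_ball.mem_nhds hξ] with η hη
    exact pullbackMetric_eq_formOf g ((h.contMDiffAt η hη).mdifferentiableAt (by simp))
      (h.mem_source η hη) i j
  exact (contDiffAt_bilin_comp (Φ := fermiChart g γ e (γ s₀))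
    ((isMetricOn_chartMetric g (γ s₀)).contDiffAt_formOf
    (mem_target_of_source (h.mem_source ξ hξ))) hsm (contDiffAt_fderiv_apply hsm _)
    (contDiffAt_fderiv_apply hsm _)).congr_of_eventuallyEq h1

lemma pairing_pullbackMetric (h : IsFermiBall g γ e s₀ ε Z) {ξ : Coord n}
    (hξ : ξ ∈ Metric.ball (axis n s₀) ε) (v w : Coord n) :
    pairing (pullbackMetric g (fermiMap g γ e)) ξ v w =
      formOf (chartMetric g (γ s₀)) (fermiChart g γ e (γ s₀) ξ)
        (fderiv ℝ (fermiChart g γ e (γ s₀)) ξ v) (fderiv ℝ (fermiChart g γ e (γ s₀)) ξ w) := by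
  rw [← formOf_apply]
  induction v using coord_induction with
  | hadd a b ha hb => simp only [map_add, add_apply, ha, hb]
  | hsmul c a ha => simp only [map_smul, smul_apply, ha]
  | hbasis i =>
    induction w using coord_induction with
    | hadd a b ha hb => simp only [map_add, ha, hb]
    | hsmul c a ha => simp only [map_smul, ha]
    | hbasis j =>
      rw [formOf_basisVec]
      exact pullbackMetric_eq_formOf g ((h.contMDiffAt ξ hξ).mdifferentiableAt (by simp))
        (h.mem_source ξ hξ) i j

/-- Near the geodesic the pulled back metric is a Riemannian metric. -/
lemma exists_isMetricOn (h : IsFermiBall g γ e s₀ ε Z) :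
    ∃ r > 0, r ≤ ε ∧
      IsMetricOn (pullbackMetric g (fermiMap g γ e)) (Metric.ball (axis n s₀) r) := by
  have hL := isLeviCivitaOn_chart g (γ s₀)
  have hdet : ∀ᶠ ξ in 𝓝 (axis n s₀), (pullbackMetric g (fermiMap g γ e) ξ).det ≠ 0 := by
    refine (contDiffAt_det (m := ∞) fun i j =>
      h.contDiffAt_pullbackMetric h.axis_mem i j).continuousAt.eventually_ne ?_
    simp [h.pullbackMetric_axis]
  obtain ⟨r, hr, hball⟩ := Metric.eventually_nhds_iff_ball.1 hdet
  have hsub : Metric.ball (axis n s₀) (min r ε) ⊆ Metric.ball (axis n s₀) ε :=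
    Metric.ball_subset_ball (min_le_right _ _)
  refine ⟨min r ε, lt_min hr h.pos, min_le_right _ _, Metric.isOpen_ball,
    fun ξ hξ => h.contDiffAt_pullbackMetric (hsub hξ), fun ξ _ i j => g.symm _ _ _,
    fun ξ hξ v hv => ?_⟩
  rw [h.pairing_pullbackMetric (hsub hξ)]
  -- A vector killed by the differential of Φ would lie in the kernel of the pulled back matrix,
  -- whose determinant is not zero near the axis.
  refine hL.metric_pos _ (mem_target_of_source (h.mem_source ξ (hsub hξ))) _ fun h0 => ?_
  apply hball ξ (Metric.ball_subset_ball (min_le_left _ _) hξ)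
  refine Matrix.exists_vecMul_eq_zero_iff.1 ⟨v, fun h1 => hv (by ext i; exact congrFun h1 i), ?_⟩
  funext j
  have h2 := h.pairing_pullbackMetric (hsub hξ) v (basisVec j)
  rw [h0, map_zero, zero_apply] at h2
  simpa [pairing, Matrix.vecMul, dotProduct, basisVec_apply, mul_comm] using h2

/-- The pulled back metric is the identity on the axis, so the differential is injective; equal
finite dimensions do the rest. -/
lemma bijective_mfderiv (h : IsFermiBall g γ e s₀ ε Z) :
    Function.Bijective (mfderiv 𝓘(ℝ, Coord n) (𝓡 (n + 1)) (fermiMap g γ e) (axis n s₀)) := by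
  let L : Coord n →L[ℝ] Coord n :=
    mfderiv 𝓘(ℝ, Coord n) (𝓡 (n + 1)) (fermiMap g γ e) (axis n s₀)
  have hinj : Function.Injective L := by
    refine (injective_iff_map_eq_zero L).2 fun v hv => ?_
    have h1 : fderiv ℝ (fermiChart g γ e (γ s₀)) (axis n s₀) v = 0 := by
      refine (chartComp_mfderiv ((h.contMDiffAt _ h.axis_mem).mdifferentiableAt (by simp))
        (h.mem_source _ h.axis_mem) v).symm.trans ?_
      have h2 : mfderiv 𝓘(ℝ, Coord n) (𝓡 (n + 1)) (fermiMap g γ e) (axis n s₀) v = 0 := hv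
      rw [h2]
      exact map_zero _
    ext j
    have h3 := h.pairing_pullbackMetric h.axis_mem v (basisVec j)
    rw [h1, map_zero, zero_apply, pairing, h.pullbackMetric_axis] at h3
    simpa [Matrix.one_apply, basisVec_apply] using h3
  exact ⟨hinj, (LinearMap.injective_iff_surjective (f := L.toLinearMap)).1 hinj⟩

end IsFermiBall

end FermiMetric

/-! ### Functions independent of x¹ with a parity in the normal coordinates. -/

section FermiFunctions

open Topology Set

variable {n : ℕ}

/-- On the ball around `(s₀, 0)`, `f` is smooth, does not depend on the first coordinate, and is
multiplied by `τ` when the signs of the other coordinates are reversed. -/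
structure IsFermiFun (f : Coord n → ℝ) (τ s₀ r : ℝ) : Prop where
  contDiffAt : ∀ ξ ∈ Metric.ball (axis n s₀) r, ContDiffAt ℝ ∞ f ξ
  translate : ∀ ξ ∈ Metric.ball (axis n s₀) r, ∀ η ∈ Metric.ball (axis n s₀) r,
    (∀ m : Fin n, η m.succ = ξ m.succ) → f η = f ξ
  reflect : ∀ ξ ∈ Metric.ball (axis n s₀) r, f (radial (-1) ξ) = τ * f ξ

/-- The reversal of the signs of all coordinates but the first, as a linear map. -/
def reflection (n : ℕ) : Coord n →L[ℝ] Coord n :=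
  (2 : ℝ) • (EuclideanSpace.proj 0 : Coord n →L[ℝ] ℝ).smulRight (basisVec 0) -
    ContinuousLinearMap.id ℝ (Coord n)

lemma reflection_apply (ξ : Coord n) : reflection n ξ = radial (-1) ξ := by
  simp only [reflection, radial, sub_apply, smul_apply, ContinuousLinearMap.smulRight_apply,
    PiLp.proj_apply, ContinuousLinearMap.id_apply]
  module

lemma reflection_basisVec_succ (m : Fin n) :
    reflection n (basisVec m.succ) = -basisVec m.succ := by
  rw [reflection_apply]
  refine coord_ext ?_ fun p => ?_
  · simp [basisVec_apply, (Fin.succ_ne_zero _).symm]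
  · simp only [radial_succ_coord, PiLp.neg_apply, neg_one_mul]

lemma sum_smul_basisVec (v : Coord n) : ∑ i, v i • (basisVec i : Coord n) = v := by
  ext j
  simp [basisVec_apply]

lemma fderiv_eq_sum_pd (f : Coord n → ℝ) (x v : Coord n) :
    fderiv ℝ f x v = ∑ i, v i * pd i f x := by
  conv_lhs => rw [← sum_smul_basisVec v]
  simp [pd]

namespace IsFermiFun

variable {f h : Coord n → ℝ} {τ τ' s₀ r : ℝ}

lemma pd_zero (hf : IsFermiFun f τ s₀ r) {ξ : Coord n} (hξ : ξ ∈ Metric.ball (axis n s₀) r) :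
    pd 0 f ξ = 0 := by
  have h1 : HasDerivAt (fun c : ℝ => ξ + c • (basisVec 0 : Coord n)) (basisVec 0) 0 := by
    simpa using ((hasDerivAt_id (0 : ℝ)).smul_const (basisVec 0 : Coord n)).const_add ξ
  have h2 := HasFDerivAt.comp_hasDerivAt (l := f) (l' := fderiv ℝ f ξ) (0 : ℝ)
    (by simpa using ((hf.contDiffAt ξ hξ).differentiableAt (by simp)).hasFDerivAt) h1
  refine h2.unique ((hasDerivAt_const (0 : ℝ) (f ξ)).congr_of_eventuallyEq ?_)
  filter_upwards [h1.continuousAt.eventually_mem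
    (Metric.isOpen_ball.mem_nhds (by simpa using hξ))] with c hc
  exact hf.translate ξ hξ _ hc fun m => by simp [basisVec_apply]

/-- A normal derivative reverses the parity. The derivative in direction x¹ vanishes, so it may be
assigned the reversed parity too, and no index needs special care later. -/
lemma pd (hf : IsFermiFun f τ s₀ r) (i : Fin (n + 1)) :
    IsFermiFun (pd i f) (-τ) s₀ r where
  contDiffAt ξ hξ := contDiffAt_pd (hf.contDiffAt ξ hξ) i
  translate ξ hξ η hη hξη := by
    have h1 : (fun ζ => f (ζ + (η - ξ))) =ᶠ[𝓝 ξ] f := by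
      have hc : ContinuousAt (fun ζ : Coord n => ζ + (η - ξ)) ξ := by fun_prop
      filter_upwards [Metric.isOpen_ball.mem_nhds hξ, hc.eventually_mem
        (Metric.isOpen_ball.mem_nhds (by simpa using hη))] with ζ h1 h2
      exact hf.translate ζ h1 _ h2 fun m => by simp [hξη]
    have h2 := h1.fderiv_eq (𝕜 := ℝ)
    rw [fderiv_comp_add_right] at h2
    simp only [FermiWaveMap.pd, ← h2, add_sub_cancel]
  reflect ξ hξ := by
    induction i using Fin.cases with
    | zero => rw [hf.pd_zero hξ, hf.pd_zero (radial_mem_ball (by norm_num) hξ), mul_zero]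
    | succ m =>
      have hR := radial_mem_ball (t := -1) (by norm_num) hξ
      have h1 : (fun ζ => f (reflection n ζ)) =ᶠ[𝓝 ξ] fun ζ => τ * f ζ := by
        filter_upwards [Metric.isOpen_ball.mem_nhds hξ] with ζ hζ
        rw [reflection_apply, hf.reflect ζ hζ]
      have h2 : HasFDerivAt (fun ζ => f (reflection n ζ)) _ ξ := HasFDerivAt.comp ξ (g := f)
        ((hf.contDiffAt _ (by rwa [reflection_apply])).differentiableAt (by simp)).hasFDerivAt
        (reflection n).hasFDerivAt
      have h3 := (((hf.contDiffAt ξ hξ).differentiableAt (by simp)).hasFDerivAt.const_mul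
        τ).congr_of_eventuallyEq h1
      have h4 := congrArg (fun L => L (basisVec m.succ)) (h2.unique h3)
      simp only [ContinuousLinearMap.comp_apply, reflection_basisVec_succ, map_neg, smul_apply,
        smul_eq_mul] at h4
      rw [reflection_apply] at h4
      simp only [FermiWaveMap.pd]
      linarith

lemma add (hf : IsFermiFun f τ s₀ r) (hh : IsFermiFun h τ s₀ r) :
    IsFermiFun (fun ξ => f ξ + h ξ) τ s₀ r where
  contDiffAt ξ hξ := (hf.contDiffAt ξ hξ).add (hh.contDiffAt ξ hξ)
  translate ξ hξ η hη H := by simp only [hf.translate ξ hξ η hη H, hh.translate ξ hξ η hη H]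
  reflect ξ hξ := by simp only [hf.reflect ξ hξ, hh.reflect ξ hξ]; ring

lemma const_mul (hf : IsFermiFun f τ s₀ r) (c : ℝ) : IsFermiFun (fun ξ => c * f ξ) τ s₀ r where
  contDiffAt ξ hξ := contDiffAt_const.mul (hf.contDiffAt ξ hξ)
  translate ξ hξ η hη H := by simp only [hf.translate ξ hξ η hη H]
  reflect ξ hξ := by simp only [hf.reflect ξ hξ]; ring

lemma sub (hf : IsFermiFun f τ s₀ r) (hh : IsFermiFun h τ s₀ r) :
    IsFermiFun (fun ξ => f ξ - h ξ) τ s₀ r where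
  contDiffAt ξ hξ := (hf.contDiffAt ξ hξ).sub (hh.contDiffAt ξ hξ)
  translate ξ hξ η hη H := by simp only [hf.translate ξ hξ η hη H, hh.translate ξ hξ η hη H]
  reflect ξ hξ := by simp only [hf.reflect ξ hξ, hh.reflect ξ hξ]; ring

lemma mul (hf : IsFermiFun f τ s₀ r) (hh : IsFermiFun h τ' s₀ r) :
    IsFermiFun (fun ξ => f ξ * h ξ) (τ * τ') s₀ r where
  contDiffAt ξ hξ := (hf.contDiffAt ξ hξ).mul (hh.contDiffAt ξ hξ)
  translate ξ hξ η hη H := by simp only [hf.translate ξ hξ η hη H, hh.translate ξ hξ η hη H]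
  reflect ξ hξ := by simp only [hf.reflect ξ hξ, hh.reflect ξ hξ]; ring

lemma sum {ι : Type*} [Fintype ι] {F : ι → Coord n → ℝ} (hF : ∀ i, IsFermiFun (F i) τ s₀ r) :
    IsFermiFun (fun ξ => ∑ i, F i ξ) τ s₀ r where
  contDiffAt ξ hξ := ContDiffAt.sum fun i _ => (hF i).contDiffAt ξ hξ
  translate ξ hξ η hη H := Finset.sum_congr rfl fun i _ => (hF i).translate ξ hξ η hη H
  reflect ξ hξ := by simp only [(hF _).reflect ξ hξ, Finset.mul_sum]

lemma apply_axis (hf : IsFermiFun f (-1) s₀ r) {s : ℝ}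
    (hs : axis n s ∈ Metric.ball (axis n s₀) r) : f (axis n s) = 0 := by
  have h1 := hf.reflect _ hs
  have h2 : radial (-1) (axis n s) = axis n s := coord_ext (by simp) (by simp)
  rw [h2] at h1
  linarith

end IsFermiFun

/-- A Riemannian metric near `(s₀, 0)` that does not depend on the first coordinate and is even in
the others. -/
structure IsFermiMetric (G : Coord n → Matrix (Fin (n + 1)) (Fin (n + 1)) ℝ) (s₀ r : ℝ) :
    Prop where
  pos : 0 < r
  isMetricOn : IsMetricOn G (Metric.ball (axis n s₀) r)
  symmetric : ∀ ξ ∈ Metric.ball (axis n s₀) r, ∀ η ∈ Metric.ball (axis n s₀) r, ∀ σ : ℝ,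
    σ ^ 2 = 1 → (∀ m : Fin n, η m.succ = σ * ξ m.succ) → G ξ = G η

namespace IsFermiMetric

variable {G : Coord n → Matrix (Fin (n + 1)) (Fin (n + 1)) ℝ} {s₀ r : ℝ}

lemma translate (h : IsFermiMetric G s₀ r) {ξ η : Coord n} (hξ : ξ ∈ Metric.ball (axis n s₀) r)
    (hη : η ∈ Metric.ball (axis n s₀) r) (hξη : ∀ m : Fin n, η m.succ = ξ m.succ) : G η = G ξ :=
  (h.symmetric ξ hξ η hη 1 (by norm_num) fun m => by rw [hξη, one_mul]).symm

lemma reflect (h : IsFermiMetric G s₀ r) {ξ : Coord n} (hξ : ξ ∈ Metric.ball (axis n s₀) r) :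
    G (radial (-1) ξ) = G ξ :=
  (h.symmetric ξ hξ _ (radial_mem_ball (by norm_num) hξ) (-1) (by norm_num) fun m => by simp).symm

lemma isFermiFun (h : IsFermiMetric G s₀ r) (i j : Fin (n + 1)) :
    IsFermiFun (fun ξ => G ξ i j) 1 s₀ r where
  contDiffAt ξ hξ := h.isMetricOn.contDiffAt ξ hξ i j
  translate ξ hξ η hη H := by simp only [h.translate hξ hη H]
  reflect ξ hξ := by simp only [h.reflect hξ, one_mul]

lemma isFermiFun_inv (h : IsFermiMetric G s₀ r) (i j : Fin (n + 1)) :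
    IsFermiFun (fun ξ => (G ξ)⁻¹ i j) 1 s₀ r where
  contDiffAt ξ hξ := contDiffAt_matrix_inv (h.isMetricOn.contDiffAt ξ hξ)
    (h.isMetricOn.det_ne_zero hξ) i j
  translate ξ hξ η hη H := by simp only [h.translate hξ hη H]
  reflect ξ hξ := by simp only [h.reflect hξ, one_mul]

/-- The inverse metric is even and every first derivative of the metric is odd, so Γ is odd for all
indices. -/
lemma isFermiFun_christoffel (h : IsFermiMetric G s₀ r) (k i j : Fin (n + 1)) :
    IsFermiFun (christoffel G k i j) (-1) s₀ r := by
  have h1 := (IsFermiFun.sum fun l : Fin (n + 1) => (h.isFermiFun_inv k l).mul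
    ((((h.isFermiFun j l).pd i).add ((h.isFermiFun i l).pd j)).sub
      ((h.isFermiFun i j).pd l))).const_mul (1 / 2)
  rw [one_mul] at h1
  exact h1

end IsFermiMetric

lemma exists_isFermiMetric {M : Type*} [TopologicalSpace M] [T2Space M] [ChartedSpace (Coord n) M]
    [IsManifold (𝓡 (n + 1)) ∞ M] {g : Metric n M} {κ : ℝ} (hκ : HasConstantCurvature g κ)
    {γ : ℝ → M} (hγ : IsGeodesicOn g γ Set.univ)
    {e : Fin (n + 1) → ∀ t, TangentSpace (𝓡 (n + 1)) (γ t)} (he : IsParallelFrame g γ e) (s₀ : ℝ) :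
    ∃ r, IsFermiMetric (pullbackMetric g (fermiMap g γ e)) s₀ r := by
  obtain ⟨ε, Z, h⟩ := exists_isFermiBall hγ he s₀
  obtain ⟨r, hr, hrε, hmet⟩ := h.exists_isMetricOn
  have hsub : Metric.ball (axis n s₀) r ⊆ Metric.ball (axis n s₀) ε := Metric.ball_subset_ball hrε
  exact ⟨r, hr, hmet, fun ξ hξ η hη σ hσ H => h.pullbackMetric_eq hκ (hsub hξ) (hsub hη) hσ H⟩

end FermiFunctions

/-! ### Taylor expansion along the axis with uniform remainders. -/

section Taylor

open Topology Set

/-- Taylor's theorem for a chain of derivatives. -/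
lemma abs_sub_taylor_le {k : ℕ} {h : ℕ → ℝ → ℝ} {A : ℝ}
    (hd : ∀ j < k, ∀ t ∈ Icc (0 : ℝ) 1, HasDerivAt (h j) (h (j + 1) t) t)
    (hb : ∀ t ∈ Icc (0 : ℝ) 1, |h k t| ≤ A) {t : ℝ} (ht : t ∈ Icc (0 : ℝ) 1) :
    |h 0 t - ∑ j ∈ Finset.range k, t ^ j / (j.factorial : ℝ) * h j 0| ≤ A := by
  induction k generalizing h t with
  | zero => simpa using hb t ht
  | succ k ih =>
    have hA : 0 ≤ A := (abs_nonneg _).trans (hb t ht)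
    -- The derivative of the remainder is the remainder of one order less for the shifted chain,
    -- bounded by A by induction. On [0, 1] the mean value inequality preserves this bound; the
    -- factor 1/k! is not needed.
    have h1 : ∀ s ∈ Icc (0 : ℝ) 1, HasDerivAt
        (fun s => h 0 s - ∑ j ∈ Finset.range (k + 1), s ^ j / (j.factorial : ℝ) * h j 0)
        (h 1 s - ∑ j ∈ Finset.range k, s ^ j / (j.factorial : ℝ) * h (j + 1) 0) s := by
      intro s hs
      refine (hd 0 (by omega) s hs).sub ?_
      simp only [Finset.sum_range_succ' _ k, pow_zero]
      refine ((HasDerivAt.fun_sum fun j _ => (((hasDerivAt_pow (j + 1) s).div_const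
        ((j + 1).factorial : ℝ)).mul_const (h (j + 1) 0))).add_const _).congr_deriv ?_
      simp only [Nat.add_sub_cancel]
      refine Finset.sum_congr rfl fun j _ => ?_
      rw [Nat.factorial_succ]
      push_cast
      have := Nat.cast_ne_zero (R := ℝ).2 (Nat.factorial_ne_zero j)
      field_simp
    have h2 : ∀ s ∈ Icc (0 : ℝ) 1,
        ‖h 1 s - ∑ j ∈ Finset.range k, s ^ j / (j.factorial : ℝ) * h (j + 1) 0‖ ≤ A :=
      fun s hs => ih (h := fun j => h (j + 1)) (fun j hj s hs => hd (j + 1) (by omega) s hs) hb hs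
    have h3 := (convex_Icc (0 : ℝ) 1).norm_image_sub_le_of_norm_hasDerivWithin_le
      (fun s hs => (h1 s hs).hasDerivWithinAt) h2 (left_mem_Icc.2 zero_le_one) ht
    have h4 : h 0 0 - ∑ j ∈ Finset.range (k + 1), (0 : ℝ) ^ j / (j.factorial : ℝ) * h j 0 = 0 := by
      simp [Finset.sum_range_succ']
    rw [h4, sub_zero, sub_zero, Real.norm_eq_abs, Real.norm_eq_abs, abs_of_nonneg ht.1] at h3
    exact h3.trans (mul_le_of_le_one_right hA ht.2)

variable {n : ℕ}

/-- The `k`-th derivative of `f` in the direction of the components of `u` but the first. -/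
def normalDeriv (u : Coord n) : ℕ → (Coord n → ℝ) → Coord n → ℝ
  | 0, f, x => f x
  | k + 1, f, x => ∑ m : Fin n, u m.succ * normalDeriv u k (pd m.succ f) x

namespace IsFermiFun

variable {f : Coord n → ℝ} {τ s₀ r : ℝ}

/-- The derivative along the full vector u is the normal one, because the derivative in direction x¹
is zero. This is why u¹ does not occur undifferentiated in the expansion. -/
lemma hasDerivAt_normalDeriv (hf : IsFermiFun f τ s₀ r) (u a : Coord n) (k : ℕ) {t : ℝ}
    (ht : a + t • u ∈ Metric.ball (axis n s₀) r) :
    HasDerivAt (fun t : ℝ => normalDeriv u k f (a + t • u)) (normalDeriv u (k + 1) f (a + t • u))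
      t := by
  induction k generalizing f τ with
  | zero =>
    have h1 : HasDerivAt (fun t : ℝ => a + t • u) u t := by
      simpa using ((hasDerivAt_id t).smul_const u).const_add a
    refine (HasFDerivAt.comp_hasDerivAt (l := f) t
      ((hf.contDiffAt _ ht).differentiableAt (by simp)).hasFDerivAt h1).congr_deriv ?_
    rw [fderiv_eq_sum_pd, Fin.sum_univ_succ, hf.pd_zero ht, mul_zero, zero_add]
    rfl
  | succ k ih => exact HasDerivAt.fun_sum fun m _ => (ih (hf.pd m.succ)).const_mul _

lemma exists_normalDeriv_le (hf : IsFermiFun f τ s₀ r) {ρ : ℝ} (hρ : ρ < r) (k : ℕ) :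
    ∃ C, 0 ≤ C ∧ ∀ u, ∀ x ∈ Metric.closedBall (axis n s₀) ρ,
      |normalDeriv u k f x| ≤ C * ‖u‖ ^ k := by
  induction k generalizing f τ with
  | zero =>
    have hc : ContinuousOn f (Metric.closedBall (axis n s₀) ρ) := fun x hx =>
      (hf.contDiffAt x (Metric.closedBall_subset_ball hρ hx)).continuousAt.continuousWithinAt
    obtain ⟨C, hC⟩ := (isCompact_closedBall (axis n s₀) ρ).exists_bound_of_continuousOn hc
    refine ⟨max C 0, le_max_right _ _, fun u x hx => ?_⟩
    simpa [normalDeriv] using Or.inl (hC x hx)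
  | succ k ih =>
    choose C hC0 hC using fun m : Fin n => ih (hf.pd m.succ)
    refine ⟨∑ m, C m, Finset.sum_nonneg fun m _ => hC0 m, fun u x hx => ?_⟩
    rw [Finset.sum_mul]
    refine (Finset.abs_sum_le_sum_abs _ _).trans (Finset.sum_le_sum fun m _ => ?_)
    rw [abs_mul, pow_succ, ← mul_assoc, mul_comm]
    have h1 : |u m.succ| ≤ ‖u‖ := PiLp.norm_apply_le u m.succ
    exact mul_le_mul (hC m u x hx) h1 (abs_nonneg _) (mul_nonneg (hC0 m) (by positivity))

/-- Taylor expansion of `f` at the points `(s, 0)` with a uniform remainder. -/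
lemma exists_taylor_le (hf : IsFermiFun f τ s₀ r) (hr : 0 < r) (k : ℕ) :
    ∃ C, 0 ≤ C ∧ ∀ s ∈ Metric.ball s₀ (r / 4), ∀ u : Coord n, ‖u‖ ≤ r / 4 →
      |f (axis n s + u) - ∑ j ∈ Finset.range k,
        1 / (j.factorial : ℝ) * normalDeriv u j f (axis n s)| ≤ C * ‖u‖ ^ k := by
  obtain ⟨C, hC0, hC⟩ := hf.exists_normalDeriv_le (ρ := r / 2) (by linarith) k
  refine ⟨C, hC0, fun s hs u hu => ?_⟩
  -- The two radii r/4 add up to r/2, so the segment stays in a compact ball inside the domain.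
  have hmem : ∀ t ∈ Icc (0 : ℝ) 1, axis n s + t • u ∈ Metric.closedBall (axis n s₀) (r / 2) := by
    intro t ht
    have h1 : axis n s + t • u - axis n s₀ = (s - s₀) • basisVec 0 + t • u := by
      simp only [axis]; module
    rw [mem_closedBall_iff_norm, h1]
    refine (norm_add_le _ _).trans ?_
    rw [norm_smul, norm_smul, Real.norm_eq_abs, Real.norm_eq_abs, abs_of_nonneg ht.1]
    have h2 : ‖(basisVec 0 : Coord n)‖ = 1 := by simp [basisVec]
    have h3 : |s - s₀| < r / 4 := by rwa [← Real.dist_eq]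
    have h4 : t * ‖u‖ ≤ ‖u‖ := mul_le_of_le_one_left (norm_nonneg u) ht.2
    rw [h2]
    linarith
  have h1 := abs_sub_taylor_le (k := k) (h := fun j t => normalDeriv u j f (axis n s + t • u))
    (fun j _ t ht => hf.hasDerivAt_normalDeriv u _ j
      (Metric.closedBall_subset_ball (by linarith) (hmem t ht)))
    (fun t ht => hC u _ (hmem t ht)) (right_mem_Icc.2 zero_le_one)
  simpa [normalDeriv] using h1

lemma normalDeriv_two_axis (hf : IsFermiFun f (-1) s₀ r) {s : ℝ}
    (hs : axis n s ∈ Metric.ball (axis n s₀) r) (u : Coord n) :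
    normalDeriv u 2 f (axis n s) = 0 := by
  refine Finset.sum_eq_zero fun m _ => mul_eq_zero_of_right _ (Finset.sum_eq_zero fun p _ =>
    mul_eq_zero_of_right _ ?_)
  have h1 := (hf.pd m.succ).pd p.succ
  rw [neg_neg] at h1
  exact h1.apply_axis hs

/-- Taylor expansion of a function that is odd in the normal coordinates. -/
lemma exists_odd_taylor_le (hf : IsFermiFun f (-1) s₀ r) (hr : 0 < r) :
    ∃ C, 0 ≤ C ∧ ∀ s ∈ Metric.ball s₀ (r / 4), ∀ u : Coord n, ‖u‖ ≤ r / 4 →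
      |f (axis n s + u) - normalDeriv u 1 f (axis n s)| ≤ C * ‖u‖ ^ 3 ∧
      |f (axis n s + u) - normalDeriv u 1 f (axis n s) - 1 / 6 * normalDeriv u 3 f (axis n s)|
        ≤ C * ‖u‖ ^ 4 := by
  -- The orders 0 and 2 vanish, so the expansion to order 3 leaves the linear term alone, and that
  -- to order 4 leaves the linear and cubic terms.
  obtain ⟨C₃, hC₃, h₃⟩ := hf.exists_taylor_le hr 3
  obtain ⟨C₄, hC₄, h₄⟩ := hf.exists_taylor_le hr 4
  refine ⟨max C₃ C₄, le_max_of_le_left hC₃, fun s hs u hu => ?_⟩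
  have hax : axis n s ∈ Metric.ball (axis n s₀) r := by
    have h1 : axis n s - axis n s₀ = (s - s₀) • basisVec 0 := by simp only [axis]; module
    have h2 : ‖(basisVec 0 : Coord n)‖ = 1 := by simp [basisVec]
    rw [mem_ball_iff_norm, h1, norm_smul, h2, mul_one, Real.norm_eq_abs, ← Real.dist_eq]
    have := Metric.mem_ball.1 hs
    linarith
  have e0 : normalDeriv u 0 f (axis n s) = 0 := hf.apply_axis hax
  have e2 := hf.normalDeriv_two_axis hax u
  have g3 := h₃ s hs u hu
  have g4 := h₄ s hs u hu
  simp only [Finset.sum_range_succ, Finset.sum_range_zero, e0, e2, Nat.factorial] at g3 g4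
  norm_num at g3 g4
  rw [← sub_sub] at g4
  constructor
  · exact g3.trans (by gcongr; exact le_max_left _ _)
  · norm_num
    exact g4.trans (by gcongr; exact le_max_right _ _)

end IsFermiFun

end Taylor

/-! ### Expansion of the wave map operator. -/

section WaveMap

open Topology Set

variable {n d : ℕ}

/-- On `S`, the functions `Γ^i_{jk}` are symmetric in `j, k` and have expansions at the points
`(s, 0)` without terms of even order, with uniform remainders. -/
def HasOddExpansion (Γ : Fin (n + 1) → Fin (n + 1) → Fin (n + 1) → Coord n → ℝ) (S : Set ℝ) : Prop :=
  ∃ C > 0, ∃ δ > 0, ∀ s ∈ S, ∀ u : Coord n, ‖u‖ ≤ δ → ∀ i j k,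
    Γ i j k (axis n s + u) = Γ i k j (axis n s + u) ∧
    |Γ i j k (axis n s + u) - normalDeriv u 1 (Γ i j k) (axis n s)| ≤ C * ‖u‖ ^ 3 ∧
    |Γ i j k (axis n s + u) - normalDeriv u 1 (Γ i j k) (axis n s)
      - 1 / 6 * normalDeriv u 3 (Γ i j k) (axis n s)| ≤ C * ‖u‖ ^ 4

/-- The property passes to subsets and to unions of two sets, by taking the larger C and the smaller
δ; compactness then makes the local statement uniform. -/
lemma HasOddExpansion.of_isCompact
    {Γ : Fin (n + 1) → Fin (n + 1) → Fin (n + 1) → Coord n → ℝ}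
    (h : ∀ s, ∃ S ∈ 𝓝 s, HasOddExpansion Γ S) {S : Set ℝ} (hS : IsCompact S) :
    HasOddExpansion Γ S := by
  refine hS.induction_on (p := HasOddExpansion Γ) ⟨1, one_pos, 1, one_pos, by simp⟩ ?_ ?_ ?_
  · rintro S T hST ⟨C, hC, δ, hδ, H⟩
    exact ⟨C, hC, δ, hδ, fun s hs => H s (hST hs)⟩
  · rintro S T ⟨C, hC, δ, hδ, H⟩ ⟨C', hC', δ', hδ', H'⟩
    refine ⟨max C C', lt_max_of_lt_left hC, min δ δ', lt_min hδ hδ', fun s hs u hu i j k => ?_⟩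
    rcases hs with hs | hs
    · obtain ⟨h1, h2, h3⟩ := H s hs u (hu.trans (min_le_left _ _)) i j k
      exact ⟨h1, h2.trans (by gcongr; exact le_max_left _ _),
        h3.trans (by gcongr; exact le_max_left _ _)⟩
    · obtain ⟨h1, h2, h3⟩ := H' s hs u (hu.trans (min_le_right _ _)) i j k
      exact ⟨h1, h2.trans (by gcongr; exact le_max_right _ _),
        h3.trans (by gcongr; exact le_max_right _ _)⟩
  · intro s _
    obtain ⟨T, hT, H⟩ := h s
    exact ⟨T, mem_nhdsWithin_of_mem_nhds hT, H⟩

lemma IsFermiMetric.hasOddExpansion {G : Coord n → Matrix (Fin (n + 1)) (Fin (n + 1)) ℝ} {s₀ r : ℝ}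
    (h : IsFermiMetric G s₀ r) : HasOddExpansion (christoffel G) (Metric.ball s₀ (r / 4)) := by
  have hr := h.pos
  choose C hC0 hC using fun i j k : Fin (n + 1) =>
    (h.isFermiFun_christoffel i j k).exists_odd_taylor_le hr
  have hle : ∀ i j k, C i j k ≤ ∑ i, ∑ j, ∑ k, C i j k := fun i j k =>
    calc C i j k ≤ ∑ k, C i j k :=
          Finset.single_le_sum (fun k _ => hC0 i j k) (Finset.mem_univ k)
      _ ≤ ∑ j, ∑ k, C i j k := Finset.single_le_sum (f := fun j => ∑ k, C i j k)
          (fun j _ => Finset.sum_nonneg fun k _ => hC0 i j k) (Finset.mem_univ j)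
      _ ≤ _ := Finset.single_le_sum (f := fun i => ∑ j, ∑ k, C i j k)
          (fun i _ => Finset.sum_nonneg fun j _ => Finset.sum_nonneg fun k _ => hC0 i j k)
          (Finset.mem_univ i)
  have hle' : ∀ i j k, C i j k ≤ (∑ i, ∑ j, ∑ k, C i j k) + 1 := fun i j k =>
    (hle i j k).trans (by linarith)
  refine ⟨(∑ i, ∑ j, ∑ k, C i j k) + 1, ?_, r / 4, by linarith, fun s hs u hu i j k => ?_⟩
  · linarith [(hC0 0 0 0).trans (hle 0 0 0)]
  · obtain ⟨h1, h2⟩ := hC i j k s hs u hu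
    refine ⟨h.isMetricOn.christoffel_symm ?_ i j k, h1.trans ?_, h2.trans ?_⟩
    · have h1 : axis n s + u - axis n s₀ = (s - s₀) • basisVec 0 + u := by
        simp only [axis]; module
      have h2 : ‖(basisVec 0 : Coord n)‖ = 1 := by simp [basisVec]
      rw [mem_ball_iff_norm, h1]
      refine (norm_add_le _ _).trans_lt ?_
      rw [norm_smul, h2, mul_one, Real.norm_eq_abs, ← Real.dist_eq]
      have := Metric.mem_ball.1 hs
      linarith
    · gcongr; exact hle' i j k
    · gcongr; exact hle' i j k

/-! ### First derivatives and the wave operator on (ℓ + u¹, u⃗). -/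

section Minkowski

lemma pd_component {u : Coord d → Coord n} {x : Coord d} (hu : DifferentiableAt ℝ u x)
    (j : Fin (n + 1)) (a : Fin (d + 1)) :
    pd a (fun z => u z j) x = fderiv ℝ u x (basisVec a) j := by
  have h1 : HasFDerivAt (fun z => u z j) _ x := HasFDerivAt.comp x
    (g := (EuclideanSpace.proj j : Coord n →L[ℝ] ℝ))
    (EuclideanSpace.proj j : Coord n →L[ℝ] ℝ).hasFDerivAt hu.hasFDerivAt
  rw [pd, h1.fderiv]
  rfl

lemma abs_pd_component_le {u : Coord d → Coord n} {x : Coord d} (hu : DifferentiableAt ℝ u x)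
    (j : Fin (n + 1)) (a : Fin (d + 1)) : |pd a (fun z => u z j) x| ≤ ‖fderiv ℝ u x‖ := by
  rw [pd_component hu]
  refine (PiLp.norm_apply_le (fderiv ℝ u x (basisVec a)) j).trans ?_
  refine ((fderiv ℝ u x).le_opNorm _).trans ?_
  have h2 : ‖(basisVec a : Coord d)‖ = 1 := by simp [basisVec]
  rw [h2, mul_one]

lemma pd_clm (ℓ : Coord d →L[ℝ] ℝ) (a : Fin (d + 1)) (x : Coord d) : pd a ℓ x = ℓ (basisVec a) := by
  rw [pd, ContinuousLinearMap.fderiv]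

lemma abs_pd_clm_le (ℓ : Coord d →L[ℝ] ℝ) (a : Fin (d + 1)) (x : Coord d) : |pd a ℓ x| ≤ ‖ℓ‖ := by
  rw [pd_clm]
  refine (ℓ.le_opNorm _).trans ?_
  have h2 : ‖(basisVec a : Coord d)‖ = 1 := by simp [basisVec]
  rw [h2, mul_one]

lemma abs_minkD_le {f h : Coord d → ℝ} {x : Coord d} {A B : ℝ} (hA : ∀ a, |pd a f x| ≤ A)
    (hB : ∀ a, |pd a h x| ≤ B) : |minkD f h x| ≤ (d + 1) * (A * B) := by
  have hA0 : 0 ≤ A := (abs_nonneg _).trans (hA 0)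
  have key : ∀ a, |pd a f x * pd a h x| ≤ A * B := fun a => by
    rw [abs_mul]
    exact mul_le_mul (hA a) (hB a) (abs_nonneg _) hA0
  rw [minkD]
  refine (abs_add_le _ _).trans ?_
  rw [abs_neg]
  have h1 : |∑ a : Fin d, pd a.succ f x * pd a.succ h x| ≤ d * (A * B) := by
    refine (Finset.abs_sum_le_sum_abs _ _).trans ?_
    refine (Finset.sum_le_card_nsmul _ _ (A * B) fun a _ => key a.succ).trans ?_
    simp
  linarith [key 0]

lemma minkD_comm (f h : Coord d → ℝ) (x : Coord d) : minkD f h x = minkD h f x := by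
  simp only [minkD, mul_comm]

lemma minkD_of_pd_add {f f₁ f₂ h h₁ h₂ : Coord d → ℝ} {x : Coord d} {α β : ℝ}
    (hf : ∀ a, pd a f x = α * pd a f₁ x + pd a f₂ x)
    (hh : ∀ a, pd a h x = β * pd a h₁ x + pd a h₂ x) :
    minkD f h x = α * β * minkD f₁ h₁ x + α * minkD f₁ h₂ x + β * minkD f₂ h₁ x
      + minkD f₂ h₂ x := by
  simp only [minkD, hf, hh]
  have : ∑ a : Fin d, (α * pd a.succ f₁ x + pd a.succ f₂ x) * (β * pd a.succ h₁ x + pd a.succ h₂ x) =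
      α * β * ∑ a : Fin d, pd a.succ f₁ x * pd a.succ h₁ x
      + α * ∑ a : Fin d, pd a.succ f₁ x * pd a.succ h₂ x
      + β * ∑ a : Fin d, pd a.succ f₂ x * pd a.succ h₁ x
      + ∑ a : Fin d, pd a.succ f₂ x * pd a.succ h₂ x := by
    simp only [Finset.mul_sum, ← Finset.sum_add_distrib]
    exact Finset.sum_congr rfl fun a _ => by ring
  rw [this]
  ring

lemma pd_axis_add (ℓ : Coord d →L[ℝ] ℝ) {u : Coord d → Coord n} {x : Coord d}
    (hu : DifferentiableAt ℝ u x) (j : Fin (n + 1)) (a : Fin (d + 1)) :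
    pd a (fun z => (axis n (ℓ z) + u z) j) x =
      (basisVec 0 : Coord n) j * pd a ℓ x + pd a (fun z => u z j) x := by
  have h1 : HasFDerivAt (fun z => u z j) (fderiv ℝ (fun z => u z j) x) x :=
    (((EuclideanSpace.proj j : Coord n →L[ℝ] ℝ).differentiableAt).comp x hu).hasFDerivAt
  have h2 : HasFDerivAt (fun z => (basisVec 0 : Coord n) j * ℓ z + u z j)
      ((basisVec 0 : Coord n) j • ℓ + fderiv ℝ (fun z => u z j) x) x :=
    (ℓ.hasFDerivAt.const_mul _).add h1
  have h3 : (fun z => (axis n (ℓ z) + u z) j) =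
      fun z => (basisVec 0 : Coord n) j * ℓ z + u z j := by
    funext z
    simp [axis, mul_comm]
  rw [h3, pd, h2.fderiv, pd_clm]
  rfl

/-- The first derivatives of ℓ are constant, so ℓ is invisible to □. -/
lemma box_axis_add (ℓ : Coord d →L[ℝ] ℝ) {u : Coord d → Coord n} {x : Coord d}
    (hu : ContDiffAt ℝ 2 u x) (j : Fin (n + 1)) :
    box (fun z => (axis n (ℓ z) + u z) j) x = box (fun z => u z j) x := by
  have key : ∀ a, pd a (pd a (fun z => (axis n (ℓ z) + u z) j)) x =
      pd a (pd a (fun z => u z j)) x := by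
    intro a
    have h1 : pd a (fun z => (axis n (ℓ z) + u z) j) =ᶠ[𝓝 x]
        fun z => (basisVec 0 : Coord n) j * ℓ (basisVec a) + pd a (fun z => u z j) z := by
      filter_upwards [hu.eventually (by simp)] with z hz
      rw [pd_axis_add ℓ (hz.differentiableAt (by simp)), pd_clm]
    rw [pd, h1.fderiv_eq, fderiv_const_add]
    rfl
  simp only [box, key]

end Minkowski

variable {Γ : Fin (n + 1) → Fin (n + 1) → Fin (n + 1) → Coord n → ℝ}

/-- `basisVec 0` acts as a Kronecker delta, since ℓ enters only the first component; symmetry of Γ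
merges the two cross terms into one with the factor 2. -/
lemma sum_sum_expand (Γ' b : Fin (n + 1) → Fin (n + 1) → ℝ) (c : Fin (n + 1) → ℝ) (σ : ℝ)
    (hsymm : ∀ j k, Γ' j k = Γ' k j) :
    ∑ j, ∑ k, Γ' j k * ((basisVec 0 : Coord n) j * (basisVec 0 : Coord n) k * σ
      + (basisVec 0 : Coord n) j * c k + (basisVec 0 : Coord n) k * c j + b j k) =
      Γ' 0 0 * σ + 2 * ∑ j, Γ' j 0 * c j + ∑ j, ∑ k, Γ' j k * b j k := by
  simp only [basisVec_apply, mul_add, Finset.sum_add_distrib]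
  have h1 : ∑ j, ∑ k, Γ' j k * ((if j = (0 : Fin (n + 1)) then (1 : ℝ) else 0) *
      (if k = (0 : Fin (n + 1)) then (1 : ℝ) else 0) * σ) = Γ' 0 0 * σ := by
    simp [ite_mul, mul_ite]
  have h2 : ∑ j, ∑ k, Γ' j k * ((if j = (0 : Fin (n + 1)) then (1 : ℝ) else 0) * c k) =
      ∑ j, Γ' j 0 * c j := by
    rw [Finset.sum_comm]
    simp [ite_mul, mul_ite, hsymm 0]
  have h3 : ∑ j, ∑ k, Γ' j k * ((if k = (0 : Fin (n + 1)) then (1 : ℝ) else 0) * c j) =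
      ∑ j, Γ' j 0 * c j := by
    simp [ite_mul, mul_ite]
  rw [h1, h2, h3]
  ring

lemma waveMapOp_axis_add (ℓ : Coord d →L[ℝ] ℝ) {u : Coord d → Coord n} {x : Coord d}
    (hu : ContDiffAt ℝ 2 u x) (i : Fin (n + 1))
    (hsymm : ∀ j k, Γ i j k (axis n (ℓ x) + u x) = Γ i k j (axis n (ℓ x) + u x)) :
    waveMapOp Γ (fun z => axis n (ℓ z) + u z) i x = box (fun z => u z i) x
      + (Γ i 0 0 (axis n (ℓ x) + u x) * minkD ℓ ℓ x
        + 2 * ∑ j, Γ i j 0 (axis n (ℓ x) + u x) * minkD (fun z => u z j) ℓ x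
        + ∑ j, ∑ k, Γ i j k (axis n (ℓ x) + u x) *
          minkD (fun z => u z j) (fun z => u z k) x) := by
  have hd : DifferentiableAt ℝ u x := hu.differentiableAt (by simp)
  rw [waveMapOp, box_axis_add ℓ hu, ← sum_sum_expand _ _ _ _ hsymm]
  congr 1
  refine Finset.sum_congr rfl fun j _ => Finset.sum_congr rfl fun k _ => ?_
  rw [minkD_of_pd_add (pd_axis_add ℓ hd j) (pd_axis_add ℓ hd k), minkD_comm ℓ (fun z => u z k)]

/-- Regroups the terms by powers of Du so that they match the Taylor polynomials of Γ; `h2` makes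
the sum with second derivatives vanish. -/
lemma expansion_eq (ℓ : Coord d →L[ℝ] ℝ) {u : Coord d → Coord n} {x : Coord d} (i : Fin (n + 1))
    (h2 : ∀ (m p : Fin n) j, pd m.succ (pd p.succ (Γ i j 0)) (axis n (ℓ x)) = 0) :
    linearPart Γ ℓ u i x + quadraticPart Γ ℓ u i x + cubicPart Γ ℓ u i x =
      (normalDeriv (u x) 1 (Γ i 0 0) (axis n (ℓ x))
        + 1 / 6 * normalDeriv (u x) 3 (Γ i 0 0) (axis n (ℓ x))) * minkD ℓ ℓ x
      + 2 * ∑ j, normalDeriv (u x) 1 (Γ i j 0) (axis n (ℓ x)) * minkD (fun z => u z j) ℓ x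
      + ∑ j, ∑ k, normalDeriv (u x) 1 (Γ i j k) (axis n (ℓ x)) *
          minkD (fun z => u z j) (fun z => u z k) x := by
  have e1 : linearPart Γ ℓ u i x = normalDeriv (u x) 1 (Γ i 0 0) (axis n (ℓ x)) * minkD ℓ ℓ x := by
    simp only [linearPart, normalDeriv, Finset.sum_mul]
    exact Finset.sum_congr rfl fun m _ => by ring
  have e2 : quadraticPart Γ ℓ u i x =
      2 * ∑ j, normalDeriv (u x) 1 (Γ i j 0) (axis n (ℓ x)) * minkD (fun z => u z j) ℓ x := by
    rw [quadraticPart, Fin.sum_univ_succ, mul_add]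
    congr 2
    · simp only [normalDeriv, Finset.sum_mul]
      exact Finset.sum_congr rfl fun m _ => by ring
    · rw [Finset.sum_comm]
      simp only [normalDeriv, Finset.sum_mul]
      exact Finset.sum_congr rfl fun m _ => Finset.sum_congr rfl fun p _ => by ring
  have e3 : ∑ m : Fin n, ∑ j, ∑ k, pd m.succ (Γ i j k) (axis n (ℓ x)) * u x m.succ
        * minkD (fun z => u z j) (fun z => u z k) x =
      ∑ j, ∑ k, normalDeriv (u x) 1 (Γ i j k) (axis n (ℓ x)) *
          minkD (fun z => u z j) (fun z => u z k) x := by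
    rw [Finset.sum_comm]
    refine Finset.sum_congr rfl fun j _ => ?_
    rw [Finset.sum_comm]
    refine Finset.sum_congr rfl fun k _ => ?_
    simp only [normalDeriv, Finset.sum_mul]
    exact Finset.sum_congr rfl fun m _ => by ring
  have e4 : ∑ m : Fin n, ∑ p : Fin n, ∑ j, pd m.succ (pd p.succ (Γ i j 0)) (axis n (ℓ x))
        * u x m.succ * u x p.succ * minkD (fun z => u z j) ℓ x = 0 :=
    Finset.sum_eq_zero fun m _ => Finset.sum_eq_zero fun p _ => Finset.sum_eq_zero fun j _ => by
      rw [h2]; ring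
  have e5 : ∑ m : Fin n, ∑ p : Fin n, ∑ q : Fin n,
        pd m.succ (pd p.succ (pd q.succ (Γ i 0 0))) (axis n (ℓ x))
          * u x m.succ * u x p.succ * u x q.succ * minkD ℓ ℓ x =
      normalDeriv (u x) 3 (Γ i 0 0) (axis n (ℓ x)) * minkD ℓ ℓ x := by
    simp only [normalDeriv, Finset.mul_sum, Finset.sum_mul]
    -- The outer index of `normalDeriv` belongs to the innermost derivative, the reverse of
    -- `cubicPart`. Exchanging the sums avoids any appeal to symmetry of third derivatives.
    calc _ = ∑ m : Fin n, ∑ q : Fin n, ∑ p : Fin n, _ :=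
          Finset.sum_congr rfl fun m _ => Finset.sum_comm
      _ = ∑ q : Fin n, ∑ m : Fin n, ∑ p : Fin n, _ := Finset.sum_comm
      _ = ∑ q : Fin n, ∑ p : Fin n, ∑ m : Fin n, _ :=
          Finset.sum_congr rfl fun q _ => Finset.sum_comm
      _ = _ := Finset.sum_congr rfl fun q _ => Finset.sum_congr rfl fun p _ =>
          Finset.sum_congr rfl fun m _ => by ring
  rw [cubicPart, e1, e2, e3, e4, e5]
  ring

/-- The expansion of the wave map operator around a solution along the geodesic. -/
theorem waveMapOp_expansion (ℓ : Coord d →L[ℝ] ℝ) {S : Set ℝ} (hΓ : HasOddExpansion Γ S)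
    (h2 : ∀ (m p : Fin n) i j s, pd m.succ (pd p.succ (Γ i j 0)) (axis n s) = 0) :
    ∃ C > 0, ∃ δ > 0, ∀ (u : Coord d → Coord n) (x : Coord d), ℓ x ∈ S → ContDiffAt ℝ 2 u x →
      ‖u x‖ ≤ δ → ∀ i : Fin (n + 1),
        |waveMapOp Γ (fun z => axis n (ℓ z) + u z) i x
          - (box (fun z => u z i) x + linearPart Γ ℓ u i x + quadraticPart Γ ℓ u i x
            + cubicPart Γ ℓ u i x)| ≤ C * (‖u x‖ ^ 4 + ‖fderiv ℝ u x‖ ^ 4) := by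
  obtain ⟨C, hC, δ, hδ, H⟩ := hΓ
  set N : ℝ := (n : ℝ) + 1 with hN
  set D : ℝ := (d : ℝ) + 1 with hD
  have hN0 : 0 < N := by positivity
  have hD0 : 0 < D := by positivity
  -- The three summands bound the errors in the terms with no, one and two factors Du; N and D count
  -- components and derivatives. The bound |u| ≤ 1 is used in `hUV2`, while Du need not be small.
  refine ⟨C * D * (‖ℓ‖ ^ 2 + 2 * N * ‖ℓ‖ + N ^ 2), by positivity, min δ 1, lt_min hδ one_pos,
    fun u x hx hu hux i => ?_⟩
  have hd : DifferentiableAt ℝ u x := hu.differentiableAt (by simp)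
  have hu1 : ‖u x‖ ≤ 1 := hux.trans (min_le_right _ _)
  have HH := H (ℓ x) hx (u x) (hux.trans (min_le_left _ _)) i
  rw [waveMapOp_axis_add ℓ hu i fun j k => (HH j k).1, add_assoc (box _ x), add_assoc (box _ x),
    expansion_eq ℓ i fun m p j => h2 m p i j _, add_sub_add_left_eq_sub]
  set U := ‖u x‖ with hU
  set V := ‖fderiv ℝ u x‖ with hV
  have hU0 : 0 ≤ U := norm_nonneg _
  have hV0 : 0 ≤ V := norm_nonneg _
  have bσ : |minkD ℓ ℓ x| ≤ D * (‖ℓ‖ * ‖ℓ‖) :=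
    abs_minkD_le (fun a => abs_pd_clm_le ℓ a x) (fun a => abs_pd_clm_le ℓ a x)
  have bc : ∀ j, |minkD (fun z => u z j) ℓ x| ≤ D * (V * ‖ℓ‖) := fun j =>
    abs_minkD_le (fun a => abs_pd_component_le hd j a) (fun a => abs_pd_clm_le ℓ a x)
  have bb : ∀ j k, |minkD (fun z => u z j) (fun z => u z k) x| ≤ D * (V * V) := fun j k =>
    abs_minkD_le (fun a => abs_pd_component_le hd j a) (fun a => abs_pd_component_le hd k a)
  have hUV1 : U ^ 3 * V ≤ U ^ 4 + V ^ 4 := by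
    nlinarith [sq_nonneg (U ^ 2 - V ^ 2), sq_nonneg (U * (U - V)), sq_nonneg (U * V),
      sq_nonneg (U ^ 2), sq_nonneg (V ^ 2)]
  have hUV2 : U ^ 3 * (V * V) ≤ U ^ 4 + V ^ 4 := by
    have h3 : U ^ 3 ≤ U ^ 2 := pow_le_pow_of_le_one hU0 hu1 (by norm_num)
    have h4 : U ^ 3 * (V * V) ≤ U ^ 2 * (V * V) := by gcongr
    nlinarith [sq_nonneg (U ^ 2 - V ^ 2), sq_nonneg (U ^ 2), sq_nonneg (V ^ 2)]
  -- Only the term with σ uses the remainder of order four. Elsewhere the factors Du supply the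
  -- missing order, through `hUV1` and `hUV2`.
  have hsplit : (Γ i 0 0 (axis n (ℓ x) + u x) * minkD ℓ ℓ x
        + 2 * ∑ j, Γ i j 0 (axis n (ℓ x) + u x) * minkD (fun z => u z j) ℓ x
        + ∑ j, ∑ k, Γ i j k (axis n (ℓ x) + u x) * minkD (fun z => u z j) (fun z => u z k) x) -
      ((normalDeriv (u x) 1 (Γ i 0 0) (axis n (ℓ x))
        + 1 / 6 * normalDeriv (u x) 3 (Γ i 0 0) (axis n (ℓ x))) * minkD ℓ ℓ x
      + 2 * ∑ j, normalDeriv (u x) 1 (Γ i j 0) (axis n (ℓ x)) * minkD (fun z => u z j) ℓ x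
      + ∑ j, ∑ k, normalDeriv (u x) 1 (Γ i j k) (axis n (ℓ x)) *
          minkD (fun z => u z j) (fun z => u z k) x) =
      (Γ i 0 0 (axis n (ℓ x) + u x) - normalDeriv (u x) 1 (Γ i 0 0) (axis n (ℓ x))
        - 1 / 6 * normalDeriv (u x) 3 (Γ i 0 0) (axis n (ℓ x))) * minkD ℓ ℓ x
      + 2 * ∑ j, (Γ i j 0 (axis n (ℓ x) + u x) - normalDeriv (u x) 1 (Γ i j 0) (axis n (ℓ x))) *
          minkD (fun z => u z j) ℓ x
      + ∑ j, ∑ k, (Γ i j k (axis n (ℓ x) + u x) - normalDeriv (u x) 1 (Γ i j k) (axis n (ℓ x))) *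
          minkD (fun z => u z j) (fun z => u z k) x := by
    simp only [sub_mul, Finset.sum_sub_distrib]
    ring
  rw [hsplit]
  have hsum : ∀ (F : Fin (n + 1) → ℝ) (A : ℝ), (∀ j, |F j| ≤ A) → |∑ j, F j| ≤ N * A := by
    intro F A hF
    refine (Finset.abs_sum_le_sum_abs _ _).trans ?_
    refine (Finset.sum_le_card_nsmul _ _ A fun j _ => hF j).trans (le_of_eq ?_)
    simp [hN]
  have t1 : |(Γ i 0 0 (axis n (ℓ x) + u x) - normalDeriv (u x) 1 (Γ i 0 0) (axis n (ℓ x))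
        - 1 / 6 * normalDeriv (u x) 3 (Γ i 0 0) (axis n (ℓ x))) * minkD ℓ ℓ x| ≤
      C * U ^ 4 * (D * (‖ℓ‖ * ‖ℓ‖)) := by
    rw [abs_mul]
    exact mul_le_mul (HH 0 0).2.2 bσ (abs_nonneg _) (by positivity)
  have t2 := hsum (fun j => (Γ i j 0 (axis n (ℓ x) + u x) -
      normalDeriv (u x) 1 (Γ i j 0) (axis n (ℓ x))) * minkD (fun z => u z j) ℓ x)
      (C * U ^ 3 * (D * (V * ‖ℓ‖))) fun j => by
    rw [abs_mul]
    exact mul_le_mul (HH j 0).2.1 (bc j) (abs_nonneg _) (by positivity)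
  have t3 := hsum (fun j => ∑ k, (Γ i j k (axis n (ℓ x) + u x) -
      normalDeriv (u x) 1 (Γ i j k) (axis n (ℓ x))) * minkD (fun z => u z j) (fun z => u z k) x)
      (N * (C * U ^ 3 * (D * (V * V)))) fun j => hsum _ _ fun k => by
    rw [abs_mul]
    exact mul_le_mul (HH j k).2.1 (bb j k) (abs_nonneg _) (by positivity)
  have u1 : C * U ^ 4 * (D * (‖ℓ‖ * ‖ℓ‖)) ≤ C * D * ‖ℓ‖ ^ 2 * (U ^ 4 + V ^ 4) := by
    have : U ^ 4 ≤ U ^ 4 + V ^ 4 := le_add_of_nonneg_right (by positivity)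
    calc _ = C * D * ‖ℓ‖ ^ 2 * U ^ 4 := by ring
      _ ≤ _ := by gcongr
  have u2 : N * (C * U ^ 3 * (D * (V * ‖ℓ‖))) ≤ C * D * (N * ‖ℓ‖) * (U ^ 4 + V ^ 4) := by
    calc _ = C * D * (N * ‖ℓ‖) * (U ^ 3 * V) := by ring
      _ ≤ _ := by gcongr
  have u3 : N * (N * (C * U ^ 3 * (D * (V * V)))) ≤ C * D * N ^ 2 * (U ^ 4 + V ^ 4) := by
    calc _ = C * D * N ^ 2 * (U ^ 3 * (V * V)) := by ring
      _ ≤ _ := by gcongr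
  refine (abs_add_three _ _ _).trans ?_
  rw [abs_mul 2, abs_two]
  calc _ ≤ C * D * ‖ℓ‖ ^ 2 * (U ^ 4 + V ^ 4) + 2 * (C * D * (N * ‖ℓ‖) * (U ^ 4 + V ^ 4))
        + C * D * N ^ 2 * (U ^ 4 + V ^ 4) := by
          gcongr
          · exact t1.trans u1
          · exact t2.trans u2
          · exact t3.trans u3
    _ = _ := by ring

end WaveMap

end FermiWaveMap

end

/-! ### The main theorem. -/

open FermiWaveMap in
theorem lemma3p3 {n : ℕ} {M : Type*} [TopologicalSpace M] [T2Space M]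
    [ChartedSpace (Coord n) M] [IsManifold (𝓡 (n + 1)) ∞ M]
    (g : Metric n M) (κ : ℝ) (hκ : HasConstantCurvature g κ)
    (γ : ℝ → M) (hγ : IsGeodesicOn g γ Set.univ)
    (e : Fin (n + 1) → ∀ t, TangentSpace (𝓡 (n + 1)) (γ t)) (he : IsParallelFrame g γ e) :
    -- the Fermi coordinates and their Christoffel symbols are regular near the geodesic
    (∀ s : ℝ, fermiMap g γ e (axis n s) = γ s ∧
      ContMDiffAt 𝓘(ℝ, Coord n) (𝓡 (n + 1)) ∞ (fermiMap g γ e) (axis n s) ∧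
      Function.Bijective (mfderiv 𝓘(ℝ, Coord n) (𝓡 (n + 1)) (fermiMap g γ e) (axis n s)) ∧
      ∀ k i j, ContDiffAt ℝ ∞ (fermiChristoffel g γ e k i j) (axis n s)) ∧
    -- the vanishing identities along the geodesic
    (∀ s : ℝ,
      (∀ (m : Fin n) (i j : Fin (n + 1)),
        pd 0 (pd m.succ (fermiChristoffel g γ e i j 0)) (axis n s) = 0) ∧
      (∀ (p m : Fin n) (i : Fin (n + 1)),
        pd p.succ (pd m.succ (fermiChristoffel g γ e i 0 0)) (axis n s) = 0) ∧
      (∀ a b i : Fin (n + 1),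
        pd 0 (pd a (pd b (fermiChristoffel g γ e i 0 0))) (axis n s) = 0)) ∧
    -- the resulting structure of the wave map equations for `φ = (ℓ + u¹, u², …)`
    (∀ (d : ℕ) (ℓ : Coord d →L[ℝ] ℝ) (K : ℝ), ∃ C > 0, ∃ δ > 0,
      ∀ (u : Coord d → Coord n) (x : Coord d), |ℓ x| ≤ K → ContDiffAt ℝ 2 u x → ‖u x‖ ≤ δ →
      ∀ i : Fin (n + 1),
        |waveMapOp (fermiChristoffel g γ e) (fun z => axis n (ℓ z) + u z) i x
          - (box (fun z => u z i) x
            + linearPart (fermiChristoffel g γ e) ℓ u i x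
            + quadraticPart (fermiChristoffel g γ e) ℓ u i x
            + cubicPart (fermiChristoffel g γ e) ℓ u i x)|
          ≤ C * (‖u x‖ ^ 4 + ‖fderiv ℝ u x‖ ^ 4)) := by
  have hlocal := fun s₀ => exists_isFermiMetric hκ hγ he s₀
  -- Two derivatives of an odd function are odd, hence zero on the axis. This holds for all indices
  -- and gives the first two identities as well as the hypothesis on second derivatives below.
  have hodd : ∀ (p m i j k s), pd p (pd m (fermiChristoffel g γ e i j k)) (axis n s) = 0 := by
    intro p m i j k s
    obtain ⟨r, h⟩ := hlocal s
    have h1 := ((h.isFermiFun_christoffel i j k).pd m).pd p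
    rw [neg_neg] at h1
    exact h1.apply_axis (Metric.mem_ball_self h.pos)
  refine ⟨fun s => ?_, fun s => ?_, fun d ℓ K => ?_⟩
  · obtain ⟨ε, Z, h⟩ := exists_isFermiBall hγ he s
    obtain ⟨r, hr⟩ := hlocal s
    have h1 := h.fermiMap_axis h.axis_mem
    rw [axis_zero_coord] at h1
    exact ⟨h1, h.contMDiffAt _ h.axis_mem, h.bijective_mfderiv, fun k i j =>
      (hr.isFermiFun_christoffel k i j).contDiffAt _ (Metric.mem_ball_self hr.pos)⟩
  · obtain ⟨r, h⟩ := hlocal s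
    exact ⟨fun m i j => hodd _ _ _ _ _ s, fun p m i => hodd _ _ _ _ _ s, fun a b i =>
      (((h.isFermiFun_christoffel i 0 0).pd b).pd a).pd_zero (Metric.mem_ball_self h.pos)⟩
  · have hexp : HasOddExpansion (fermiChristoffel g γ e) (Set.Icc (-K) K) :=
      HasOddExpansion.of_isCompact (fun s => by
        obtain ⟨r, h⟩ := hlocal s
        exact ⟨_, Metric.ball_mem_nhds s (by linarith [h.pos]), h.hasOddExpansion⟩) isCompact_Icc
    obtain ⟨C, hC, δ, hδ, H⟩ := waveMapOp_expansion ℓ hexp fun m p i j s => hodd _ _ _ _ _ s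
    exact ⟨C, hC, δ, hδ, fun u x hx hu hux i => H u x (abs_le.1 hx) hu hux i⟩
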